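/- Let $n\ge 0$, let $G\subset Sp(2n,\mathbf C)$ be a finite group acting linearly on $\mathbf C^{2n}$, with projection $\pi:\mathbf C^{2n}\to X:=\mathbf C^{2n}/G$. Regard $X$ as a complex space with the quotient topology and structure sheaf $\mathcal O_X=(\pi_*\mathcal O_{\mathbf C^{2n}})^G$, write $0\in X$ for the image of the origin, and let $X_{reg}$ be the set of points at which $X$ is a complex manifold. A holomorphic symplectic form on the germ $(X,0)$ is represented by a closed, everywhere nondegenerate holomorphic 2-form on $U\cap X_{reg}$ for some open neighbourhood $U$ of $0$ in $X$. Then any two holomorphic symplectic forms $\omega,\omega'$ on $(X,0)$ are equivalent: there is an automorphism $\varphi$ of the germ $(X,0)$, i.e. a biholomorphic map $\varphi:W\to W'$ between open neighbourhoods of $0$ in $X$ with $\varphi(0)=0$, where $W$ and $W'$ are contained in the domains of definition of $\omega$ and $\omega'$ respectively, such that $\varphi^*\omega'=\omega$ on $W\cap X_{reg}$. -/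

import Mathlib

open scoped Topology Matrix

namespace QuotSing

/-- The affine space `ℂ²ⁿ`. -/
abbrev Space (n : ℕ) : Type := Fin n ⊕ Fin n → ℂ

/-- Two vectors of `ℂ²ⁿ` are equivalent if they lie in the same orbit of the subgroup
`G ⊂ Sp(2n, ℂ)` acting linearly. -/
def orbitSetoid {n : ℕ} (G : Subgroup (Matrix.symplecticGroup (Fin n) ℂ)) :
    Setoid (Space n) where
  r v w := ∃ g ∈ G, (g : Matrix (Fin n ⊕ Fin n) (Fin n ⊕ Fin n) ℂ) *ᵥ v = w
  iseqv :=
    { refl := fun v => ⟨1, G.one_mem, by simp⟩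
      symm := by
        rintro v w ⟨g, hg, rfl⟩
        refine ⟨g⁻¹, G.inv_mem hg, ?_⟩
        rw [Matrix.mulVec_mulVec]
        have h : ((g⁻¹ * g : Matrix.symplecticGroup (Fin n) ℂ) :
            Matrix (Fin n ⊕ Fin n) (Fin n ⊕ Fin n) ℂ) = 1 := by
          rw [inv_mul_cancel]; rfl
        rw [Submonoid.coe_mul] at h
        rw [h, Matrix.one_mulVec]
      trans := by
        rintro u v w ⟨g, hg, rfl⟩ ⟨h, hh, rfl⟩
        exact ⟨h * g, G.mul_mem hh hg, by rw [Matrix.mulVec_mulVec, Submonoid.coe_mul]⟩ }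

section

variable {n : ℕ} (G : Subgroup (Matrix.symplecticGroup (Fin n) ℂ))

/-- The orbit space `X = ℂ²ⁿ / G`, with the quotient topology. -/
abbrev OrbitSpace : Type := Quotient (orbitSetoid G)

/-- The projection `π : ℂ²ⁿ → X`. -/
def proj (v : Space n) : OrbitSpace G := Quotient.mk (orbitSetoid G) v

/-- The point `0 ∈ X`. -/
def origin : OrbitSpace G := proj G 0

/-- The structure sheaf `𝒪_X = (π_* 𝒪)^G` of the complex space `X`: a function on the open set
`U ⊆ X` is holomorphic iff its pull-back to `π⁻¹(U) ⊆ ℂ²ⁿ` is. (`X` is reduced, so its sections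
are honest functions. Only the values of `f` on `U` matter.) -/
def IsHolomorphicOn (f : OrbitSpace G → ℂ) (U : Set (OrbitSpace G)) : Prop :=
  AnalyticOnNhd ℂ (f ∘ proj G) (proj G ⁻¹' U)

/-- A holomorphic chart of `X`: a homeomorphism from an open subset of `X` onto an open subset of
`ℂ²ⁿ` that identifies the two structure sheaves. As `X` is of pure dimension `2n`, no other
dimension of the target can occur. -/
structure HolChart extends OpenPartialHomeomorph (OrbitSpace G) (Space n) where
  holomorphic_iff : ∀ U : Set (OrbitSpace G), IsOpen U → U ⊆ source → ∀ f : OrbitSpace G → ℂ,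
    (IsHolomorphicOn G f U ↔
      AnalyticOnNhd ℂ (f ∘ toOpenPartialHomeomorph.symm)
        (target ∩ toOpenPartialHomeomorph.symm ⁻¹' U))

/-- The regular locus `X_reg`: the points at which the complex space `X` is a complex manifold. -/
def regularLocus : Set (OrbitSpace G) := ⋃ e : HolChart G, e.source

/-- A holomorphic 2-form on the complex manifold `U ∩ X_reg`, for `U ⊆ X` open: a holomorphic
2-form in each chart, with the usual transformation rule on the overlap of two charts. (The values
of `form e` outside the image of `U` are irrelevant.) -/
structure TwoForm (U : Set (OrbitSpace G)) where
  form : HolChart G → Space n → (Space n) [⋀^Fin 2]→L[ℂ] ℂ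
  holomorphic : ∀ e : HolChart G,
    AnalyticOnNhd ℂ (form e) (e.target ∩ e.toOpenPartialHomeomorph.symm ⁻¹' U)
  compatible : ∀ e e' : HolChart G, ∀ x ∈ U, x ∈ e.source → x ∈ e'.source →
    form e (e.toOpenPartialHomeomorph x) =
      (form e' (e'.toOpenPartialHomeomorph x)).compContinuousLinearMap
        (fderiv ℂ (e'.toOpenPartialHomeomorph ∘ e.toOpenPartialHomeomorph.symm)
          (e.toOpenPartialHomeomorph x))

/-- A map `ψ : W → X`, `W ⊆ X` open, is holomorphic: it is continuous and pulls back holomorphic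
functions to holomorphic functions, i.e. it is a morphism of reduced complex spaces. -/
def IsHolomorphicMapOn (ψ : OrbitSpace G → OrbitSpace G) (W : Set (OrbitSpace G)) : Prop :=
  ContinuousOn ψ W ∧
    ∀ (U : Set (OrbitSpace G)) (f : OrbitSpace G → ℂ), IsOpen U → IsHolomorphicOn G f U →
      IsHolomorphicOn G (f ∘ ψ) (W ∩ ψ ⁻¹' U)

/-- (A representative of) an automorphism of the germ `(X, 0)`: a biholomorphic map between two
open neighbourhoods of `0` in `X` that fixes `0`. -/
structure GermAut extends OpenPartialHomeomorph (OrbitSpace G) (OrbitSpace G) where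
  origin_mem : origin G ∈ source
  map_origin : toOpenPartialHomeomorph (origin G) = origin G
  holomorphic : IsHolomorphicMapOn G toOpenPartialHomeomorph source
  holomorphic_symm : IsHolomorphicMapOn G toOpenPartialHomeomorph.symm target

end

section

variable {n : ℕ} {G : Subgroup (Matrix.symplecticGroup (Fin n) ℂ)}

/-- A holomorphic 2-form on `U ∩ X_reg` is symplectic if it is closed and everywhere
nondegenerate. -/
structure TwoForm.IsSymplectic {U : Set (OrbitSpace G)} (ω : TwoForm G U) : Prop where
  closed : ∀ e : HolChart G, ∀ x ∈ U, x ∈ e.source →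
    extDeriv (ω.form e) (e.toOpenPartialHomeomorph x) = 0
  nondegenerate : ∀ e : HolChart G, ∀ x ∈ U, x ∈ e.source → ∀ v : Space n,
    (∀ w : Space n, ω.form e (e.toOpenPartialHomeomorph x) ![v, w] = 0) → v = 0

/-- `φ^* ω' = ω` as germs at `0`: the map `φ` is defined on an open neighbourhood of `0` that lies
in the domain of `ω`, has its image in the domain of `ω'`, and the equality holds at every regular
point of the domain of `φ`; the pull-back is computed in charts. -/
def GermAut.PullsBack (φ : GermAut G) {U U' : Set (OrbitSpace G)}
    (ω' : TwoForm G U') (ω : TwoForm G U) : Prop :=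
  φ.source ⊆ U ∧ φ.target ⊆ U' ∧
    ∀ (e e' : HolChart G) (x : OrbitSpace G), x ∈ φ.source → x ∈ e.source →
      φ.toOpenPartialHomeomorph x ∈ e'.source →
      (ω'.form e' (e'.toOpenPartialHomeomorph
          (φ.toOpenPartialHomeomorph x))).compContinuousLinearMap
        (fderiv ℂ (e'.toOpenPartialHomeomorph ∘ φ.toOpenPartialHomeomorph ∘
            e.toOpenPartialHomeomorph.symm) (e.toOpenPartialHomeomorph x)) =
      ω.form e (e.toOpenPartialHomeomorph x)

end

end QuotSing

/-!
The two symplectic forms are compared on `V = ℂ²ⁿ`, where the projection `π : V → X` turns the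
problem into an equivariant one.

*Upstairs.* A nontrivial element of finite order of the symplectic group has a fixed space of
codimension at least two (`finrank_fixed_add_two_le`), so the set of points of `V` with trivial
stabilizer is the complement of finitely many such subspaces. There `π` is a local homeomorphism
whose local inverses are charts of `X` (`exists_holChart`), and a symplectic form `ω` on `X_reg`
pulls back to a `G`-invariant symplectic form. By Hartogs' theorem (`exists_analyticAt_extension`)
it extends to a neighbourhood of `0 ∈ V`, and so does its inverse; hence the extension is again
nondegenerate (`TwoForm.IsSymplectic.exists_extension`).

*Equivariant Darboux theorem* (`exists_equivariant_darboux`). An invariant symplectic form `B` near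
`0 ∈ V` is equivalent to the constant form `B 0` by a map that commutes with `G`. This is Moser's
method applied to the family `B (t x)` for small `t`, from which `B` is obtained by scaling. The
primitive given by the Poincaré lemma is invariant, hence so are the vector field and its flow; the
flow is analytic in the complex time and in the initial value.

*Linear algebra.* Two constant `G`-invariant symplectic forms `b₀ = b₁ (A ·, ·)` and `b₁` are
related by a square root of `A` that is a polynomial in `A`, and this square root commutes with `G`
(`exists_commuting_isometry`).

The composition of these maps is a `G`-equivariant biholomorphic germ `Φ` at `0 ∈ V`, which descends
to an automorphism of the germ `(X, 0)` (`exists_germAut`). It identifies the two forms at the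
images of the points with trivial stabilizer. These are dense, so by continuity it does so in every chart
of `X` (`TwoForm.IsSymplectic.pullsBack`).

Analyticity in several variables rests on a form of Osgood's lemma (`analyticOnNhd_of_separating`),
which yields the analyticity of integrals depending on a parameter and of uniform limits.
-/

namespace QuotSing

/-! ### Osgood's lemma and integrals with parameters -/

section Osgood

open Metric Set

variable {F F' : Type*} [NormedAddCommGroup F] [NormedSpace ℂ F]
  [NormedAddCommGroup F'] [NormedSpace ℂ F']

theorem differentiableAt_line {E : Type*} [NormedAddCommGroup E] [NormedSpace ℂ E]
    {f : E → F} {x : E} (h : AnalyticAt ℂ f x) (v : E) :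
    DifferentiableAt ℂ (fun ζ : ℂ => f (x + ζ • v)) 0 := by
  have h1 : DifferentiableAt ℂ (fun ζ : ℂ => x + ζ • v) 0 := by fun_prop
  exact DifferentiableAt.comp (g := f) 0 (by simpa using h.differentiableAt) h1

/-- Integration over a compact set, as a continuous linear map on the continuous functions. -/
noncomputable def integralCLM {X : Type*} [TopologicalSpace X] [T2Space X] [MeasurableSpace X]
    [BorelSpace X] (K : Set X) [CompactSpace K] (μ : MeasureTheory.Measure X)
    [MeasureTheory.IsFiniteMeasureOnCompacts μ] : C(K, F) →L[ℂ] F :=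
  have hμ : MeasureTheory.IsFiniteMeasure
      (MeasureTheory.Measure.comap (Subtype.val : K → X) μ) := by
    have hK : IsCompact K := isCompact_iff_compactSpace.mpr inferInstance
    constructor
    rw [MeasureTheory.Measure.comap_apply _ Subtype.val_injective _ _ MeasurableSet.univ]
    · rw [image_univ, Subtype.range_coe]
      exact hK.measure_lt_top
    · exact fun s hs => hK.measurableSet.subtype_image hs
  LinearMap.mkContinuous
    { toFun := fun g => ∫ θ, g θ ∂(MeasureTheory.Measure.comap (Subtype.val : K → X) μ)
      map_add' := fun g h => MeasureTheory.integral_add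
        (g.continuous.integrable_of_hasCompactSupport (HasCompactSupport.of_compactSpace _))
        (h.continuous.integrable_of_hasCompactSupport (HasCompactSupport.of_compactSpace _))
      map_smul' := fun c g => MeasureTheory.integral_smul c _ }
    ((MeasureTheory.Measure.comap (Subtype.val : K → X) μ).real univ) (fun g => by
      rw [mul_comm]
      exact MeasureTheory.norm_integral_le_of_norm_le_const
        (Filter.Eventually.of_forall fun θ => g.norm_coe_le_norm θ))

theorem integralCLM_apply {X : Type*} [TopologicalSpace X] [T2Space X] [MeasurableSpace X]
    [BorelSpace X] (K : Set X) [CompactSpace K] (μ : MeasureTheory.Measure X)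
    [MeasureTheory.IsFiniteMeasureOnCompacts μ] (g : C(K, F)) :
    integralCLM K μ g = ∫ θ, g θ ∂(MeasureTheory.Measure.comap (Subtype.val : K → X) μ) := rfl

/-- The torus of polyradius `(R, …, R)` lies in every larger polydisc. -/
theorem torusMap_mem_ball {n : ℕ} {r R : ℝ} (hR : 0 < R) (hRr : R < r) (θ : Fin n → ℝ) :
    torusMap 0 (fun _ => R) θ ∈ ball (0 : Fin n → ℂ) r := by
  rw [mem_ball_zero_iff, pi_norm_lt_iff (hR.trans hRr)]
  intro i
  simpa [torusMap, abs_of_pos hR] using hRr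

theorem continuous_torusMap {n : ℕ} (c : Fin n → ℂ) (R : Fin n → ℝ) :
    Continuous (torusMap c R) := by
  unfold torusMap
  fun_prop

theorem continuous_torusMap_apply {n : ℕ} (c : Fin n → ℂ) (R : Fin n → ℝ) (i : Fin n) :
    Continuous fun θ => torusMap c R θ i := by
  unfold torusMap
  fun_prop

theorem torusMap_sub_ne_zero {n : ℕ} {R : ℝ} (hR : 0 < R) {z : Fin n → ℂ}
    (hz : z ∈ ball (0 : Fin n → ℂ) R) (θ : Fin n → ℝ) (i : Fin n) :
    torusMap 0 (fun _ => R) θ i - z i ≠ 0 := by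
  intro h
  rw [mem_ball_zero_iff, pi_norm_lt_iff hR] at hz
  have h1 := hz i
  rw [← sub_eq_zero.mp h] at h1
  simp [torusMap, abs_of_pos hR] at h1

/-- The Cauchy transform of a continuous function on a torus is analytic in the polydisc: the
integrand is the image under a continuous linear map of the product of a fixed function by inverses
in the Banach algebra of continuous functions on the torus. -/
theorem analyticAt_torusIntegral {n : ℕ} {R : ℝ} (hR : 0 < R) {f : (Fin n → ℂ) → F}
    (hf : Continuous fun θ : Fin n → ℝ => f (torusMap 0 (fun _ => R) θ))
    {z : Fin n → ℂ} (hz : z ∈ ball (0 : Fin n → ℂ) R) :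
    AnalyticAt ℂ (fun z : Fin n → ℂ =>
      torusIntegral (fun x => (∏ i, (x i - z i)⁻¹) • f x) 0 (fun _ => R)) z := by
  let K : Set (Fin n → ℝ) := Icc 0 fun _ => 2 * Real.pi
  have : CompactSpace K := isCompact_iff_compactSpace.mp isCompact_Icc
  let u : Fin n → C(K, ℂ) := fun i => ⟨fun θ => torusMap 0 (fun _ => R) θ.1 i,
    (continuous_torusMap_apply 0 (fun _ => R) i).comp continuous_subtype_val⟩
  have hprod : Continuous fun θ : Fin n → ℝ =>
      (∏ i, R * Complex.exp (θ i * Complex.I) * Complex.I : ℂ) := by fun_prop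
  let g : C(K, F) := ⟨fun θ => (∏ i, R * Complex.exp (θ.1 i * Complex.I) * Complex.I : ℂ) •
      f (torusMap 0 (fun _ => R) θ.1), by
    exact Continuous.smul (hprod.comp continuous_subtype_val) (hf.comp continuous_subtype_val)⟩
  let k : (Fin n → ℂ) → C(K, ℂ) := fun w => ∏ i, Ring.inverse (u i - w i • 1)
  let M : C(K, ℂ) →L[ℂ] C(K, F) := LinearMap.mkContinuous
    { toFun := fun h => h • g
      map_add' := fun h h' => add_smul h h' g
      map_smul' := fun c h => by ext θ; exact mul_smul c (h θ) (g θ) } ‖g‖ (fun h => by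
        refine (ContinuousMap.norm_le _ (by positivity)).mpr fun θ => ?_
        rw [mul_comm]
        refine (norm_smul_le (h θ) (g θ)).trans ?_
        gcongr
        · exact h.norm_coe_le_norm θ
        · exact g.norm_coe_le_norm θ)
  have hunit : ∀ w ∈ ball (0 : Fin n → ℂ) R, ∀ i, ∃ e : C(K, ℂ)ˣ,
      (e : C(K, ℂ)) = u i - w i • 1 ∧
      ∀ θ, (↑e⁻¹ : C(K, ℂ)) θ = (torusMap 0 (fun _ => R) θ.1 i - w i)⁻¹ := by
    intro w hw i
    have hne := fun θ : K => torusMap_sub_ne_zero hR hw θ.1 i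
    have hcont : Continuous fun θ : K => torusMap 0 (fun _ => R) θ.1 i - w i :=
      (u i).continuous.sub continuous_const
    refine ⟨⟨u i - w i • 1, ⟨_, hcont.inv₀ hne⟩, ?_, ?_⟩, rfl, fun θ => rfl⟩
    · ext θ
      simpa [u] using mul_inv_cancel₀ (hne θ)
    · ext θ
      simpa [u] using inv_mul_cancel₀ (hne θ)
  have hk : AnalyticAt ℂ k z := by
    refine Finset.analyticAt_fun_prod _ fun i _ => ?_
    obtain ⟨e, he, -⟩ := hunit z hz i
    have h1 : AnalyticAt ℂ (Ring.inverse : C(K, ℂ) → _) (u i - z i • 1) := by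
      rw [← he]
      exact analyticAt_inverse e
    have h2 : AnalyticAt ℂ (fun w : Fin n → ℂ => u i - w i • (1 : C(K, ℂ))) z := by
      refine analyticAt_const.sub ?_
      exact ((ContinuousLinearMap.toSpanSingleton ℂ (1 : C(K, ℂ))).comp
        (ContinuousLinearMap.proj i : (Fin n → ℂ) →L[ℂ] ℂ)).analyticAt z
    exact AnalyticAt.fun_comp h1 h2
  have hmain : AnalyticAt ℂ (fun w => integralCLM K MeasureTheory.volume (M (k w))) z :=
    (ContinuousLinearMap.analyticAt _ _).fun_comp ((M.analyticAt _).fun_comp hk)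
  refine hmain.congr ?_
  filter_upwards [isOpen_ball.mem_nhds hz] with w hw
  rw [integralCLM_apply, torusIntegral,
    ← MeasureTheory.integral_subtype_comap measurableSet_Icc]
  refine MeasureTheory.integral_congr_ae (Filter.Eventually.of_forall fun θ => ?_)
  have hkθ : k w θ = ∏ i, (torusMap 0 (fun _ => R) θ.1 i - w i)⁻¹ := by
    simp only [k, ContinuousMap.prod_apply]
    refine Finset.prod_congr rfl fun i _ => ?_
    obtain ⟨e, he, he'⟩ := hunit w hw i
    rw [← he, Ring.inverse_unit, he']
  change k w θ • g θ = _
  rw [hkθ]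
  simp only [g, ContinuousMap.coe_mk]
  rw [smul_comm]

variable [CompleteSpace F] [CompleteSpace F']

/-- Cauchy's integral formula on a polydisc, for a continuous function that is holomorphic on
complex lines: the formula in one variable is applied to each coordinate in turn. -/
theorem torusIntegral_prod_inv_smul {n : ℕ} {r R : ℝ} (hR : 0 < R) (hRr : R < r)
    {f : (Fin n → ℂ) → F} (hc : ContinuousOn f (ball 0 r))
    (hd : ∀ x ∈ ball (0 : Fin n → ℂ) r, ∀ v,
      DifferentiableAt ℂ (fun ζ : ℂ => f (x + ζ • v)) 0)
    {z : Fin n → ℂ} (hz : z ∈ ball (0 : Fin n → ℂ) R) :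
    torusIntegral (fun x => (∏ i, (x i - z i)⁻¹) • f x) 0 (fun _ => R) =
      (2 * Real.pi * Complex.I) ^ n • f z := by
  induction n with
  | zero => simp [Subsingleton.elim z 0]
  | succ n ih =>
    have hr : 0 < r := hR.trans hRr
    have hint : TorusIntegrable (fun x => (∏ i, (x i - z i)⁻¹) • f x) 0 (fun _ => R) := by
      refine (Continuous.continuousOn ?_).integrableOn_compact isCompact_Icc
      refine Continuous.smul ?_ ?_
      · refine continuous_finsetProd _ fun i _ => Continuous.inv₀ ?_ ?_
        · exact (continuous_torusMap_apply _ _ i).sub continuous_const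
        · exact fun θ => torusMap_sub_ne_zero hR hz θ i
      · exact hc.comp_continuous (continuous_torusMap _ _) (torusMap_mem_ball hR hRr)
    have cons_mem : ∀ {s : ℝ}, 0 < s → ∀ {a : ℂ} {w : Fin n → ℂ}, ‖a‖ < s →
        w ∈ ball (0 : Fin n → ℂ) s → (Fin.cons a w : Fin (n + 1) → ℂ) ∈ ball 0 s := by
      intro s hs a w ha hw
      rw [mem_ball_zero_iff, pi_norm_lt_iff hs] at hw ⊢
      intro i
      refine Fin.cases ?_ (fun j => ?_) i
      · simpa using ha
      · simpa using hw j
    have hz' : Fin.tail z ∈ ball (0 : Fin n → ℂ) R ∧ ‖z 0‖ < R := by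
      rw [mem_ball_zero_iff, pi_norm_lt_iff hR] at hz
      refine ⟨?_, hz 0⟩
      rw [mem_ball_zero_iff, pi_norm_lt_iff hR]
      exact fun i => hz i.succ
    have hcons_cont' : ∀ a : ℂ, Continuous fun w : Fin n → ℂ => (Fin.cons a w : Fin (n + 1) → ℂ) :=
      fun a => continuous_pi fun i => Fin.cases (by simpa using continuous_const)
        (fun j => by simpa using continuous_apply j) i
    rw [torusIntegral_succ hint]
    have inner : ∀ x ∈ sphere (0 : ℂ) R,
        torusIntegral (fun y : Fin n → ℂ => (∏ i, ((Fin.cons x y : Fin (n + 1) → ℂ) i - z i)⁻¹) •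
          f (Fin.cons x y)) 0 (fun _ => R) =
        (x - z 0)⁻¹ • (2 * Real.pi * Complex.I) ^ n • f (Fin.cons x (Fin.tail z)) := by
      intro x hx
      have hxr : ‖x‖ < r := by
        rw [mem_sphere_zero_iff_norm] at hx
        linarith
      have := ih (f := fun y => f (Fin.cons x y))
        (hc.comp (hcons_cont' x).continuousOn fun w hw => cons_mem hr hxr hw)
        (by
          intro w hw v
          have h := hd _ (cons_mem hr hxr hw) (Fin.cons 0 v)
          refine h.congr_of_eventuallyEq (Filter.Eventually.of_forall fun ζ => ?_)
          simp only
          congr 1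
          ext i
          refine Fin.cases ?_ (fun j => ?_) i <;> simp)
        hz'.1
      rw [← this, ← torusIntegral_smul]
      congr 1
      ext y
      rw [Fin.prod_univ_succ, smul_smul]
      simp [Fin.tail]
    have e1 : ((0 : Fin (n + 1) → ℂ) ∘ Fin.succ) = 0 := rfl
    have e2 : ((fun _ : Fin (n + 1) => R) ∘ Fin.succ) = fun _ => R := rfl
    rw [e1, e2, Pi.zero_apply, circleIntegral.integral_congr hR.le inner]
    have hdc : DiffContOnCl ℂ (fun x : ℂ => (2 * Real.pi * Complex.I) ^ n •
        f (Fin.cons x (Fin.tail z))) (ball 0 R) := by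
      have hzr : Fin.tail z ∈ ball (0 : Fin n → ℂ) r := ball_subset_ball hRr.le hz'.1
      refine DifferentiableOn.diffContOnCl (DifferentiableOn.const_smul ?_ _)
      intro x hx
      rw [closure_ball _ hR.ne', mem_closedBall_zero_iff] at hx
      have h := hd _ (cons_mem hr (hx.trans_lt hRr) hzr) (Fin.cons 1 0)
      refine DifferentiableAt.differentiableWithinAt ?_
      have h2 : DifferentiableAt ℂ (fun y : ℂ => y - x) x := by fun_prop
      refine (DifferentiableAt.comp x (by rwa [sub_self]) h2).congr_of_eventuallyEq
        (Filter.Eventually.of_forall fun y => ?_)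
      simp only [Function.comp]
      congr 1
      ext i
      refine Fin.cases ?_ (fun j => ?_) i <;> simp
    rw [hdc.circleIntegral_sub_inv_smul (by simpa using hz'.2), smul_smul, ← pow_succ']
    congr 2
    exact Fin.cons_self_tail z

/-- Osgood's lemma, in a weak form: a continuous map `f` into a Banach space is analytic at `0` if
`ℓ i ∘ f` is holomorphic on complex lines for a separating family `ℓ` of continuous linear maps.
Indeed, `f` is then the Cauchy transform of its values on a torus. -/
theorem analyticAt_zero_of_separating {n : ℕ} {ι : Type*} {r : ℝ} (hr : 0 < r)
    {f : (Fin n → ℂ) → F'} (hc : ContinuousOn f (ball 0 r)) (ℓ : ι → F' →L[ℂ] F)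
    (hsep : ∀ a b, (∀ i, ℓ i a = ℓ i b) → a = b)
    (hd : ∀ i, ∀ x ∈ ball (0 : Fin n → ℂ) r, ∀ v,
      DifferentiableAt ℂ (fun ζ : ℂ => ℓ i (f (x + ζ • v))) 0) :
    AnalyticAt ℂ f 0 := by
  have hR : 0 < r / 2 := half_pos hr
  have hRr : r / 2 < r := half_lt_self hr
  have hcont : Continuous fun θ : Fin n → ℝ => f (torusMap 0 (fun _ => r / 2) θ) :=
    hc.comp_continuous (continuous_torusMap _ _) (torusMap_mem_ball hR hRr)
  have hana := (analyticAt_torusIntegral hR hcont (mem_ball_self hR)).const_smul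
    (c := ((2 * Real.pi * Complex.I) ^ n : ℂ)⁻¹)
  refine hana.congr ?_
  filter_upwards [ball_mem_nhds _ hR] with w hw
  apply hsep
  intro i
  have hCauchy := torusIntegral_prod_inv_smul hR hRr ((ℓ i).continuous.comp_continuousOn hc)
    (hd i) hw
  have hcomm : ℓ i (torusIntegral (fun x => (∏ i, (x i - w i)⁻¹) • f x) 0 (fun _ => r / 2)) =
      torusIntegral (fun x => (∏ i, (x i - w i)⁻¹) • (ℓ i ∘ f) x) 0 (fun _ => r / 2) := by
    rw [torusIntegral, ← ContinuousLinearMap.integral_comp_comm]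
    · simp only [map_smul, torusIntegral, Function.comp]
    · refine (Continuous.continuousOn ?_).integrableOn_compact isCompact_Icc
      refine Continuous.smul (by fun_prop) (Continuous.smul ?_ hcont)
      refine continuous_finsetProd _ fun i _ => Continuous.inv₀ ?_ ?_
      · exact (continuous_torusMap_apply _ _ i).sub continuous_const
      · exact fun θ => torusMap_sub_ne_zero hR hw θ i
  have hne : ((2 * Real.pi * Complex.I) ^ n : ℂ) ≠ 0 := pow_ne_zero _ Complex.two_pi_I_ne_zero
  rw [Pi.smul_apply, map_smul, hcomm, hCauchy, smul_smul, inv_mul_cancel₀ hne, one_smul]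
  rfl

variable {E : Type*} [NormedAddCommGroup E] [NormedSpace ℂ E] [FiniteDimensional ℂ E]

/-- The version of `analyticAt_zero_of_separating` on an open subset of a finite-dimensional
space. -/
theorem analyticOnNhd_of_separating {ι : Type*} {U : Set E} (hU : IsOpen U) {f : E → F'}
    (hc : ContinuousOn f U) (ℓ : ι → F' →L[ℂ] F) (hsep : ∀ a b, (∀ i, ℓ i a = ℓ i b) → a = b)
    (hd : ∀ i, ∀ x ∈ U, ∀ v, DifferentiableAt ℂ (fun ζ : ℂ => ℓ i (f (x + ζ • v))) 0) :
    AnalyticOnNhd ℂ f U := by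
  intro x hx
  let e : E ≃L[ℂ] (Fin (Module.finrank ℂ E) → ℂ) := (Module.finBasis ℂ E).equivFunL
  have hT : Continuous fun w => x + e.symm w := by fun_prop
  obtain ⟨r, hr, hball⟩ := Metric.isOpen_iff.mp (hU.preimage hT) 0 (by simpa using hx)
  have h0 := analyticAt_zero_of_separating hr (f := fun w => f (x + e.symm w))
    (hc.comp hT.continuousOn hball) ℓ hsep (by
      intro i w hw v
      simpa [add_assoc] using hd i _ (hball hw) (e.symm v))
  have h1 : AnalyticAt ℂ (fun y => e (y - x)) x :=
    (e.toContinuousLinearMap.analyticAt _).fun_comp (analyticAt_id.sub analyticAt_const)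
  refine (AnalyticAt.fun_comp_of_eq h0 h1 (by simp)).congr (Filter.Eventually.of_forall fun y => ?_)
  simp

/-- **Osgood's lemma**: a continuous function on an open subset of a finite-dimensional complex
space is analytic if it is holomorphic on complex lines. -/
theorem analyticOnNhd_of_continuousOn_of_lines {U : Set E} (hU : IsOpen U) {f : E → F}
    (hc : ContinuousOn f U)
    (hd : ∀ x ∈ U, ∀ v, DifferentiableAt ℂ (fun ζ : ℂ => f (x + ζ • v)) 0) :
    AnalyticOnNhd ℂ f U :=
  analyticOnNhd_of_separating hU hc (fun _ : Unit => ContinuousLinearMap.id ℂ F)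
    (fun _ _ h => h ()) (fun _ => hd)

/-- An integral of analytic functions that depend continuously on the parameter is analytic: the
integrand is an analytic map to the continuous functions of the parameter, since the evaluations
form a separating family. -/
theorem analyticOnNhd_intervalIntegral {U : Set E} (hU : IsOpen U) {a b : ℝ} (hab : a ≤ b)
    {H : ℝ → E → F} (hc : ContinuousOn (fun p : ℝ × E => H p.1 p.2) (Icc a b ×ˢ U))
    (ha : ∀ s ∈ Icc a b, AnalyticOnNhd ℂ (H s) U) :
    AnalyticOnNhd ℂ (fun x => ∫ s in a..b, H s x) U := by
  classical
  have hcs : CompactSpace (Icc a b) := isCompact_iff_compactSpace.mp isCompact_Icc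
  have hcont : Continuous fun p : U × Icc a b => H p.2 p.1 :=
    hc.comp_continuous (f := fun p : U × Icc a b => ((p.2 : ℝ), (p.1 : E))) (by fun_prop)
      fun p => ⟨p.2.2, p.1.2⟩
  let f : E → C(Icc a b, F) := fun x =>
    if h : x ∈ U then (ContinuousMap.curry ⟨_, hcont⟩) ⟨x, h⟩ else 0
  have hf : ∀ x ∈ U, ∀ s, f x s = H s x := fun x hx s => by simp [f, hx]
  have hana : AnalyticOnNhd ℂ f U := by
    refine analyticOnNhd_of_separating hU ?_ (fun s => ContinuousMap.evalCLM ℂ s)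
      (fun g h hgh => ContinuousMap.ext hgh) ?_
    · rw [continuousOn_iff_continuous_domRestrict]
      refine (ContinuousMap.curry ⟨_, hcont⟩).continuous.congr fun x => ?_
      simp [f, x.2]
    · intro s x hx v
      refine (differentiableAt_line (ha s s.2 x hx) v).congr_of_eventuallyEq ?_
      have hev : ∀ᶠ ζ : ℂ in 𝓝 0, x + ζ • v ∈ U :=
        (hU.preimage (by fun_prop : Continuous fun ζ : ℂ => x + ζ • v)).mem_nhds (by simpa using hx)
      filter_upwards [hev] with ζ hζ
      exact hf _ hζ s
  intro x hx
  have h1 := ((integralCLM (F := F) (Icc a b) MeasureTheory.volume).analyticAt (f x)).fun_comp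
    (hana x hx)
  refine h1.congr ?_
  filter_upwards [hU.mem_nhds hx] with y hy
  rw [integralCLM_apply, intervalIntegral.integral_of_le hab,
    ← MeasureTheory.integral_Icc_eq_integral_Ioc,
    ← MeasureTheory.integral_subtype_comap measurableSet_Icc]
  exact MeasureTheory.integral_congr_ae (Filter.Eventually.of_forall fun s => hf y hy s)

end Osgood

/-! ### Hartogs' theorem -/

section Hartogs

open Metric Set

variable {V : Type*} [NormedAddCommGroup V] [NormedSpace ℂ V] [FiniteDimensional ℂ V]

/-- The complement of a finite union of proper subspaces is dense. -/
theorem dense_forall_notMem_submodule {ι : Type*} [Finite ι] (L : ι → Submodule ℂ V)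
    (hL : ∀ i, L i ≠ ⊤) : Dense {x : V | ∀ i, x ∉ L i} := by
  have : CompleteSpace V := FiniteDimensional.complete ℂ V
  have h : {x : V | ∀ i, x ∉ L i} = ⋂ i, (L i : Set V)ᶜ := by
    ext x
    simp
  rw [h]
  refine dense_iInter_of_isOpen (fun i => (L i).closed_of_finiteDimensional.isOpen_compl)
    fun i => ?_
  rw [← interior_eq_empty_iff_dense_compl]
  by_contra hne
  exact hL i (Submodule.eq_top_of_nonempty_interior' _ (nonempty_iff_ne_empty.mpr hne))

theorem isOpen_forall_notMem_submodule {ι : Type*} [Finite ι] (L : ι → Submodule ℂ V) :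
    IsOpen {x : V | ∀ i, x ∉ L i} := by
  have h : {x : V | ∀ i, x ∉ L i} = ⋂ i, (L i : Set V)ᶜ := by
    ext x
    simp
  rw [h]
  exact isOpen_iInter_of_finite fun i => (L i).closed_of_finiteDimensional.isOpen_compl

/-- **Hartogs' extension theorem** across a finite union of subspaces of codimension at least two:
the extension is the mean over the circles `x + ζ • v`, `‖ζ‖ = r`, for a vector `v` outside the
subspaces. -/
theorem exists_analyticAt_extension {F : Type*} [NormedAddCommGroup F] [NormedSpace ℂ F]
    [CompleteSpace F] {ι : Type*} [Finite ι] (L : ι → Submodule ℂ V)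
    (hL : ∀ i, Module.finrank ℂ (L i) + 2 ≤ Module.finrank ℂ V) {f : V → F} {N : Set V}
    (hN : IsOpen N) (h0 : (0 : V) ∈ N)
    (hf : AnalyticOnNhd ℂ f (N ∩ {x | ∀ i, x ∉ L i})) :
    ∃ g : V → F, AnalyticAt ℂ g 0 ∧ ∀ᶠ x in 𝓝 0, (∀ i, x ∉ L i) → g x = f x := by
  have hLtop : ∀ i, L i ≠ ⊤ := fun i h => by
    have := hL i
    rw [h, finrank_top] at this
    omega
  -- The vector `v` avoids all the `L i`, so the circles around points close to `0` avoid them too.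
  obtain ⟨v, hv⟩ := (dense_forall_notMem_submodule L hLtop).nonempty
  have hL' : ∀ i, L i ⊔ Submodule.span ℂ {v} ≠ ⊤ := fun i h => by
    have h1 := Submodule.finrank_add_le_finrank_add_finrank (L i) (Submodule.span ℂ {v})
    rw [h, finrank_top] at h1
    have h2 : Module.finrank ℂ (Submodule.span ℂ {v}) ≤ 1 := by
      simpa using finrank_span_le_card (R := ℂ) ({v} : Set V)
    have := hL i
    omega
  obtain ⟨ρ, hρ, hball⟩ := Metric.isOpen_iff.mp hN 0 h0
  obtain ⟨r, hr, hrv⟩ : ∃ r : ℝ, 0 < r ∧ r * ‖v‖ < ρ / 2 := by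
    refine ⟨ρ / 2 / (‖v‖ + 1), by positivity, ?_⟩
    rw [div_mul_eq_mul_div, div_lt_iff₀ (by positivity)]
    nlinarith [norm_nonneg v]
  have hmem : ∀ x ∈ ball (0 : V) (ρ / 2), ∀ ζ : ℂ, ‖ζ‖ ≤ r → x + ζ • v ∈ N := by
    intro x hx ζ hζ
    apply hball
    rw [mem_ball_zero_iff] at hx ⊢
    calc ‖x + ζ • v‖ ≤ ‖x‖ + ‖ζ‖ * ‖v‖ := by
          rw [← norm_smul]
          exact norm_add_le _ _
      _ < ρ := by nlinarith [norm_nonneg v]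
  have hopen := isOpen_forall_notMem_submodule L
  have htube : ∀ᶠ x in 𝓝 (0 : V), ∀ ζ ∈ sphere (0 : ℂ) r, ∀ i, x + ζ • v ∉ L i := by
    refine (isCompact_sphere _ _).eventually_forall_of_forall_eventually fun ζ hζ => ?_
    have hcont : Continuous fun p : V × ℂ => p.1 + p.2 • v := by fun_prop
    refine (hopen.preimage hcont).mem_nhds ?_
    intro i
    simp only [zero_add]
    rw [Submodule.smul_mem_iff _ (ne_zero_of_mem_sphere hr.ne' ⟨ζ, hζ⟩)]
    exact hv i
  obtain ⟨δ, hδ, hδball⟩ := Metric.eventually_nhds_iff_ball.mp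
    (htube.and (ball_mem_nhds (0 : V) (half_pos hρ)))
  have hcircle : ∀ x ∈ ball (0 : V) δ, ∀ θ,
      x + circleMap 0 r θ • v ∈ N ∩ {x | ∀ i, x ∉ L i} := fun x hx θ =>
    ⟨hmem x (hδball x hx).2 _ (by simp [abs_of_pos hr]),
      (hδball x hx).1 _ (circleMap_mem_sphere 0 hr.le θ)⟩
  have hNopen : IsOpen (N ∩ {x | ∀ i, x ∉ L i}) := hN.inter hopen
  let g : V → F := fun x =>
    (2 * Real.pi * Complex.I : ℂ)⁻¹ • ∮ ζ in C(0, r), (ζ - 0)⁻¹ • f (x + ζ • v)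
  have hg : AnalyticOnNhd ℂ g (ball 0 δ) := by
    refine AnalyticOnNhd.const_smul (c := (2 * Real.pi * Complex.I : ℂ)⁻¹)
      (f := fun x => ∮ ζ in C(0, r), (ζ - 0)⁻¹ • f (x + ζ • v)) ?_
    refine analyticOnNhd_intervalIntegral isOpen_ball Real.two_pi_pos.le
      (H := fun θ x => deriv (circleMap 0 r) θ •
        (circleMap 0 r θ - 0)⁻¹ • f (x + circleMap 0 r θ • v)) ?_ ?_
    · have h1 : Continuous fun p : ℝ × V => deriv (circleMap 0 r) p.1 := by
        simp only [deriv_circleMap]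
        fun_prop
      have h2 : Continuous fun p : ℝ × V => (circleMap 0 r p.1 - 0)⁻¹ := by
        refine Continuous.inv₀ (by fun_prop) fun p => ?_
        rw [sub_zero]
        exact circleMap_ne_center hr.ne'
      have h3 : ContinuousOn (fun p : ℝ × V => f (p.2 + circleMap 0 r p.1 • v))
          (Icc 0 (2 * Real.pi) ×ˢ ball 0 δ) := by
        refine hf.continuousOn.comp (Continuous.continuousOn (by fun_prop)) fun p hp => ?_
        exact hcircle p.2 hp.2 p.1
      exact h1.continuousOn.smul (h2.continuousOn.smul h3)
    · intro θ _ x hx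
      refine AnalyticAt.const_smul (AnalyticAt.const_smul ?_)
      exact AnalyticAt.fun_comp (hf _ (hcircle x hx θ)) (analyticAt_id.add analyticAt_const)
  -- If `x` lies in no `L i + ℂ v`, the whole line `x + ℂ v` avoids the subspaces and `f` has the
  -- mean value property on it. As `L i` has codimension at least two, such points are dense.
  have hgf : ∀ x ∈ ball (0 : V) δ ∩ {x | ∀ i, x ∉ L i ⊔ Submodule.span ℂ {v}},
      g x = f x := by
    rintro x ⟨hx, hxL⟩
    have hline : ∀ ζ : ℂ, ∀ i, x + ζ • v ∉ L i := by
      intro ζ i h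
      apply hxL i
      have : x = (x + ζ • v) + (-ζ) • v := by rw [neg_smul, add_neg_cancel_right]
      rw [this]
      exact Submodule.add_mem_sup h (Submodule.smul_mem _ _ (Submodule.mem_span_singleton_self v))
    have hdc : DiffContOnCl ℂ (fun ζ : ℂ => f (x + ζ • v)) (ball 0 r) := by
      refine DifferentiableOn.diffContOnCl fun ζ hζ => ?_
      rw [closure_ball _ hr.ne', mem_closedBall_zero_iff] at hζ
      have h1 : DifferentiableAt ℂ (fun ζ : ℂ => x + ζ • v) ζ := by fun_prop
      exact (DifferentiableAt.comp (g := f) ζ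
        (hf _ ⟨hmem x (hδball x hx).2 ζ hζ, hline ζ⟩).differentiableAt h1).differentiableWithinAt
    simp only [g]
    rw [hdc.circleIntegral_sub_inv_smul (by simpa using hr), smul_smul,
      inv_mul_cancel₀ Complex.two_pi_I_ne_zero, one_smul, zero_smul, add_zero]
  refine ⟨g, hg 0 (mem_ball_self hδ), ?_⟩
  have hEq : EqOn g f (ball 0 δ ∩ {x | ∀ i, x ∉ L i}) := by
    refine EqOn.of_subset_closure
      (s := (ball 0 δ ∩ {x | ∀ i, x ∉ L i}) ∩ {x | ∀ i, x ∉ L i ⊔ Submodule.span ℂ {v}})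
      (fun x hx => hgf x ⟨hx.1.1, hx.2⟩) (hg.continuousOn.mono inter_subset_left) ?_
      inter_subset_left ?_
    · refine hf.continuousOn.mono fun x hx => ⟨?_, hx.2⟩
      simpa using hmem x (hδball x hx.1).2 0 (by simpa using hr.le)
    · exact (dense_forall_notMem_submodule _ hL').open_subset_closure_inter
        (isOpen_ball.inter hopen)
  filter_upwards [ball_mem_nhds (0 : V) hδ] with x hx hxL
  exact hEq ⟨hx, hxL⟩

end Hartogs

/-! ### Analytic differential equations in complex time -/

section Flow

open Metric Set Filter

/-- A uniform limit of analytic functions on an open subset of a finite-dimensional complex space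
is analytic. -/
theorem analyticOnNhd_of_tendstoUniformlyOn {E F : Type*} [NormedAddCommGroup E] [NormedSpace ℂ E]
    [FiniteDimensional ℂ E] [NormedAddCommGroup F] [NormedSpace ℂ F] [CompleteSpace F]
    {U : Set E} (hU : IsOpen U) {φ : ℕ → E → F} {f : E → F}
    (hφ : ∀ k, AnalyticOnNhd ℂ (φ k) U) (hlim : TendstoUniformlyOn φ f atTop U) :
    AnalyticOnNhd ℂ f U := by
  refine analyticOnNhd_of_continuousOn_of_lines hU
    (hlim.continuousOn (Frequently.of_forall fun k => (hφ k).continuousOn)) fun x hx v => ?_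
  have hcont : Continuous fun ζ : ℂ => x + ζ • v := by fun_prop
  have hopen : IsOpen ((fun ζ : ℂ => x + ζ • v) ⁻¹' U) := hU.preimage hcont
  have h0 : (0 : ℂ) ∈ (fun ζ : ℂ => x + ζ • v) ⁻¹' U := by simpa using hx
  have h1 := (hlim.comp fun ζ : ℂ => x + ζ • v).tendstoLocallyUniformlyOn.differentiableOn
    (Eventually.of_forall fun k ζ hζ => ?_) hopen
  · exact (h1 0 h0).differentiableAt (hopen.mem_nhds h0)
  · have hd : DifferentiableAt ℂ (fun ζ : ℂ => x + ζ • v) ζ := by fun_prop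
    exact (DifferentiableAt.comp (g := φ k) ζ
      (hφ k _ hζ).differentiableAt hd).differentiableWithinAt

variable {V : Type*} [NormedAddCommGroup V] [NormedSpace ℂ V]

/-- The Picard operator of the differential equation `γ' = X (t, γ)` with complex time; the unknown
`γ` depends on the time and on the initial value. The integral is taken over the segment from `0` to
`t`, parametrized by `[0, 1]`. -/
noncomputable def picardOp (X γ : ℂ × V → V) (p : ℂ × V) : V :=
  p.2 + p.1 • ∫ s in (0 : ℝ)..1, X ((s : ℂ) * p.1, γ ((s : ℂ) * p.1, p.2))

theorem scale_time_mem_ball {V : Type*} [NormedAddCommGroup V] {ε : ℝ} {p : ℂ × V}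
    (hp : p ∈ ball (0 : ℂ × V) ε) {s : ℝ} (hs : s ∈ Icc (0 : ℝ) 1) :
    ((s : ℂ) * p.1, p.2) ∈ ball (0 : ℂ × V) ε := by
  rw [mem_ball_zero_iff, Prod.norm_def] at hp ⊢
  refine lt_of_le_of_lt (max_le_max_right _ ?_) hp
  rw [norm_mul, Complex.norm_real, Real.norm_of_nonneg hs.1]
  exact mul_le_of_le_one_left (norm_nonneg _) hs.2

/-- The data of a Picard iteration: a vector field that is analytic, bounded and Lipschitz on a
ball of radius `ρ`, and a radius `ε` so small that the Picard operator acts on the functions on the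
`ε`-ball with values in the ball of radius `ρ / 2`, as a contraction with constant `1 / 2`. -/
structure PicardData (X : ℂ × V → V) (ρ ε M : ℝ) (K : NNReal) : Prop where
  pos : 0 < ε
  analytic : AnalyticOnNhd ℂ X (ball 0 ρ)
  bound : ∀ p ∈ ball (0 : ℂ × V) ρ, ‖X p‖ ≤ M
  lipschitz : LipschitzOnWith K X (ball 0 ρ)
  le_radius : ε ≤ ρ / 4
  mul_bound : ε * M ≤ ρ / 4
  mul_lip : ε * K ≤ 1 / 2

/-- The functions on which the Picard operator acts. -/
def IsPicardFun (ρ ε : ℝ) (γ : ℂ × V → V) : Prop :=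
  AnalyticOnNhd ℂ γ (ball 0 ε) ∧ ∀ p ∈ ball (0 : ℂ × V) ε, ‖γ p‖ ≤ ρ / 2

namespace PicardData

variable {X γ γ' : ℂ × V → V} {ρ ε M : ℝ} {K : NNReal}

theorem pair_mem (h : PicardData X ρ ε M K) (hγ : IsPicardFun ρ ε γ) {p : ℂ × V}
    (hp : p ∈ ball (0 : ℂ × V) ε) : (p.1, γ p) ∈ ball (0 : ℂ × V) ρ := by
  have h1 := hγ.2 p hp
  have h2 := h.pos
  have h3 := h.le_radius
  rw [mem_ball_zero_iff, Prod.norm_def, max_lt_iff] at hp ⊢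
  exact ⟨by simp only; linarith [hp.1], by simp only; linarith⟩

theorem analyticOnNhd_comp (h : PicardData X ρ ε M K) (hγ : IsPicardFun ρ ε γ) :
    AnalyticOnNhd ℂ (fun p => X (p.1, γ p)) (ball 0 ε) := fun p hp =>
  AnalyticAt.fun_comp (g := X) (h.analytic _ (h.pair_mem hγ hp)) (analyticAt_fst.prod (hγ.1 p hp))

theorem continuousOn_integrand (h : PicardData X ρ ε M K) (hγ : IsPicardFun ρ ε γ) :
    ContinuousOn (fun q : ℝ × (ℂ × V) => X ((q.1 : ℂ) * q.2.1, γ ((q.1 : ℂ) * q.2.1, q.2.2)))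
      (Icc 0 1 ×ˢ ball 0 ε) := by
  refine (h.analyticOnNhd_comp hγ).continuousOn.comp
    (f := fun q : ℝ × (ℂ × V) => ((q.1 : ℂ) * q.2.1, q.2.2)) (Continuous.continuousOn ?_)
    fun q hq => scale_time_mem_ball hq.2 hq.1
  fun_prop

theorem intervalIntegrable (h : PicardData X ρ ε M K) (hγ : IsPicardFun ρ ε γ) {p : ℂ × V}
    (hp : p ∈ ball (0 : ℂ × V) ε) : IntervalIntegrable
      (fun s : ℝ => X ((s : ℂ) * p.1, γ ((s : ℂ) * p.1, p.2))) MeasureTheory.volume 0 1 := by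
  refine ContinuousOn.intervalIntegrable_of_Icc zero_le_one ?_
  exact (h.continuousOn_integrand hγ).comp (f := fun s : ℝ => (s, p))
    (Continuous.continuousOn (by fun_prop)) fun s hs => ⟨hs, hp⟩

theorem norm_integral_le_of_norm_le {g : ℝ → V} {C : ℝ} (hg : ∀ s ∈ Icc (0 : ℝ) 1, ‖g s‖ ≤ C) :
    ‖∫ s in (0 : ℝ)..1, g s‖ ≤ C := by
  have := intervalIntegral.norm_integral_le_of_norm_le_const (a := (0 : ℝ)) (b := 1) (f := g)
    (C := C) fun s hs => by
      rw [uIoc_of_le zero_le_one] at hs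
      exact hg s ⟨hs.1.le, hs.2⟩
  simpa using this

theorem isPicardFun_picardOp [FiniteDimensional ℂ V] (h : PicardData X ρ ε M K)
    (hγ : IsPicardFun ρ ε γ) : IsPicardFun ρ ε (picardOp X γ) := by
  have : CompleteSpace V := FiniteDimensional.complete ℂ V
  constructor
  · intro p hp
    refine analyticAt_snd.add (analyticAt_fst.smul ?_)
    refine analyticOnNhd_intervalIntegral isOpen_ball zero_le_one (h.continuousOn_integrand hγ)
      (fun s hs p hp => ?_) p hp
    refine AnalyticAt.fun_comp (g := fun p => X (p.1, γ p))
      (f := fun p : ℂ × V => ((s : ℂ) * p.1, p.2))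
      (h.analyticOnNhd_comp hγ _ (scale_time_mem_ball hp hs)) ?_
    exact (analyticAt_const.mul analyticAt_fst).prod analyticAt_snd
  · intro p hp
    have hb : ‖∫ s in (0 : ℝ)..1, X ((s : ℂ) * p.1, γ ((s : ℂ) * p.1, p.2))‖ ≤ M :=
      norm_integral_le_of_norm_le fun s hs =>
        h.bound _ (h.pair_mem hγ (scale_time_mem_ball hp hs))
    rw [mem_ball_zero_iff, Prod.norm_def, max_lt_iff] at hp
    refine (norm_add_le _ _).trans ?_
    rw [norm_smul]
    have h1 := h.le_radius
    have h2 := h.mul_bound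
    have h3 : ‖p.1‖ * ‖∫ s in (0 : ℝ)..1, X ((s : ℂ) * p.1, γ ((s : ℂ) * p.1, p.2))‖ ≤ ε * M :=
      mul_le_mul hp.1.le hb (norm_nonneg _) h.pos.le
    linarith [hp.2]

theorem norm_picardOp_sub_le (h : PicardData X ρ ε M K) (hγ : IsPicardFun ρ ε γ)
    (hγ' : IsPicardFun ρ ε γ') {C : ℝ} (hC : ∀ p ∈ ball (0 : ℂ × V) ε, ‖γ p - γ' p‖ ≤ C)
    {p : ℂ × V} (hp : p ∈ ball (0 : ℂ × V) ε) : ‖picardOp X γ p - picardOp X γ' p‖ ≤ C / 2 := by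
  have hC0 : 0 ≤ C := (norm_nonneg _).trans (hC p hp)
  have hb : ‖∫ s in (0 : ℝ)..1, (X ((s : ℂ) * p.1, γ ((s : ℂ) * p.1, p.2)) -
      X ((s : ℂ) * p.1, γ' ((s : ℂ) * p.1, p.2)))‖ ≤ K * C := by
    refine norm_integral_le_of_norm_le fun s hs => ?_
    have hs' := scale_time_mem_ball hp hs
    refine (h.lipschitz.norm_sub_le (h.pair_mem hγ hs') (h.pair_mem hγ' hs')).trans ?_
    refine mul_le_mul_of_nonneg_left ?_ K.2
    simpa [Prod.norm_def] using hC _ hs'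
  rw [picardOp, picardOp, add_sub_add_left_eq_sub, ← smul_sub, ← intervalIntegral.integral_sub
    (h.intervalIntegrable hγ hp) (h.intervalIntegrable hγ' hp), norm_smul]
  rw [mem_ball_zero_iff, Prod.norm_def, max_lt_iff] at hp
  calc _ ≤ ε * (K * C) := mul_le_mul hp.1.le hb (norm_nonneg _) h.pos.le
    _ = (ε * K) * C := by ring
    _ ≤ 1 / 2 * C := mul_le_mul_of_nonneg_right h.mul_lip hC0
    _ = C / 2 := by ring

/-- The Picard operator has an analytic fixed point. -/
theorem exists_fixedPoint [FiniteDimensional ℂ V] (h : PicardData X ρ ε M K) :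
    ∃ γ, IsPicardFun ρ ε γ ∧ ∀ p ∈ ball (0 : ℂ × V) ε, picardOp X γ p = γ p := by
  have : CompleteSpace V := FiniteDimensional.complete ℂ V
  let φ : ℕ → ℂ × V → V := fun k => (picardOp X)^[k] Prod.snd
  have hsucc : ∀ k, φ (k + 1) = picardOp X (φ k) := fun k =>
    Function.iterate_succ_apply' _ _ _
  have hφ : ∀ k, IsPicardFun ρ ε (φ k) := by
    intro k
    induction k with
    | zero =>
      refine ⟨fun p _ => analyticAt_snd, fun p hp => ?_⟩
      rw [mem_ball_zero_iff, Prod.norm_def, max_lt_iff] at hp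
      have := h.le_radius
      have := h.pos
      change ‖p.2‖ ≤ _
      linarith [hp.2]
    | succ k ih =>
      rw [hsucc]
      exact h.isPicardFun_picardOp ih
  have hstep : ∀ k, ∀ p ∈ ball (0 : ℂ × V) ε, ‖φ k p - φ (k + 1) p‖ ≤ ρ * (1 / 2) ^ k := by
    intro k
    induction k with
    | zero =>
      intro p hp
      have h1 := (hφ 0).2 p hp
      have h2 := (hφ 1).2 p hp
      simpa using (norm_sub_le _ _).trans (by linarith : ‖φ 0 p‖ + ‖φ 1 p‖ ≤ ρ)
    | succ k ih =>
      intro p hp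
      rw [hsucc k, hsucc (k + 1)]
      refine (h.norm_picardOp_sub_le (hφ k) (hφ (k + 1)) ih hp).trans_eq ?_
      ring
  have hlim : ∀ p ∈ ball (0 : ℂ × V) ε, ∃ y, Tendsto (fun k => φ k p) atTop (𝓝 y) := fun p hp =>
    cauchySeq_tendsto_of_complete (cauchySeq_of_le_geometric (1 / 2) ρ (by norm_num)
      fun k => by simpa only [dist_eq_norm] using hstep k p hp)
  choose! γ hγ using hlim
  have hdist : ∀ k, ∀ p ∈ ball (0 : ℂ × V) ε, ‖φ k p - γ p‖ ≤ ρ * (1 / 2) ^ k / (1 - 1 / 2) := by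
    intro k p hp
    rw [← dist_eq_norm]
    exact dist_le_of_le_geometric_of_tendsto _ _ (by norm_num)
      (fun k => by simpa only [dist_eq_norm] using hstep k p hp) (hγ p hp) k
  have hto0 : Tendsto (fun k : ℕ => ρ * (1 / 2 : ℝ) ^ k / (1 - 1 / 2)) atTop (𝓝 0) := by
    have := (tendsto_pow_atTop_nhds_zero_of_lt_one (r := (1 / 2 : ℝ)) (by norm_num)
      (by norm_num)).const_mul ρ |>.div_const (1 - 1 / 2)
    simpa using this
  have hunif : TendstoUniformlyOn φ γ atTop (ball 0 ε) := by
    rw [Metric.tendstoUniformlyOn_iff]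
    intro δ hδ
    filter_upwards [hto0.eventually_lt_const hδ] with k hk p hp
    rw [dist_comm, dist_eq_norm]
    exact (hdist k p hp).trans_lt hk
  have hγP : IsPicardFun ρ ε γ :=
    ⟨analyticOnNhd_of_tendstoUniformlyOn isOpen_ball (fun k => (hφ k).1) hunif, fun p hp =>
      le_of_tendsto (hγ p hp).norm (Eventually.of_forall fun k => (hφ k).2 p hp)⟩
  refine ⟨γ, hγP, fun p hp => ?_⟩
  have h1 : Tendsto (fun k => φ (k + 1) p) atTop (𝓝 (γ p)) :=
    (hγ p hp).comp (tendsto_add_atTop_nat 1)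
  have h2 : Tendsto (fun k => φ (k + 1) p) atTop (𝓝 (picardOp X γ p)) := by
    rw [tendsto_iff_norm_sub_tendsto_zero]
    have hto0' := hto0.div_const 2
    rw [zero_div] at hto0'
    refine squeeze_zero (fun _ => norm_nonneg _) (fun k => ?_) hto0'
    rw [hsucc]
    exact h.norm_picardOp_sub_le (hφ k) hγP (hdist k) hp
  exact tendsto_nhds_unique h2 h1

end PicardData

theorem exists_picardData {X : ℂ × V → V} [CompleteSpace V] (hX : AnalyticAt ℂ X 0) :
    ∃ ρ ε M K, PicardData X ρ ε M K := by
  obtain ⟨K, s, hs, hK⟩ := (hX.contDiffAt (n := 1)).exists_lipschitzOnWith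
  have hM : ∀ᶠ p in 𝓝 (0 : ℂ × V), ‖X p‖ < ‖X 0‖ + 1 :=
    hX.continuousAt.norm.eventually_lt_const (lt_add_one _)
  obtain ⟨ρ, hρ, hball⟩ := Metric.eventually_nhds_iff_ball.mp
    (hX.eventually_analyticAt.and (hM.and hs))
  set M : ℝ := ‖X 0‖ + 1
  have hMpos : 0 < M := by positivity
  have hK1 : (0 : ℝ) < K + 1 := by positivity
  refine ⟨ρ, min (ρ / 4) (min (ρ / 4 / M) (1 / 2 / (K + 1))), M, K, ⟨?_, fun p hp => (hball p hp).1,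
    fun p hp => (hball p hp).2.1.le, hK.mono fun p hp => (hball p hp).2.2, min_le_left _ _, ?_, ?_⟩⟩
  · refine lt_min (by positivity) (lt_min (by positivity) (by positivity))
  · rw [← le_div_iff₀ hMpos]
    exact (min_le_right _ _).trans (min_le_left _ _)
  · have h1 : min (ρ / 4) (min (ρ / 4 / M) (1 / 2 / ((K : ℝ) + 1))) ≤ 1 / 2 / ((K : ℝ) + 1) :=
      (min_le_right _ _).trans (min_le_right _ _)
    calc _ ≤ 1 / 2 / ((K : ℝ) + 1) * K := mul_le_mul_of_nonneg_right h1 K.2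
      _ ≤ 1 / 2 / ((K : ℝ) + 1) * (K + 1) := by gcongr; linarith
      _ = 1 / 2 := by field_simp

/-- An analytic differential equation `γ' = X (t, γ)` in complex time has a local solution that is
analytic in the time and the initial value. -/
theorem exists_analytic_flow [FiniteDimensional ℂ V] {X : ℂ × V → V} (hX : AnalyticAt ℂ X 0) :
    ∃ Φ : ℂ × V → V, AnalyticAt ℂ Φ 0 ∧ (∀ x, Φ (0, x) = x) ∧
      ∀ᶠ p in 𝓝 (0 : ℂ × V), HasDerivAt (fun t => Φ (t, p.2)) (X (p.1, Φ p)) p.1 := by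
  have : CompleteSpace V := FiniteDimensional.complete ℂ V
  obtain ⟨ρ, ε, M, K, h⟩ := exists_picardData hX
  obtain ⟨γ, hγ, hfix⟩ := h.exists_fixedPoint
  have hmem : ∀ᶠ p in 𝓝 (0 : ℂ × V), p ∈ ball (0 : ℂ × V) ε := ball_mem_nhds _ h.pos
  refine ⟨picardOp X γ, ?_, fun x => by simp [picardOp], ?_⟩
  · exact (h.isPicardFun_picardOp hγ).1 0 (mem_ball_self h.pos)
  · filter_upwards [hmem] with p hp
    rw [hfix p hp]
    have hp' := hp
    rw [mem_ball_zero_iff, Prod.norm_def, max_lt_iff] at hp'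
    have hline : ∀ t ∈ ball (0 : ℂ) ε, (t, p.2) ∈ ball (0 : ℂ × V) ε := by
      intro t ht
      rw [mem_ball_zero_iff] at ht ⊢
      rw [Prod.norm_def, max_lt_iff]
      exact ⟨ht, hp'.2⟩
    have hdiff : DifferentiableOn ℂ (fun t => X (t, γ (t, p.2))) (ball 0 ε) := by
      intro t ht
      refine AnalyticAt.differentiableWithinAt ?_
      exact AnalyticAt.fun_comp (g := fun p => X (p.1, γ p)) (f := fun t : ℂ => (t, p.2))
        (h.analyticOnNhd_comp hγ _ (hline t ht)) (analyticAt_id.prod analyticAt_const)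
    -- The integral in the Picard operator is a difference of values of a holomorphic primitive in
    -- the time, so the fixed point solves the differential equation.
    obtain ⟨H, hH⟩ := hdiff.isExactOn_ball
    have hprim : ∀ t ∈ ball (0 : ℂ) ε, picardOp X γ (t, p.2) = p.2 + (H t - H 0) := by
      intro t ht
      have hst : ∀ s ∈ uIcc (0 : ℝ) 1, HasDerivAt (fun s : ℝ => H ((s : ℂ) * t))
          (t • X ((s : ℂ) * t, γ ((s : ℂ) * t, p.2))) s := by
        intro s hs
        rw [uIcc_of_le zero_le_one] at hs
        have hs' : (s : ℂ) * t ∈ ball (0 : ℂ) ε := by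
          have := scale_time_mem_ball (hline t ht) hs
          rw [mem_ball_zero_iff, Prod.norm_def, max_lt_iff] at this
          rw [mem_ball_zero_iff]
          exact this.1
        have h1 : HasDerivAt (fun s : ℝ => (s : ℂ) * t) t s := by
          simpa using (Complex.ofRealCLM.hasDerivAt (x := s)).mul_const t
        exact (hH _ hs').scomp s h1
      have hint : IntervalIntegrable (fun s : ℝ => t • X ((s : ℂ) * t, γ ((s : ℂ) * t, p.2)))
          MeasureTheory.volume 0 1 := (h.intervalIntegrable hγ (hline t ht)).smul t
      have := intervalIntegral.integral_eq_sub_of_hasDerivAt hst hint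
      rw [intervalIntegral.integral_smul] at this
      simp only [picardOp, this, Complex.ofReal_one, one_mul, Complex.ofReal_zero, zero_mul]
    have hp1 : p.1 ∈ ball (0 : ℂ) ε := by simpa using hp'.1
    refine (((hH p.1 hp1).sub_const (H 0)).const_add p.2).congr_of_eventuallyEq ?_
    filter_upwards [isOpen_ball.mem_nhds hp1] with t ht
    exact hprim t ht

/-- Solutions of an analytic differential equation in complex time are unique: on the segment from
`0` to a given time they solve the same differential equation in real time. -/
theorem eventuallyEq_of_flow [CompleteSpace V] {X Φ Ψ : ℂ × V → V} (hX : AnalyticAt ℂ X 0)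
    (hΦ : ContinuousAt Φ 0) (hΦ0 : Φ 0 = 0) (hΨ : ContinuousAt Ψ 0) (hΨ0 : Ψ 0 = 0)
    (hinit : ∀ᶠ x in 𝓝 (0 : V), Φ (0, x) = Ψ (0, x))
    (hΦ' : ∀ᶠ p in 𝓝 (0 : ℂ × V), HasDerivAt (fun t => Φ (t, p.2)) (X (p.1, Φ p)) p.1)
    (hΨ' : ∀ᶠ p in 𝓝 (0 : ℂ × V), HasDerivAt (fun t => Ψ (t, p.2)) (X (p.1, Ψ p)) p.1) :
    Φ =ᶠ[𝓝 0] Ψ := by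
  obtain ⟨ρ, ε, M, K, h⟩ := exists_picardData hX
  have hρ : 0 < ρ := by linarith [h.pos, h.le_radius]
  have hpair : ∀ {Θ : ℂ × V → V}, ContinuousAt Θ 0 → Θ 0 = 0 →
      ∀ᶠ p in 𝓝 (0 : ℂ × V), (p.1, Θ p) ∈ ball (0 : ℂ × V) ρ := by
    intro Θ hΘ hΘ0
    have hc : ContinuousAt (fun p : ℂ × V => (p.1, Θ p)) 0 := continuousAt_fst.prodMk hΘ
    exact hc.eventually_mem (isOpen_ball.mem_nhds (by simpa [hΘ0] using hρ))
  have hinit' : ∀ᶠ p in 𝓝 (0 : ℂ × V), Φ (0, p.2) = Ψ (0, p.2) :=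
    (continuous_snd.tendsto' (0 : ℂ × V) 0 rfl).eventually hinit
  obtain ⟨δ, hδ, hball⟩ := Metric.eventually_nhds_iff_ball.mp
    ((hpair hΦ hΦ0).and ((hpair hΨ hΨ0).and (hinit'.and (hΦ'.and hΨ'))))
  filter_upwards [ball_mem_nhds (0 : ℂ × V) hδ, ball_mem_nhds (0 : ℂ × V) one_pos] with p hp hp1
  have hs : ∀ s ∈ Icc (0 : ℝ) 1, ((s : ℂ) * p.1, p.2) ∈ ball (0 : ℂ × V) δ := fun s hs =>
    scale_time_mem_ball hp hs
  have hder : ∀ {Θ : ℂ × V → V}, (∀ q ∈ ball (0 : ℂ × V) δ,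
      HasDerivAt (fun t => Θ (t, q.2)) (X (q.1, Θ q)) q.1) → ∀ s ∈ Icc (0 : ℝ) 1,
      HasDerivAt (fun s : ℝ => Θ ((s : ℂ) * p.1, p.2))
        (p.1 • X ((s : ℂ) * p.1, Θ ((s : ℂ) * p.1, p.2))) s := by
    intro Θ hΘ s hs'
    have h1 : HasDerivAt (fun s : ℝ => (s : ℂ) * p.1) p.1 s := by
      simpa using (Complex.ofRealCLM.hasDerivAt (x := s)).mul_const p.1
    exact (hΘ _ (hs s hs')).scomp s h1
  have hdΦ := hder fun q hq => (hball q hq).2.2.2.1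
  have hdΨ := hder fun q hq => (hball q hq).2.2.2.2
  have hEq := ODE_solution_unique_of_mem_Icc_right (a := (0 : ℝ)) (b := 1) (K := K)
    (v := fun s y => p.1 • X ((s : ℂ) * p.1, y))
    (s := fun s => {y | ((s : ℂ) * p.1, y) ∈ ball (0 : ℂ × V) ρ})
    (f := fun s : ℝ => Φ ((s : ℂ) * p.1, p.2)) (g := fun s : ℝ => Ψ ((s : ℂ) * p.1, p.2))
    (by
      intro s _
      refine LipschitzOnWith.of_dist_le_mul fun y hy z hz => ?_
      have h1 := h.lipschitz.norm_sub_le hy hz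
      have h2 : ‖p.1‖ ≤ 1 := by
        rw [mem_ball_zero_iff, Prod.norm_def, max_lt_iff] at hp1
        exact hp1.1.le
      rw [dist_eq_norm, dist_eq_norm, ← smul_sub, norm_smul]
      refine (mul_le_of_le_one_left (norm_nonneg _) h2).trans (h1.trans_eq ?_)
      simp [Prod.norm_def])
    (fun s hs' => (hdΦ s hs').continuousAt.continuousWithinAt)
    (fun s hs' => (hdΦ s (Ico_subset_Icc_self hs')).hasDerivWithinAt)
    (fun s hs' => (hball _ (hs s (Ico_subset_Icc_self hs'))).1)
    (fun s hs' => (hdΨ s hs').continuousAt.continuousWithinAt)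
    (fun s hs' => (hdΨ s (Ico_subset_Icc_self hs')).hasDerivWithinAt)
    (fun s hs' => (hball _ (hs s (Ico_subset_Icc_self hs'))).2.1)
    (by simpa using (hball p hp).2.2.1)
  simpa using hEq (right_mem_Icc.mpr zero_le_one)

end Flow

set_option maxSynthPendingDepth 3

/-! ### The Poincaré lemma -/

section Radial

open Metric Set Filter

variable {V : Type*} [NormedAddCommGroup V] [NormedSpace ℂ V]
  {F : Type*} [NormedAddCommGroup F] [NormedSpace ℂ F]

theorem hasDerivAt_line {f : V → F} {y : V} (hf : DifferentiableAt ℂ f y) (c : V) :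
    HasDerivAt (fun s : ℂ => f (y + s • c)) (fderiv ℂ f y c) 0 := by
  have h1 : HasDerivAt (fun s : ℂ => y + s • c) c 0 := by
    simpa using ((hasDerivAt_id (0 : ℂ)).smul_const c).const_add y
  have h2 : HasFDerivAt f (fderiv ℂ f y) (y + (0 : ℂ) • c) := by simpa using hf.hasFDerivAt
  exact h2.comp_hasDerivAt 0 h1

/-- Two functions that agree near a point have the same derivative along lines. -/
theorem line_deriv_unique {f g : V → F} {y c : V} (h : f =ᶠ[𝓝 y] g) {f' g' : F}
    (hf : HasDerivAt (fun s : ℂ => f (y + s • c)) f' 0)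
    (hg : HasDerivAt (fun s : ℂ => g (y + s • c)) g' 0) : f' = g' := by
  have hc : Tendsto (fun s : ℂ => y + s • c) (𝓝 0) (𝓝 y) :=
    (by fun_prop : Continuous fun s : ℂ => y + s • c).tendsto' 0 y (by simp)
  exact hf.unique (hg.congr_of_eventuallyEq (hc.eventually h))

theorem hasDerivAt_line_apply₂ {B : V → V →L[ℂ] V →L[ℂ] F} {y : V} (hB : DifferentiableAt ℂ B y)
    (c a b : V) : HasDerivAt (fun s : ℂ => B (y + s • c) a b) (fderiv ℂ B y c a b) 0 := by
  simpa using ((hasDerivAt_line hB c).clm_apply (hasDerivAt_const 0 a)).clm_apply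
    (hasDerivAt_const 0 b)

/-- A function that is homogeneous of degree `-k < 0`, in the sense of Euler's equation, on a
neighbourhood of `0` vanishes: `t ^ k • u (t • x)` does not depend on `t ∈ [0, 1]`. -/
theorem eq_zero_of_euler {u : V → F} {r : ℝ} {k : ℕ} (hk : k ≠ 0)
    (hu : ∀ x ∈ ball (0 : V) r, DifferentiableAt ℂ u x)
    (h : ∀ x ∈ ball (0 : V) r, fderiv ℂ u x x + (k : ℂ) • u x = 0) :
    ∀ x ∈ ball (0 : V) r, u x = 0 := by
  intro x hx
  have hmem : ∀ t ∈ Icc (0 : ℝ) 1, (t : ℂ) • x ∈ ball (0 : V) r := by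
    intro t ht
    rw [mem_ball_zero_iff] at hx ⊢
    rw [norm_smul, Complex.norm_real, Real.norm_of_nonneg ht.1]
    exact (mul_le_of_le_one_left (norm_nonneg _) ht.2).trans_lt hx
  have hd : ∀ t ∈ Icc (0 : ℝ) 1,
      HasDerivAt (fun t : ℝ => (t : ℂ) ^ k • u ((t : ℂ) • x)) 0 t := by
    intro t ht
    have h1 : HasDerivAt (fun t : ℝ => (t : ℂ)) 1 t := Complex.ofRealCLM.hasDerivAt (x := t)
    have h2 : HasDerivAt (fun t : ℝ => (t : ℂ) • x) x t := by simpa using h1.smul_const x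
    have hut : HasFDerivAt u ((fderiv ℂ u ((t : ℂ) • x)).restrictScalars ℝ) ((t : ℂ) • x) :=
      (hu _ (hmem t ht)).hasFDerivAt.restrictScalars ℝ
    have h3 : HasDerivAt (fun t : ℝ => u ((t : ℂ) • x)) (fderiv ℂ u ((t : ℂ) • x) x) t := by
      have h := hut.comp_hasDerivAt t h2
      exact h
    have h4 := (h1.pow k).smul h3
    convert! h4 using 1
    have h5 := congrArg (fun w => ((t : ℂ) ^ (k - 1)) • w) (h _ (hmem t ht))
    simp only [smul_add, map_smul, smul_smul, smul_zero] at h5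
    rw [pow_sub_one_mul hk] at h5
    rw [mul_one, mul_comm (k : ℂ), Pi.pow_apply, h5]
  have := constant_of_has_deriv_right_zero (a := (0 : ℝ)) (b := 1)
    (f := fun t : ℝ => (t : ℂ) ^ k • u ((t : ℂ) • x))
    (fun t ht => (hd t ht).continuousAt.continuousWithinAt)
    (fun t ht => (hd t (Ico_subset_Icc_self ht)).hasDerivWithinAt) 1 (right_mem_Icc.mpr zero_le_one)
  simpa [hk] using this

/-- Euler's equation `A' (x) x + 2 A (x) = B (x)` has the solution `A (x) = ∫₀¹ s B (s x) ds`. -/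
theorem exists_euler_primitive [FiniteDimensional ℂ V] [CompleteSpace F] {B : V → F} {r : ℝ}
    (hB : AnalyticOnNhd ℂ B (ball 0 r)) :
    ∃ A : V → F, AnalyticOnNhd ℂ A (ball 0 r) ∧
      ∀ x ∈ ball (0 : V) r, fderiv ℂ A x x + (2 : ℂ) • A x = B x := by
  let A : V → F := fun x => ∫ s in (0 : ℝ)..1, (s : ℂ) • B ((s : ℂ) • x)
  have hmem : ∀ x ∈ ball (0 : V) r, ∀ t ∈ Icc (0 : ℝ) 1, (t : ℂ) • x ∈ ball (0 : V) r := by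
    intro x hx t ht
    rw [mem_ball_zero_iff] at hx ⊢
    rw [norm_smul, Complex.norm_real, Real.norm_of_nonneg ht.1]
    exact (mul_le_of_le_one_left (norm_nonneg _) ht.2).trans_lt hx
  have hA : AnalyticOnNhd ℂ A (ball 0 r) := by
    refine analyticOnNhd_intervalIntegral isOpen_ball zero_le_one
      (H := fun s x => (s : ℂ) • B ((s : ℂ) • x)) ?_ fun s hs x hx => ?_
    · refine ContinuousOn.smul (Continuous.continuousOn (by fun_prop)) ?_
      exact hB.continuousOn.comp (f := fun p : ℝ × V => (p.1 : ℂ) • p.2)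
        (Continuous.continuousOn (by fun_prop)) fun p hp => hmem p.2 hp.2 p.1 hp.1
    · exact AnalyticAt.const_smul (AnalyticAt.fun_comp (g := B) (f := fun x : V => (s : ℂ) • x)
        (hB _ (hmem x hx s hs)) (analyticAt_id.const_smul))
  refine ⟨A, hA, fun x hx => ?_⟩
  let f : ℝ → F := fun σ => (σ : ℂ) • B ((σ : ℂ) • x)
  have hscale : ∀ t : ℝ, ((t : ℂ) ^ 2) • A ((t : ℂ) • x) = ∫ σ in (0 : ℝ)..t, f σ := by
    intro t
    have h1 := intervalIntegral.smul_integral_comp_mul_left (a := 0) (b := 1) f t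
    rw [mul_zero, mul_one] at h1
    rw [← h1, pow_two, mul_smul, ← intervalIntegral.integral_smul]
    simp only [f, Complex.ofReal_mul, smul_smul, RCLike.real_smul_eq_coe_smul (K := ℂ)]
    simp [mul_comm]
  have hopen : IsOpen {σ : ℝ | (σ : ℂ) • x ∈ ball (0 : V) r} :=
    isOpen_ball.preimage (by fun_prop : Continuous fun σ : ℝ => (σ : ℂ) • x)
  have hcont : ContinuousOn f {σ : ℝ | (σ : ℂ) • x ∈ ball (0 : V) r} := by
    refine ContinuousOn.smul (Continuous.continuousOn (by fun_prop)) ?_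
    exact hB.continuousOn.comp (f := fun σ : ℝ => (σ : ℂ) • x)
      (Continuous.continuousOn (by fun_prop)) fun σ hσ => hσ
  have h1mem : (1 : ℝ) ∈ {σ : ℝ | (σ : ℂ) • x ∈ ball (0 : V) r} := by simpa using hx
  have hR : HasDerivAt (fun t : ℝ => ∫ σ in (0 : ℝ)..t, f σ) (f 1) 1 :=
    intervalIntegral.integral_hasDerivAt_right
      (ContinuousOn.intervalIntegrable_of_Icc zero_le_one (hcont.mono fun t ht => hmem x hx t ht))
      (hcont.stronglyMeasurableAtFilter hopen 1 h1mem) (hcont.continuousAt (hopen.mem_nhds h1mem))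
  have hL : HasDerivAt (fun t : ℝ => ((t : ℂ) ^ 2) • A ((t : ℂ) • x))
      (fderiv ℂ A x x + (2 : ℂ) • A x) 1 := by
    have h1 : HasDerivAt (fun t : ℝ => (t : ℂ)) 1 1 := Complex.ofRealCLM.hasDerivAt (x := 1)
    have h2 : HasDerivAt (fun t : ℝ => (t : ℂ) • x) x 1 := by simpa using h1.smul_const x
    have hAx : HasFDerivAt A ((fderiv ℂ A x).restrictScalars ℝ) (((1 : ℝ) : ℂ) • x) := by
      simpa using (hA x hx).differentiableAt.hasFDerivAt.restrictScalars ℝ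
    have h3 : HasDerivAt (fun t : ℝ => A ((t : ℂ) • x)) (fderiv ℂ A x x) 1 := by
      have h := hAx.comp_hasDerivAt (1 : ℝ) h2
      exact h
    convert! (h1.pow 2).smul h3 using 1
    simp
  have := hL.unique (hR.congr_of_eventuallyEq (Eventually.of_forall hscale))
  simpa [f] using this

end Radial

section Poincare

open Metric Set Filter

variable {V : Type*} [NormedAddCommGroup V] [NormedSpace ℂ V] [FiniteDimensional ℂ V]

/-- A 2-form, encoded as a map to the bilinear forms, that is skew and closed on a set. -/
structure IsClosedTwoFormOn (B : V → V →L[ℂ] V →L[ℂ] ℂ) (s : Set V) : Prop where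
  analytic : AnalyticOnNhd ℂ B s
  skew : ∀ x ∈ s, ∀ a b, B x a b = -B x b a
  closed : ∀ x ∈ s, ∀ a b c,
    fderiv ℂ B x a b c + fderiv ℂ B x b c a + fderiv ℂ B x c a b = 0

variable {B : V → V →L[ℂ] V →L[ℂ] ℂ}

omit [FiniteDimensional ℂ V] in
theorem fderiv_skew {x : V} (hB : DifferentiableAt ℂ B x)
    (h : ∀ᶠ y in 𝓝 x, ∀ a b, B y a b = -B y b a) (c a b : V) :
    fderiv ℂ B x c a b = -fderiv ℂ B x c b a :=
  line_deriv_unique (f := fun y => B y a b) (g := fun y => -B y b a) (h.mono fun _ hy => hy a b)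
    (hasDerivAt_line_apply₂ hB c a b) (hasDerivAt_line_apply₂ hB c b a).neg

/-- The **Poincaré lemma** with its symmetry: a closed 2-form `B` near `0` is the exterior
derivative of a 1-form `x ↦ A (x) x`, where the skew bilinear forms `A (x)` inherit every linear
symmetry of `B`. -/
theorem exists_poincare_primitive {r : ℝ} (hr : 0 < r) (hB : IsClosedTwoFormOn B (ball 0 r)) :
    ∃ A : V → V →L[ℂ] V →L[ℂ] ℂ, AnalyticOnNhd ℂ A (ball 0 r) ∧
      (∀ x ∈ ball (0 : V) r, ∀ c a b, fderiv ℂ A x c a b = -fderiv ℂ A x c b a) ∧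
      (∀ x ∈ ball (0 : V) r, ∀ a b,
        fderiv ℂ A x a x b - fderiv ℂ A x b x a + 2 * A x a b = B x a b) ∧
      ∀ L : V ≃L[ℂ] V, (∀ᶠ x in 𝓝 0, ∀ a b, B (L x) (L a) (L b) = B x a b) →
        ∀ᶠ x in 𝓝 0, ∀ a b c,
          fderiv ℂ A (L x) (L a) (L b) (L c) = fderiv ℂ A x a b c := by
  obtain ⟨A, hA, hAB⟩ := exists_euler_primitive hB.analytic
  have hdA : ∀ x ∈ ball (0 : V) r, DifferentiableAt ℂ A x := fun x hx => (hA x hx).differentiableAt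
  have hAB' : ∀ x ∈ ball (0 : V) r, ∀ a b, fderiv ℂ A x x a b + 2 * A x a b = B x a b := by
    intro x hx a b
    rw [← hAB x hx]
    simp
  -- Each identity for `B` passes to `A`, because the defect satisfies Euler's equation.
  have hskew : ∀ x ∈ ball (0 : V) r, ∀ a b, A x a b = -A x b a := by
    intro x hx a b
    have hd : ∀ y ∈ ball (0 : V) r, ∀ a b, HasFDerivAt (fun y => A y a b)
        (((fderiv ℂ A y).flip a).flip b) y := by
      intro y hy a b
      have := ((hdA y hy).hasFDerivAt.clm_apply (hasFDerivAt_const a y)).clm_apply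
        (hasFDerivAt_const b y)
      convert! this using 1
      ext c
      simp
    have := eq_zero_of_euler (u := fun y => A y a b + A y b a) two_ne_zero
      (fun y hy => ((hd y hy a b).add (hd y hy b a)).differentiableAt) (fun y hy => by
        rw [((hd y hy a b).fun_add (hd y hy b a)).fderiv]
        have h1 := hAB' y hy a b
        have h2 := hAB' y hy b a
        have h3 := hB.skew y hy a b
        simp only [add_apply, ContinuousLinearMap.flip_apply, smul_eq_mul,
          Nat.cast_ofNat]
        linear_combination h1 + h2 + h3) x hx
    linear_combination this
  have hskew' : ∀ x ∈ ball (0 : V) r, ∀ c a b, fderiv ℂ A x c a b = -fderiv ℂ A x c b a :=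
    fun x hx => fderiv_skew (hdA x hx) (eventually_of_mem (isOpen_ball.mem_nhds hx) hskew)
  have hdA' : ∀ x ∈ ball (0 : V) r, DifferentiableAt ℂ (fderiv ℂ A) x := fun x hx =>
    (hA x hx).fderiv.differentiableAt
  have hsymm : ∀ x ∈ ball (0 : V) r, ∀ a b,
      fderiv ℂ (fderiv ℂ A) x a b = fderiv ℂ (fderiv ℂ A) x b a := by
    intro x hx a b
    exact ((hA x hx).contDiffAt (n := 2)).isSymmSndFDerivAt (by simp) a b
  have hclosed : ∀ x ∈ ball (0 : V) r, ∀ a b c,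
      fderiv ℂ A x a b c + fderiv ℂ A x b c a + fderiv ℂ A x c a b = 0 := by
    intro x hx a b c
    have hd : ∀ y ∈ ball (0 : V) r, ∀ a b c, HasFDerivAt (fun y => fderiv ℂ A y a b c)
        ((((fderiv ℂ (fderiv ℂ A) y).flip a).flip b).flip c) y := by
      intro y hy a b c
      have := (((hdA' y hy).hasFDerivAt.clm_apply (hasFDerivAt_const a y)).clm_apply
        (hasFDerivAt_const b y)).clm_apply (hasFDerivAt_const c y)
      convert! this using 1
      ext e
      simp
    -- The derivative of `A' (x) x + 2 A (x) = B (x)` in the direction `a`.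
    have hdiff : ∀ y ∈ ball (0 : V) r, ∀ a b c,
        fderiv ℂ (fderiv ℂ A) y y a b c + 3 * fderiv ℂ A y a b c = fderiv ℂ B y a b c := by
      intro y hy a b c
      have hl : HasDerivAt (fun s : ℂ => y + s • a) a 0 := by
        simpa using ((hasDerivAt_id (0 : ℂ)).smul_const a).const_add y
      have h1 := (((hasDerivAt_line (hdA' y hy) a).clm_apply hl).clm_apply
        (hasDerivAt_const 0 b)).clm_apply (hasDerivAt_const 0 c)
      have h2 := (hasDerivAt_line_apply₂ (hdA y hy) a b c).const_mul 2
      have h3 := line_deriv_unique (f := fun y => fderiv ℂ A y y b c + 2 * A y b c)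
        (g := fun y => B y b c) (c := a)
        (eventually_of_mem (isOpen_ball.mem_nhds hy) fun z hz => hAB' z hz b c)
        (h1.add h2) (hasDerivAt_line_apply₂ (hB.analytic y hy).differentiableAt a b c)
      simp only [zero_smul, add_zero, map_zero, add_apply] at h3
      rw [hsymm y hy y a]
      linear_combination h3
    have hsum := fun y hy => ((hd y hy a b c).fun_add (hd y hy b c a)).fun_add (hd y hy c a b)
    refine eq_zero_of_euler
      (u := fun y => fderiv ℂ A y a b c + fderiv ℂ A y b c a + fderiv ℂ A y c a b) three_ne_zero
      (fun y hy => (hsum y hy).differentiableAt) (fun y hy => ?_) x hx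
    rw [(hsum y hy).fderiv]
    simp only [add_apply, ContinuousLinearMap.flip_apply, smul_eq_mul,
      Nat.cast_ofNat]
    linear_combination hdiff y hy a b c + hdiff y hy b c a + hdiff y hy c a b +
      hB.closed y hy a b c
  refine ⟨A, hA, hskew', fun x hx a b => ?_, fun L hL => ?_⟩
  · linear_combination hclosed x hx a x b - hskew' x hx b a x - hskew' x hx x b a + hAB' x hx a b
  · have hLr : ∀ᶠ x in 𝓝 (0 : V), L x ∈ ball (0 : V) r :=
      (L.continuous.tendsto' 0 0 (map_zero L)).eventually (ball_mem_nhds _ hr)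
    obtain ⟨δ, hδ, hball⟩ := Metric.eventually_nhds_iff_ball.mp
      (hL.and (hLr.and (ball_mem_nhds (0 : V) hr)))
    have hinv : ∀ x ∈ ball (0 : V) δ, ∀ a b, A (L x) (L a) (L b) = A x a b := by
      intro x hx a b
      have hd : ∀ y ∈ ball (0 : V) δ, HasFDerivAt (fun y => A (L y) (L a) (L b) - A y a b)
          ((((fderiv ℂ A (L y)).flip (L a)).flip (L b)).comp (L : V →L[ℂ] V) -
            ((fderiv ℂ A y).flip a).flip b) y := by
        intro y hy
        have hAL := (hdA _ (hball y hy).2.1).hasFDerivAt.comp y L.hasFDerivAt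
        have h1 := (hAL.clm_apply (hasFDerivAt_const (L a) y)).clm_apply
          (hasFDerivAt_const (L b) y)
        have h2 := ((hdA y (hball y hy).2.2).hasFDerivAt.clm_apply
          (hasFDerivAt_const a y)).clm_apply (hasFDerivAt_const b y)
        convert! h1.fun_sub h2 using 1
        ext e
        simp
      have := eq_zero_of_euler (u := fun y => A (L y) (L a) (L b) - A y a b) two_ne_zero
        (fun y hy => (hd y hy).differentiableAt) (fun y hy => by
          rw [(hd y hy).fderiv]
          simp only [sub_apply, ContinuousLinearMap.comp_apply,
            ContinuousLinearMap.flip_apply, smul_eq_mul, Nat.cast_ofNat,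
            ContinuousLinearEquiv.coe_coe]
          linear_combination hAB' _ (hball y hy).2.1 (L a) (L b) - hAB' y (hball y hy).2.2 a b +
            (hball y hy).1 a b) x hx
      linear_combination this
    filter_upwards [ball_mem_nhds (0 : V) hδ] with x hx a b c
    have h1 : HasDerivAt (fun s : ℂ => A (L (x + s • a)) (L b) (L c))
        (fderiv ℂ A (L x) (L a) (L b) (L c)) 0 := by
      simpa using hasDerivAt_line_apply₂ (hdA _ (hball x hx).2.1) (L a) (L b) (L c)
    exact line_deriv_unique (f := fun y => A (L y) (L b) (L c)) (g := fun y => A y b c)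
      (eventually_of_mem (isOpen_ball.mem_nhds hx) fun y hy => hinv y hy b c) h1
      (hasDerivAt_line_apply₂ (hdA x (hball x hx).2.2) a b c)

end Poincare

/-! ### Moser's vector field -/

section Moser

open Metric Set Filter

variable {V : Type*} [NormedAddCommGroup V] [NormedSpace ℂ V] [FiniteDimensional ℂ V]
  {A B : V → V →L[ℂ] V →L[ℂ] ℂ}

/-- A nondegenerate bilinear form is an isomorphism onto the dual space. -/
theorem isInvertible_of_nondegenerate {b : V →L[ℂ] V →L[ℂ] ℂ}
    (h : ∀ x, (∀ y, b x y = 0) → x = 0) : b.IsInvertible := by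
  have hinj : Function.Injective b := by
    rw [injective_iff_map_eq_zero]
    intro x hx
    exact h x fun y => by rw [hx]; rfl
  have hfin : Module.finrank ℂ V = Module.finrank ℂ (V →L[ℂ] ℂ) := by
    rw [← (LinearMap.toContinuousLinearMap : (V →ₗ[ℂ] ℂ) ≃ₗ[ℂ] (V →L[ℂ] ℂ)).finrank_eq]
    exact (Subspace.dual_finrank_eq (K := ℂ) (V := V)).symm
  refine ⟨(LinearEquiv.ofInjectiveOfFinrankEq (b : V →ₗ[ℂ] V →L[ℂ] ℂ) hinj
    hfin).toContinuousLinearEquiv, ?_⟩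
  ext x y
  rfl

theorem eventually_isInvertible {b : V →L[ℂ] V →L[ℂ] ℂ} (h : b.IsInvertible) :
    ∀ᶠ c in 𝓝 b, c.IsInvertible := by
  have : CompleteSpace V := FiniteDimensional.complete ℂ V
  obtain ⟨e, rfl⟩ := h
  exact e.nhds

/-- The time-dependent vector field of Moser's method for the family of 2-forms `B (t • x)`. With
`β = A' (t • x) x x` the derivative of the primitive `A (t • x) x` in `t`, it is the solution of
`B (t • x) X = -β`. -/
noncomputable def moserField (A B : V → V →L[ℂ] V →L[ℂ] ℂ) (p : ℂ × V) : V :=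
  -(B (p.1 • p.2)).inverse (fderiv ℂ A (p.1 • p.2) p.2 p.2)

omit [FiniteDimensional ℂ V] in
theorem tendsto_smul_zero : Tendsto (fun p : ℂ × V => p.1 • p.2) (𝓝 0) (𝓝 0) :=
  (by fun_prop : Continuous fun p : ℂ × V => p.1 • p.2).tendsto' 0 0 (by simp)

omit [FiniteDimensional ℂ V] in
theorem moserField_zero (t : ℂ) : moserField A B (t, 0) = 0 := by
  simp [moserField]

theorem analyticAt_moserField (hA : AnalyticAt ℂ A 0) (hB : AnalyticAt ℂ B 0)
    (h : (B 0).IsInvertible) : AnalyticAt ℂ (moserField A B) 0 := by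
  have : CompleteSpace V := FiniteDimensional.complete ℂ V
  have hs : ContDiffAt ℂ ⊤ (fun p : ℂ × V => p.1 • p.2) 0 :=
    (contDiff_fst.smul contDiff_snd).contDiffAt
  have h0 : (0 : ℂ × V).1 • (0 : ℂ × V).2 = 0 := by simp
  have hA' : ContDiffAt ℂ ⊤ (fun p : ℂ × V => fderiv ℂ A (p.1 • p.2)) 0 :=
    ContDiffAt.comp (g := fderiv ℂ A) 0 (by rw [h0]; exact hA.fderiv.contDiffAt) hs
  have hB' : ContDiffAt ℂ ⊤ (fun p : ℂ × V => B (p.1 • p.2)) 0 :=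
    ContDiffAt.comp (g := B) 0 (by rw [h0]; exact hB.contDiffAt) hs
  have hinv : ContDiffAt ℂ ⊤ (fun p : ℂ × V => (B (p.1 • p.2)).inverse) 0 :=
    ContDiffAt.comp (g := ContinuousLinearMap.inverse) 0
      (by rw [h0]; exact h.contDiffAt_map_inverse) hB'
  have hβ : ContDiffAt ℂ ⊤ (fun p : ℂ × V => fderiv ℂ A (p.1 • p.2) p.2 p.2) 0 :=
    (hA'.clm_apply contDiffAt_snd).clm_apply contDiffAt_snd
  exact (hinv.clm_apply hβ).neg.analyticAt

theorem eventually_apply_moserField (hB : ContinuousAt B 0) (h : (B 0).IsInvertible) :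
    ∀ᶠ p in 𝓝 (0 : ℂ × V), (B (p.1 • p.2)).IsInvertible ∧
      B (p.1 • p.2) (moserField A B p) = -fderiv ℂ A (p.1 • p.2) p.2 p.2 := by
  have h1 : ∀ᶠ x in 𝓝 (0 : V), (B x).IsInvertible := hB.eventually (eventually_isInvertible h)
  filter_upwards [tendsto_smul_zero.eventually h1] with p hp
  refine ⟨hp, ?_⟩
  rw [moserField, map_neg, hp.self_apply_inverse]

/-- The vector field of Moser's method has the symmetries of the forms. -/
theorem eventually_moserField_equivariant (hB : ContinuousAt B 0) (h : (B 0).IsInvertible)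
    (L : V ≃L[ℂ] V) (hL : ∀ᶠ x in 𝓝 0, ∀ a b, B (L x) (L a) (L b) = B x a b)
    (hLA : ∀ᶠ x in 𝓝 0, ∀ a b c,
      fderiv ℂ A (L x) (L a) (L b) (L c) = fderiv ℂ A x a b c) :
    ∀ᶠ p in 𝓝 (0 : ℂ × V), moserField A B (p.1, L p.2) = L (moserField A B p) := by
  have hLt : Tendsto (fun p : ℂ × V => (p.1, L p.2)) (𝓝 0) (𝓝 0) :=
    (by fun_prop : Continuous fun p : ℂ × V => (p.1, L p.2)).tendsto' 0 0 (by simp)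
  have happ := eventually_apply_moserField (A := A) hB h
  filter_upwards [happ, hLt.eventually happ, tendsto_smul_zero.eventually hL,
    tendsto_smul_zero.eventually hLA] with p hp hp' hpL hpLA
  simp only [← map_smul] at hp'
  obtain ⟨e, he⟩ := hp'.1
  apply e.injective
  have he' : ∀ v, e v = B (L (p.1 • p.2)) v := fun v => by rw [← he]; rfl
  rw [he', he', hp'.2]
  ext b
  obtain ⟨b, rfl⟩ := L.surjective b
  rw [hpL, hp.2]
  exact congrArg Neg.neg (hpLA _ _ _)

/-- **Moser's equation**: the derivative in `t` of the pull-back of `B (t • x)` by the flow of the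
vector field vanishes. After the defining equation of the field and the identity for the primitive
are differentiated, this is the closedness of `B`. -/
theorem eventually_moser_equation {r : ℝ} (hr : 0 < r) (hB : IsClosedTwoFormOn B (ball 0 r))
    (h : (B 0).IsInvertible) (hA : AnalyticOnNhd ℂ A (ball 0 r))
    (hskew : ∀ x ∈ ball (0 : V) r, ∀ c a b, fderiv ℂ A x c a b = -fderiv ℂ A x c b a)
    (hprim : ∀ x ∈ ball (0 : V) r, ∀ a b,
        fderiv ℂ A x a x b - fderiv ℂ A x b x a + 2 * A x a b = B x a b) :
    ∀ᶠ p in 𝓝 (0 : ℂ × V), ∀ a b,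
      p.1 * fderiv ℂ B (p.1 • p.2) (moserField A B p) a b + fderiv ℂ B (p.1 • p.2) p.2 a b +
        B (p.1 • p.2) (fderiv ℂ (moserField A B) p (0, a)) b +
        B (p.1 • p.2) a (fderiv ℂ (moserField A B) p (0, b)) = 0 := by
  have : CompleteSpace V := FiniteDimensional.complete ℂ V
  have h0 := mem_ball_self (x := (0 : V)) hr
  have hX := analyticAt_moserField (hA 0 h0) (hB.analytic 0 h0) h
  have happ := eventually_apply_moserField (A := A) (hB.analytic 0 h0).continuousAt h
  filter_upwards [happ.eventually_nhds, hX.eventually_analyticAt,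
    tendsto_smul_zero.eventually (ball_mem_nhds (0 : V) hr)] with ⟨t, y⟩ hp hXp hz a b
  simp only at hz ⊢
  set z := t • y with hzdef
  set X := moserField A B (t, y) with hXdef
  have hAz : DifferentiableAt ℂ A z := (hA z hz).differentiableAt
  have hA'z : DifferentiableAt ℂ (fderiv ℂ A) z := (hA z hz).fderiv.differentiableAt
  have hBz : DifferentiableAt ℂ B z := (hB.analytic z hz).differentiableAt
  have hl : ∀ (w c : V), HasDerivAt (fun s : ℂ => w + s • c) c 0 := fun w c => by
    simpa using ((hasDerivAt_id (0 : ℂ)).smul_const c).const_add w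
  -- The derivative of the defining equation of the vector field in the direction `c`.
  have hfield : ∀ c b, t * fderiv ℂ B z c X b + B z (fderiv ℂ (moserField A B) (t, y) (0, c)) b =
      -(t * fderiv ℂ (fderiv ℂ A) z c y y b + fderiv ℂ A z c y b + fderiv ℂ A z y c b) := by
    intro c b
    have hz' : ∀ s : ℂ, t • (y + s • c) = z + s • (t • c) := fun s => by
      rw [smul_add, smul_comm t s c]
    have h1 : HasDerivAt (fun s : ℂ => B (t • (y + s • c))) (fderiv ℂ B z (t • c)) 0 := by
      simpa only [hz'] using hasDerivAt_line hBz (t • c)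
    have h2 : HasDerivAt (fun s : ℂ => fderiv ℂ A (t • (y + s • c)))
        (fderiv ℂ (fderiv ℂ A) z (t • c)) 0 := by
      simpa only [hz'] using hasDerivAt_line hA'z (t • c)
    have h3 : HasDerivAt (fun s : ℂ => moserField A B (t, y + s • c))
        (fderiv ℂ (moserField A B) (t, y) (0, c)) 0 := by
      simpa using hasDerivAt_line hXp.differentiableAt (0, c)
    have h4 := (h1.clm_apply h3).clm_apply (hasDerivAt_const 0 b)
    have h5 := (((h2.clm_apply (hl y c)).clm_apply (hl y c)).clm_apply (hasDerivAt_const 0 b)).neg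
    have hyt : ∀ᶠ y' in 𝓝 y, B (t • y') (moserField A B (t, y')) b =
        -fderiv ℂ A (t • y') y' y' b := by
      have hc : Tendsto (fun y' : V => (t, y')) (𝓝 y) (𝓝 (t, y)) :=
        (by fun_prop : Continuous fun y' : V => (t, y')).tendsto' y _ rfl
      filter_upwards [hc.eventually hp] with y' hy'
      have := congrArg (fun f => f b) hy'.2
      simpa using this
    have h6 := line_deriv_unique hyt h4 h5
    simp only [zero_smul, add_zero, map_zero, add_apply, ← hzdef,
      map_smul, smul_apply, smul_eq_mul] at h6
    rw [← hXdef] at h6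
    linear_combination h6
  -- The derivative of the primitive identity in the direction `y`.
  have hprim' : t * fderiv ℂ (fderiv ℂ A) z y a y b + fderiv ℂ A z a y b -
      (t * fderiv ℂ (fderiv ℂ A) z y b y a + fderiv ℂ A z b y a) + 2 * fderiv ℂ A z y a b =
      fderiv ℂ B z y a b := by
    have h1 : ∀ a b, HasDerivAt (fun s : ℂ => fderiv ℂ A (z + s • y) a (z + s • y) b)
        (t * fderiv ℂ (fderiv ℂ A) z y a y b + fderiv ℂ A z a y b) 0 := by
      intro a b
      have := (((hasDerivAt_line hA'z y).clm_apply (hasDerivAt_const 0 a)).clm_apply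
        (hl z y)).clm_apply (hasDerivAt_const 0 b)
      convert! this using 1
      simp [hzdef]
    exact line_deriv_unique
      (f := fun x => fderiv ℂ A x a x b - fderiv ℂ A x b x a + 2 * A x a b)
      (g := fun x => B x a b)
      (eventually_of_mem (isOpen_ball.mem_nhds hz) fun x hx => hprim x hx a b)
      (((h1 a b).sub (h1 b a)).add ((hasDerivAt_line_apply₂ hAz y a b).const_mul 2))
      (hasDerivAt_line_apply₂ hBz y a b)
  have hsymm : ∀ a b, fderiv ℂ (fderiv ℂ A) z a b = fderiv ℂ (fderiv ℂ A) z b a := fun a b =>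
    ((hA z hz).contDiffAt (n := 2)).isSymmSndFDerivAt (by simp) a b
  rw [hsymm y a, hsymm y b] at hprim'
  have hBskew := fderiv_skew hBz (eventually_of_mem (isOpen_ball.mem_nhds hz) hB.skew)
  linear_combination hfield a b - hfield b a +
    hB.skew z hz a (fderiv ℂ (moserField A B) (t, y) (0, b))
    - hprim' + t * hB.closed z hz X a b - t * hBskew a b X + hskew z hz y b a

end Moser

/-! ### The equivariant Darboux theorem -/

section Darboux

open Metric Set Filter

variable {V : Type*} [NormedAddCommGroup V] [NormedSpace ℂ V] [FiniteDimensional ℂ V]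
  {B : V → V →L[ℂ] V →L[ℂ] ℂ}

/-- Under Moser's equation, the pull-back of `B (t • x)` by the flow does not depend on `t`. -/
theorem eventually_pullback_flow_eq {X Φ : ℂ × V → V} (hB : AnalyticAt ℂ B 0)
    (hX : AnalyticAt ℂ X 0) (hΦ : AnalyticAt ℂ Φ 0) (hΦ0 : ∀ x, Φ (0, x) = x)
    (hflow : ∀ᶠ p in 𝓝 (0 : ℂ × V), HasDerivAt (fun t => Φ (t, p.2)) (X (p.1, Φ p)) p.1)
    (hmoser : ∀ᶠ p in 𝓝 (0 : ℂ × V), ∀ a b,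
      p.1 * fderiv ℂ B (p.1 • p.2) (X p) a b + fderiv ℂ B (p.1 • p.2) p.2 a b +
        B (p.1 • p.2) (fderiv ℂ X p (0, a)) b +
        B (p.1 • p.2) a (fderiv ℂ X p (0, b)) = 0) :
    ∀ᶠ p in 𝓝 (0 : ℂ × V), ∀ a b,
      B (p.1 • Φ p) (fderiv ℂ Φ p (0, a)) (fderiv ℂ Φ p (0, b)) = B 0 a b := by
  have : CompleteSpace V := FiniteDimensional.complete ℂ V
  have hΦ00 : Φ 0 = 0 := hΦ0 0
  have hpair : Tendsto (fun p : ℂ × V => (p.1, Φ p)) (𝓝 0) (𝓝 0) := by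
    have h := (continuousAt_fst (p := (0 : ℂ × V))).prodMk hΦ.continuousAt
    rw [ContinuousAt, hΦ00] at h
    exact h
  have hsmul : Tendsto (fun p : ℂ × V => p.1 • Φ p) (𝓝 0) (𝓝 0) := tendsto_smul_zero.comp hpair
  obtain ⟨δ, hδ, hball⟩ := Metric.eventually_nhds_iff_ball.mp
    (hΦ.eventually_analyticAt.and (hflow.and ((hpair.eventually hmoser).and
      ((hpair.eventually hX.eventually_analyticAt).and
        (hsmul.eventually hB.eventually_analyticAt)))))
  filter_upwards [ball_mem_nhds (0 : ℂ × V) hδ] with p hp a b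
  have hmem : ∀ t ∈ ball (0 : ℂ) δ, (t, p.2) ∈ ball (0 : ℂ × V) δ := by
    intro t ht
    rw [mem_ball_zero_iff] at hp ht ⊢
    rw [Prod.norm_def, max_lt_iff] at hp ⊢
    exact ⟨ht, hp.2⟩
  -- The variational equation along the flow.
  have hvar : ∀ t ∈ ball (0 : ℂ) δ, ∀ a, HasDerivAt (fun t => fderiv ℂ Φ (t, p.2) (0, a))
      (fderiv ℂ X (t, Φ (t, p.2)) (0, fderiv ℂ Φ (t, p.2) (0, a))) t := by
    intro t ht a
    obtain ⟨hΦt, hft, hmt, hXt, hBt⟩ := hball _ (hmem t ht)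
    have hcurve : HasDerivAt (fun t : ℂ => (t, p.2)) (1, 0) t :=
      (hasDerivAt_id t).prodMk (hasDerivAt_const t p.2)
    have h1 : HasDerivAt (fun t : ℂ => fderiv ℂ Φ (t, p.2))
        (fderiv ℂ (fderiv ℂ Φ) (t, p.2) (1, 0)) t :=
      hΦt.fderiv.differentiableAt.hasFDerivAt.comp_hasDerivAt t hcurve
    have h2 := h1.clm_apply (hasDerivAt_const t ((0 : ℂ), a))
    have hsymm := (hΦt.contDiffAt (n := 2)).isSymmSndFDerivAt (by simp) (1, 0) (0, a)
    have htime : ∀ᶠ q in 𝓝 (t, p.2), fderiv ℂ Φ q (1, 0) = X (q.1, Φ q) := by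
      filter_upwards [isOpen_ball.mem_nhds (hmem t ht)] with q hq
      have hcq : HasDerivAt (fun s : ℂ => (s, q.2)) ((1 : ℂ), (0 : V)) q.1 :=
        (hasDerivAt_id q.1).prodMk (hasDerivAt_const q.1 q.2)
      have h := (hball q hq).1.differentiableAt.hasFDerivAt.comp_hasDerivAt q.1 hcq
      exact h.unique (hball q hq).2.1
    have h3 := (hasDerivAt_line hΦt.fderiv.differentiableAt ((0 : ℂ), a)).clm_apply
      (hasDerivAt_const 0 ((1 : ℂ), (0 : V)))
    have h4 : HasDerivAt (fun s : ℂ => X (((t, p.2) + s • ((0 : ℂ), a)).1,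
        Φ ((t, p.2) + s • ((0 : ℂ), a))))
        (fderiv ℂ X (t, Φ (t, p.2)) (0, fderiv ℂ Φ (t, p.2) (0, a))) 0 := by
      have hc1 : HasDerivAt (fun s : ℂ => ((t, p.2) + s • ((0 : ℂ), a)).1) 0 0 := by
        simpa using hasDerivAt_const (0 : ℂ) t
      have hc2 := hc1.prodMk (hasDerivAt_line hΦt.differentiableAt ((0 : ℂ), a))
      have hXt' : HasFDerivAt X (fderiv ℂ X (t, Φ (t, p.2)))
          (((t, p.2) + (0 : ℂ) • ((0 : ℂ), a)).1, Φ ((t, p.2) + (0 : ℂ) • ((0 : ℂ), a))) := by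
        simpa using hXt.differentiableAt.hasFDerivAt
      exact hXt'.comp_hasDerivAt 0 hc2
    have h5 := line_deriv_unique (f := fun q => fderiv ℂ Φ q (1, 0)) (g := fun q => X (q.1, Φ q))
      htime h3 h4
    rw [map_zero, add_zero] at h5 h2
    rwa [hsymm, h5] at h2
  have hder : ∀ t ∈ ball (0 : ℂ) δ, HasDerivAt (fun t => B (t • Φ (t, p.2))
      (fderiv ℂ Φ (t, p.2) (0, a)) (fderiv ℂ Φ (t, p.2) (0, b))) 0 t := by
    intro t ht
    obtain ⟨hΦt, hft, hmt, hXt, hBt⟩ := hball _ (hmem t ht)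
    have h1 : HasDerivAt (fun t => t • Φ (t, p.2)) (t • X (t, Φ (t, p.2)) + Φ (t, p.2)) t := by
      convert! (hasDerivAt_id t).smul hft using 1
      simp
    have h2 : HasDerivAt (fun t => B (t • Φ (t, p.2)))
        (fderiv ℂ B (t • Φ (t, p.2)) (t • X (t, Φ (t, p.2)) + Φ (t, p.2))) t :=
      hBt.differentiableAt.hasFDerivAt.comp_hasDerivAt t h1
    convert! (h2.clm_apply (hvar t ht a)).clm_apply (hvar t ht b) using 1
    have := hmt (fderiv ℂ Φ (t, p.2) (0, a)) (fderiv ℂ Φ (t, p.2) (0, b))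
    simp only [map_add, map_smul, add_apply, smul_apply, smul_eq_mul] at this ⊢
    linear_combination -this
  have hconst := isOpen_ball.is_const_of_deriv_eq_zero
    (convex_ball (0 : ℂ) δ).isPreconnected
    (fun t ht => (hder t ht).differentiableAt.differentiableWithinAt)
    (fun t ht => (hder t ht).deriv) (x := p.1) (y := 0)
    (by
      rw [mem_ball_zero_iff] at hp ⊢
      rw [Prod.norm_def, max_lt_iff] at hp
      exact hp.1) (mem_ball_self hδ)
  have hinit : ∀ a, fderiv ℂ Φ (0, p.2) (0, a) = a := by
    intro a
    have h1 := hasDerivAt_line (hball _ (hmem 0 (mem_ball_self hδ))).1.differentiableAt ((0 : ℂ), a)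
    have h2 : HasDerivAt (fun s : ℂ => p.2 + s • a) a 0 := by
      simpa using ((hasDerivAt_id (0 : ℂ)).smul_const a).const_add p.2
    refine h1.unique (h2.congr_of_eventuallyEq (Eventually.of_forall fun s => ?_))
    simp [hΦ0]
  simpa [hinit] using hconst

/-- **Equivariant Darboux theorem**: a holomorphic symplectic form near the origin of a vector
space becomes constant in suitable coordinates, which can be chosen equivariant under finitely many
linear symmetries of the form. -/
theorem exists_equivariant_darboux {ι : Type*} [Finite ι] (L : ι → V ≃L[ℂ] V)
    (hB : AnalyticAt ℂ B 0) (hskew : ∀ᶠ x in 𝓝 (0 : V), ∀ a b, B x a b = -B x b a)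
    (hclosed : ∀ᶠ x in 𝓝 (0 : V), ∀ a b c,
      fderiv ℂ B x a b c + fderiv ℂ B x b c a + fderiv ℂ B x c a b = 0)
    (hnd : ∀ x, (∀ y, B 0 x y = 0) → x = 0)
    (hL : ∀ i, ∀ᶠ x in 𝓝 0, ∀ a b, B (L i x) (L i a) (L i b) = B x a b) :
    ∃ φ : V → V, AnalyticAt ℂ φ 0 ∧ φ 0 = 0 ∧
      (∀ᶠ y in 𝓝 0, ∀ a b, B (φ y) (fderiv ℂ φ y a) (fderiv ℂ φ y b) = B 0 a b) ∧
      ∀ i, ∀ᶠ y in 𝓝 0, φ (L i y) = L i (φ y) := by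
  have : CompleteSpace V := FiniteDimensional.complete ℂ V
  obtain ⟨r, hr, hball⟩ := Metric.eventually_nhds_iff_ball.mp
    (hB.eventually_analyticAt.and (hskew.and hclosed))
  have hform : IsClosedTwoFormOn B (ball 0 r) :=
    ⟨fun x hx => (hball x hx).1, fun x hx => (hball x hx).2.1, fun x hx => (hball x hx).2.2⟩
  have hinv := isInvertible_of_nondegenerate hnd
  obtain ⟨A, hA, hAskew, hprim, hAL⟩ := exists_poincare_primitive hr hform
  have hA0 := hA 0 (mem_ball_self hr)
  have hX := analyticAt_moserField hA0 hB hinv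
  have hmoser := eventually_moser_equation hr hform hinv hA hAskew hprim
  set X := moserField A B with hXdef
  obtain ⟨Φ, hΦ, hΦ0, hflow⟩ := exists_analytic_flow hX
  have hΦ00 : Φ 0 = 0 := hΦ0 0
  have hpull := eventually_pullback_flow_eq hB hX hΦ hΦ0 hflow hmoser
  have hfix : ∀ᶠ p in 𝓝 (0 : ℂ × V), Φ (p.1, 0) = 0 := by
    have hproj : Tendsto (fun p : ℂ × V => (p.1, (0 : V))) (𝓝 0) (𝓝 0) :=
      (by fun_prop : Continuous fun p : ℂ × V => (p.1, (0 : V))).tendsto' 0 0 rfl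
    have hcont : ContinuousAt (fun p : ℂ × V => Φ (p.1, 0)) 0 := by
      have h := hΦ.continuousAt.tendsto.comp hproj
      exact h
    have h := eventuallyEq_of_flow (Φ := fun p => Φ (p.1, 0)) (Ψ := fun _ => 0) hX hcont hΦ00
      continuousAt_const rfl (Eventually.of_forall fun _ => hΦ00) (hproj.eventually hflow)
      (Eventually.of_forall fun p => by
        rw [hXdef, moserField_zero]
        exact hasDerivAt_const _ _)
    exact h
  -- The flow conjugated by a symmetry solves the same equation with the same initial values.
  have hequiv : ∀ i, ∀ᶠ p in 𝓝 (0 : ℂ × V), Φ (p.1, L i p.2) = L i (Φ p) := by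
    intro i
    have hXL := eventually_moserField_equivariant hB.continuousAt hinv (L i) (hL i)
      (hAL (L i) (hL i))
    have hLt : Tendsto (fun p : ℂ × V => (p.1, L i p.2)) (𝓝 0) (𝓝 0) :=
      (by fun_prop : Continuous fun p : ℂ × V => (p.1, L i p.2)).tendsto' 0 0 (by simp)
    have hΨcont : ContinuousAt (fun p : ℂ × V => (L i).symm (Φ (p.1, L i p.2))) 0 := by
      have h1 : Tendsto (fun p : ℂ × V => Φ (p.1, L i p.2)) (𝓝 0) (𝓝 (Φ 0)) :=
        hΦ.continuousAt.tendsto.comp hLt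
      have h2 := ((L i).symm.continuous.tendsto (Φ 0)).comp h1
      rw [ContinuousAt]
      convert! h2 using 2
      simp only [Prod.fst_zero, Prod.snd_zero, map_zero]
      rfl
    have hpair : Tendsto (fun p : ℂ × V => (p.1, (L i).symm (Φ (p.1, L i p.2)))) (𝓝 0) (𝓝 0) := by
      have h := (continuousAt_fst (p := (0 : ℂ × V))).prodMk hΨcont
      rw [ContinuousAt] at h
      convert! h using 2
      simp only [Prod.fst_zero, Prod.snd_zero, map_zero, hΦ0]
      rfl
    have h := eventuallyEq_of_flow (Ψ := fun p => (L i).symm (Φ (p.1, L i p.2))) hX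
      hΦ.continuousAt hΦ00 hΨcont (by simp [hΦ0])
      (Eventually.of_forall fun x => by simp [hΦ0]) hflow (by
        filter_upwards [hLt.eventually hflow, hpair.eventually hXL] with p hp hpX
        have h1 := ((L i).symm : V →L[ℂ] V).hasFDerivAt.comp_hasDerivAt p.1 hp
        simp only [ContinuousLinearEquiv.apply_symm_apply] at hpX
        rw [← hXdef] at hpX
        convert! h1 using 1
        simp [hpX])
    filter_upwards [h] with p hp
    rw [hp, ContinuousLinearEquiv.apply_symm_apply]
  obtain ⟨δ, hδ, hδball⟩ := Metric.eventually_nhds_iff_ball.mp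
    (hΦ.eventually_analyticAt.and (hpull.and (hfix.and (eventually_all.mpr hequiv))))
  -- Moser's method gives an isomorphism between `B (ε • x)` and `B 0`; the factor `ε` is then
  -- scaled away.
  let ε : ℂ := ((δ / 2 : ℝ) : ℂ)
  have hε : ε ≠ 0 := Complex.ofReal_ne_zero.mpr (half_pos hδ).ne'
  have hmem0 : (ε, (0 : V)) ∈ ball (0 : ℂ × V) δ := by
    rw [mem_ball_zero_iff, Prod.norm_def, max_lt_iff]
    simp only [ε, Complex.norm_real, norm_zero]
    rw [Real.norm_of_nonneg (half_pos hδ).le]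
    exact ⟨half_lt_self hδ, hδ⟩
  have hcurve : Continuous fun y : V => (ε, ε⁻¹ • y) := by fun_prop
  have hmem : ∀ᶠ y in 𝓝 (0 : V), (ε, ε⁻¹ • y) ∈ ball (0 : ℂ × V) δ :=
    (isOpen_ball.preimage hcurve).mem_nhds (by simpa using hmem0)
  refine ⟨fun y => ε • Φ (ε, ε⁻¹ • y), ?_, ?_, ?_, fun i => ?_⟩
  · refine AnalyticAt.const_smul ?_
    refine AnalyticAt.fun_comp (g := Φ) (f := fun y : V => (ε, ε⁻¹ • y)) ?_
      (analyticAt_const.prod analyticAt_id.const_smul)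
    simpa using (hδball _ hmem0).1
  · have h := (hδball _ hmem0).2.2.1
    simp only at h
    simp [h]
  · filter_upwards [hmem] with y hy a b
    have hd : ∀ a, fderiv ℂ (fun y => ε • Φ (ε, ε⁻¹ • y)) y a =
        fderiv ℂ Φ (ε, ε⁻¹ • y) (0, a) := by
      intro a
      have h1 : HasFDerivAt (fun y : V => (ε, ε⁻¹ • y))
          ((0 : V →L[ℂ] ℂ).prod (ε⁻¹ • ContinuousLinearMap.id ℂ V)) y :=
        (hasFDerivAt_const ε y).prodMk ((hasFDerivAt_id y).const_smul ε⁻¹)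
      have h2 := ((hδball _ hy).1.differentiableAt.hasFDerivAt.comp y h1).const_smul ε
      have h3 : fderiv ℂ (fun y => ε • Φ (ε, ε⁻¹ • y)) y = _ := h2.fderiv
      rw [h3]
      have h4 : ((0 : ℂ), ε⁻¹ • a) = ε⁻¹ • ((0 : ℂ), a) := by simp
      simp only [smul_apply, ContinuousLinearMap.comp_apply,
        ContinuousLinearMap.prod_apply, zero_apply, ContinuousLinearMap.id_apply]
      rw [h4, map_smul, smul_smul, mul_inv_cancel₀ hε, one_smul]
    rw [hd, hd]
    exact (hδball _ hy).2.1 a b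
  · filter_upwards [hmem] with y hy
    have := (hδball _ hy).2.2.2 i
    rw [← map_smul, this, map_smul]

end Darboux

/-! ### Linear symplectic geometry -/

section LinearAlgebra

open Polynomial

/-- `X` is a square modulo every polynomial that does not vanish at `0`. A linear factor `X - λ` is
added to the modulus by solving for `c` in the correction `p + c f` of the root `p` modulo `f`; this
is a quadratic equation, or a linear one with leading coefficient `2 p (λ) ≠ 0`. -/
theorem exists_dvd_sq_sub_X {f : ℂ[X]} (hf : f.eval 0 ≠ 0) : ∃ p : ℂ[X], f ∣ p ^ 2 - X := by
  have key : ∀ s : Multiset ℂ, (0 : ℂ) ∉ s → ∃ p : ℂ[X],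
      (s.map fun a => X - C a).prod ∣ p ^ 2 - X := by
    intro s
    induction s using Multiset.induction_on with
    | empty => exact fun _ => ⟨0, by simp⟩
    | cons l s ih =>
      intro hs
      rw [Multiset.mem_cons, not_or] at hs
      obtain ⟨p, h, hp⟩ := ih hs.2
      set f := (s.map fun a => X - C a).prod
      obtain ⟨c, hc⟩ : ∃ c : ℂ, h.eval l + 2 * c * p.eval l + c ^ 2 * f.eval l = 0 := by
        by_cases hfl : f.eval l = 0
        · have hpl : p.eval l ≠ 0 := by
            intro hpl
            have := congrArg (eval l) hp
            simp only [eval_sub, eval_pow, eval_X, eval_mul, hfl, hpl] at this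
            apply hs.1
            linear_combination this
          refine ⟨-h.eval l / (2 * p.eval l), ?_⟩
          rw [hfl]
          field_simp
          ring
        · obtain ⟨d, hd⟩ := IsAlgClosed.exists_pow_nat_eq
            ((p.eval l) ^ 2 - f.eval l * h.eval l) (n := 2) (by norm_num)
          refine ⟨(d - p.eval l) / f.eval l, ?_⟩
          field_simp
          linear_combination hd
      obtain ⟨q, hq⟩ : X - C l ∣ h + 2 * C c * p + C c ^ 2 * f := by
        rw [dvd_iff_isRoot, IsRoot.def]
        simpa using hc
      refine ⟨p + C c * f, q, ?_⟩
      rw [Multiset.map_cons, Multiset.prod_cons]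
      linear_combination hp + f * hq
  have hf0 : f ≠ 0 := by
    rintro rfl
    simp at hf
  obtain ⟨p, hp⟩ := key f.roots fun h => hf (mem_roots'.mp h).2
  refine ⟨p, ?_⟩
  rw [(IsAlgClosed.splits f).eq_prod_roots]
  exact (isUnit_C.mpr (leadingCoeff_ne_zero.mpr hf0).isUnit).mul_left_dvd.mpr hp

variable {V : Type*} [NormedAddCommGroup V] [NormedSpace ℂ V] [FiniteDimensional ℂ V]

/-- Any two symplectic forms on a complex vector space are related by an isomorphism that commutes
with all common symmetries of the two forms: if `b₀ (x, y) = b₁ (A x, y)`, a square root of `A` that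
is a polynomial in `A` has these properties. -/
theorem exists_commuting_isometry {b₀ b₁ : V →L[ℂ] V →L[ℂ] ℂ}
    (h₀ : ∀ x y, b₀ x y = -b₀ y x) (h₁ : ∀ x y, b₁ x y = -b₁ y x)
    (hnd₀ : ∀ x, (∀ y, b₀ x y = 0) → x = 0) (hnd₁ : ∀ x, (∀ y, b₁ x y = 0) → x = 0) :
    ∃ S : V ≃L[ℂ] V, (∀ x y, b₁ (S x) (S y) = b₀ x y) ∧
      ∀ L : V ≃L[ℂ] V, (∀ x y, b₀ (L x) (L y) = b₀ x y) → (∀ x y, b₁ (L x) (L y) = b₁ x y) →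
        ∀ x, S (L x) = L (S x) := by
  obtain ⟨J, hJ⟩ := isInvertible_of_nondegenerate hnd₁
  have hJ' : ∀ x y, J x y = b₁ x y := fun x y => by rw [← hJ]; rfl
  let A : Module.End ℂ V := (J.symm : (V →L[ℂ] ℂ) →ₗ[ℂ] V) ∘ₗ (b₀ : V →ₗ[ℂ] V →L[ℂ] ℂ)
  have hA : ∀ x y, b₁ (A x) y = b₀ x y := fun x y => by
    rw [← hJ']
    simp [A]
  have hA_adj : ∀ x y, b₁ (A x) y = b₁ x (A y) := fun x y => by
    rw [hA, h₁ x, hA, h₀]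
  have hAinj : ∀ x, A x = 0 → x = 0 := fun x hx => hnd₀ x fun y => by
    rw [← hA, hx]
    simp
  have hmin : (minpoly ℂ A).eval 0 ≠ 0 := by
    intro h
    have := Module.End.hasEigenvalue_of_isRoot h
    obtain ⟨v, hv⟩ := this.exists_hasEigenvector
    exact hv.2 (hAinj v (by simpa using hv.apply_eq_smul))
  obtain ⟨p, q, hpq⟩ := exists_dvd_sq_sub_X hmin
  let S : Module.End ℂ V := aeval A p
  have hS2 : S * S = A := by
    have := congrArg (aeval A) hpq
    rw [map_mul, minpoly.aeval, zero_mul, map_sub, map_pow, aeval_X, sub_eq_zero] at this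
    rw [← pow_two]
    exact this
  have hS_adj : ∀ x y, b₁ (S x) y = b₁ x (S y) := by
    have : ∀ p : ℂ[X], ∀ x y, b₁ (aeval A p x) y = b₁ x (aeval A p y) := by
      intro p
      induction p using Polynomial.induction_on with
      | C a => simp [Module.algebraMap_end_apply]
      | add p q hp hq => simp [hp, hq]
      | monomial n a h =>
        intro x y
        rw [pow_succ, ← mul_assoc, map_mul, aeval_X, Module.End.mul_apply, h, hA_adj,
          ← Module.End.mul_apply]
        have hcomm : ∀ q : ℂ[X], A * aeval A q = aeval A q * A := fun q => by
          have h := congrArg (aeval A) (mul_comm X q)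
          rwa [map_mul, map_mul, aeval_X] at h
        rw [hcomm]
    exact this p
  have hS : ∀ x y, b₁ (S x) (S y) = b₀ x y := fun x y => by
    rw [hS_adj, ← Module.End.mul_apply, hS2, ← hA_adj, hA]
  have hSinj : Function.Injective S := by
    rw [injective_iff_map_eq_zero]
    intro x hx
    refine hnd₀ x fun y => ?_
    rw [← hS, hx]
    simp
  refine ⟨(LinearEquiv.ofInjectiveEndo S hSinj).toContinuousLinearEquiv, hS, fun L hL₀ hL₁ x => ?_⟩
  have hAL : ∀ x, A (L x) = L (A x) := by
    intro x
    have : ∀ y, b₁ (A (L x) - L (A x)) y = 0 := by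
      intro y
      obtain ⟨y, rfl⟩ := L.surjective y
      rw [map_sub, sub_apply, hA, hL₀, hL₁, hA, sub_self]
    exact sub_eq_zero.mp (hnd₁ _ this)
  have hp : ∀ p : ℂ[X], ∀ x, aeval A p (L x) = L (aeval A p x) := by
    intro p
    induction p using Polynomial.induction_on with
    | C a => simp [Module.algebraMap_end_apply]
    | add p q hp hq => simp [hp, hq]
    | monomial n a h =>
      intro x
      rw [pow_succ, ← mul_assoc, map_mul, aeval_X, Module.End.mul_apply, hAL, h]
      rfl
  exact hp p x

/-- A nontrivial symplectic linear map of finite order is not a reflection: its fixed space has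
codimension at least two. Indeed, if the image of `g - 1` were a line, it would be an eigenline of
`g` that is orthogonal to the fixed space and to itself, hence to everything. -/
theorem finrank_fixed_add_two_le {b : V →ₗ[ℂ] V →ₗ[ℂ] ℂ} (hb : ∀ x, b x x = 0)
    (hnd : ∀ x, (∀ y, b y x = 0) → x = 0) {g : Module.End ℂ V} (hg : ∀ x y, b (g x) (g y) = b x y)
    (hg1 : g ≠ 1) {k : ℕ} (hk : k ≠ 0) (hgk : g ^ k = 1) :
    Module.finrank ℂ (LinearMap.ker (g - 1)) + 2 ≤ Module.finrank ℂ V := by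
  have hrk := LinearMap.finrank_range_add_finrank_ker (g - 1 : Module.End ℂ V)
  by_contra hlt
  have hle : Module.finrank ℂ (LinearMap.range (g - 1)) ≤ 1 := by omega
  obtain ⟨⟨u, hu⟩, hspan⟩ := finrank_le_one_iff.mp hle
  have hrange : ∀ y, ∃ c : ℂ, g y - y = c • u := by
    intro y
    obtain ⟨c, hc⟩ := hspan ⟨(g - 1) y, LinearMap.mem_range_self _ y⟩
    exact ⟨c, by simpa using (congrArg Subtype.val hc).symm⟩
  have hfix : ∀ x y, g x = x → b x (g y - y) = 0 := by
    intro x y hx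
    have := hg x y
    rw [hx] at this
    rw [map_sub, this, sub_self]
  have hu0 : u ≠ 0 := by
    rintro rfl
    apply hg1
    ext y
    obtain ⟨c, hc⟩ := hrange y
    rw [smul_zero, sub_eq_zero] at hc
    simpa using hc
  obtain ⟨y, hy⟩ := hu
  have hy' : g y = y + u := by
    rw [← hy]
    simp
  -- Otherwise `g` would be a transvection, which has infinite order.
  have hgu : g u ≠ u := by
    intro hgu
    have hpow : ∀ m : ℕ, (g ^ m) y = y + (m : ℂ) • u := by
      intro m
      induction m with
      | zero => simp
      | succ m ih =>
        rw [pow_succ', Module.End.mul_apply, ih, map_add, map_smul, hgu, hy']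
        push_cast
        module
    have := hpow k
    rw [hgk, Module.End.one_apply, left_eq_add, smul_eq_zero] at this
    rcases this with h | h
    · exact hk (by exact_mod_cast h)
    · exact hu0 h
  obtain ⟨c, hc⟩ := hrange u
  have hc0 : c ≠ 0 := by
    rintro rfl
    rw [zero_smul, sub_eq_zero] at hc
    exact hgu hc
  apply hu0
  refine hnd u fun z => ?_
  obtain ⟨d, hd⟩ := hrange z
  have hz : g (z - (d / c) • u) = z - (d / c) • u := by
    have h1 : g z = z + d • u := by rw [← hd]; abel
    have h2 : g u = u + c • u := by rw [← hc]; abel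
    rw [map_sub, map_smul, h1, h2, smul_add, smul_smul, div_mul_cancel₀ _ hc0]
    abel
  have h3 := hfix _ y hz
  rw [hy', add_sub_cancel_left, map_sub, LinearMap.sub_apply, map_smul, LinearMap.smul_apply,
    hb, smul_zero, sub_zero] at h3
  exact h3

end LinearAlgebra

/-! ### The action and the orbit space -/

section Action

open Set

variable {n : ℕ} {G : Subgroup (Matrix.symplecticGroup (Fin n) ℂ)}

/-- The linear automorphism of `ℂ²ⁿ` given by a symplectic matrix. -/
noncomputable def act (g : Matrix.symplecticGroup (Fin n) ℂ) : Space n ≃L[ℂ] Space n :=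
  (LinearEquiv.ofLinearMap (Matrix.mulVecLin (g : Matrix (Fin n ⊕ Fin n) (Fin n ⊕ Fin n) ℂ))
    (Matrix.mulVecLin ((g⁻¹ : Matrix.symplecticGroup (Fin n) ℂ) :
      Matrix (Fin n ⊕ Fin n) (Fin n ⊕ Fin n) ℂ))
    (by rw [← Matrix.mulVecLin_mul, ← Submonoid.coe_mul, mul_inv_cancel]; simp)
    (by rw [← Matrix.mulVecLin_mul, ← Submonoid.coe_mul, inv_mul_cancel]; simp)
    ).toContinuousLinearEquiv

theorem act_apply (g : Matrix.symplecticGroup (Fin n) ℂ) (v : Space n) :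
    act g v = (g : Matrix (Fin n ⊕ Fin n) (Fin n ⊕ Fin n) ℂ) *ᵥ v := rfl

theorem act_mul_apply (g h : Matrix.symplecticGroup (Fin n) ℂ) (v : Space n) :
    act (g * h) v = act g (act h v) := by
  rw [act_apply, act_apply, act_apply, Matrix.mulVec_mulVec, Submonoid.coe_mul]

theorem act_one_apply (v : Space n) : act (1 : Matrix.symplecticGroup (Fin n) ℂ) v = v := by
  rw [act_apply]
  simp

theorem act_inv_act (g : Matrix.symplecticGroup (Fin n) ℂ) (v : Space n) :
    act g⁻¹ (act g v) = v := by
  rw [← act_mul_apply, inv_mul_cancel, act_one_apply]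

theorem proj_eq_iff {v w : Space n} : proj G v = proj G w ↔ ∃ g ∈ G, act g v = w :=
  Quotient.eq (r := orbitSetoid G)

theorem proj_act {g : Matrix.symplecticGroup (Fin n) ℂ} (hg : g ∈ G) (v : Space n) :
    proj G (act g v) = proj G v :=
  (proj_eq_iff.mpr ⟨g, hg, rfl⟩).symm

theorem continuous_proj : Continuous (proj G) := continuous_quotient_mk'

theorem proj_surjective : Function.Surjective (proj G) := Quotient.mk_surjective

theorem isOpenMap_proj : IsOpenMap (proj G) := by
  intro O hO
  have h : proj G ⁻¹' (proj G '' O) = ⋃ g ∈ G, act g ⁻¹' O := by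
    ext v
    simp only [mem_preimage, mem_image, mem_iUnion, exists_prop]
    constructor
    · rintro ⟨w, hw, hwv⟩
      obtain ⟨g, hg, rfl⟩ := proj_eq_iff.mp hwv.symm
      exact ⟨g, hg, hw⟩
    · rintro ⟨g, hg, hv⟩
      exact ⟨_, hv, proj_act hg v⟩
  refine isOpen_coinduced.mpr ?_
  change IsOpen (proj G ⁻¹' (proj G '' O))
  rw [h]
  exact isOpen_biUnion fun g _ => hO.preimage (act g).continuous

theorem map_proj_nhds (v : Space n) : Filter.map (proj G) (𝓝 v) = 𝓝 (proj G v) :=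
  le_antisymm continuous_proj.continuousAt (isOpenMap_proj.nhds_le v)

variable (G) in
/-- The points of `ℂ²ⁿ` with trivial stabilizer in `G`. -/
def IsFree (v : Space n) : Prop := ∀ g ∈ G, act g v = v → g = 1

theorem IsFree.act {v : Space n} (hv : IsFree G v) {g : Matrix.symplecticGroup (Fin n) ℂ}
    (hg : g ∈ G) : IsFree G (act g v) := by
  intro h hh hhv
  have h1 : QuotSing.act (g⁻¹ * h * g) v = v := by
    rw [act_mul_apply, act_mul_apply, hhv, act_inv_act]
  have h2 := hv _ (G.mul_mem (G.mul_mem (G.inv_mem hg) hh) hg) h1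
  rw [mul_assoc, inv_mul_eq_one] at h2
  exact right_eq_mul.mp h2

/-- The space of vectors fixed by a symplectic matrix. -/
noncomputable def fixedSpace (g : Matrix.symplecticGroup (Fin n) ℂ) : Submodule ℂ (Space n) :=
  LinearMap.ker (((act g : Space n →L[ℂ] Space n) : Module.End ℂ (Space n)) - 1)

theorem mem_fixedSpace {g : Matrix.symplecticGroup (Fin n) ℂ} {v : Space n} :
    v ∈ fixedSpace g ↔ act g v = v := by
  rw [fixedSpace, LinearMap.mem_ker, LinearMap.sub_apply, sub_eq_zero]
  rfl

theorem isFree_iff {v : Space n} :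
    IsFree G v ↔ ∀ i : {g : G // g ≠ 1}, v ∉ fixedSpace (i : G).1 := by
  simp only [mem_fixedSpace]
  constructor
  · intro h i hi
    exact i.2 (Subtype.ext (h _ (i : G).2 hi))
  · intro h g hg hv
    by_contra hne
    exact h ⟨⟨g, hg⟩, fun h1 => hne (congrArg Subtype.val h1)⟩ hv

theorem finrank_fixedSpace_add_two_le {g : Matrix.symplecticGroup (Fin n) ℂ}
    (hg : IsOfFinOrder g) (hg1 : g ≠ 1) :
    Module.finrank ℂ (fixedSpace g) + 2 ≤ Module.finrank ℂ (Space n) := by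
  let J := Matrix.J (Fin n) ℂ
  have hb : ∀ x y : Space n, Matrix.toLinearMap₂' ℂ J x y = x ⬝ᵥ J *ᵥ y := fun x y =>
    Matrix.toLinearMap₂'_apply' J x y
  have hskew : ∀ x y : Space n, x ⬝ᵥ J *ᵥ y = -(y ⬝ᵥ J *ᵥ x) := by
    intro x y
    rw [Matrix.dotProduct_mulVec, ← Matrix.mulVec_transpose, Matrix.J_transpose, Matrix.neg_mulVec,
      neg_dotProduct, dotProduct_comm]
  have hact : ∀ (m : ℕ) (v : Space n),
      (((act g : Space n →L[ℂ] Space n) : Module.End ℂ (Space n)) ^ m) v = act (g ^ m) v := by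
    intro m
    induction m with
    | zero =>
      intro v
      rw [pow_zero, pow_zero, act_one_apply]
      rfl
    | succ m ih =>
      intro v
      rw [pow_succ, pow_succ, Module.End.mul_apply, act_mul_apply, ih]
      rfl
  refine finrank_fixed_add_two_le (b := Matrix.toLinearMap₂' ℂ J) (fun x => ?_) (fun x hx => ?_)
    (fun x y => ?_) (fun h => hg1 ?_) hg.orderOf_pos.ne' ?_
  · rw [hb]
    exact self_eq_neg.mp (hskew x x)
  · simp only [hb] at hx
    have h1 : J *ᵥ x = 0 := dotProduct_eq_zero _ fun y => by
      rw [dotProduct_comm]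
      exact hx y
    have h2 := congrArg (fun w => J *ᵥ w) h1
    simp only [Matrix.mulVec_mulVec, Matrix.mulVec_zero] at h2
    rw [Matrix.J_squared, Matrix.neg_mulVec, Matrix.one_mulVec, neg_eq_zero] at h2
    exact h2
  · rw [hb, hb]
    change (g : Matrix _ _ ℂ) *ᵥ x ⬝ᵥ J *ᵥ ((g : Matrix _ _ ℂ) *ᵥ y) = _
    rw [← Matrix.vecMul_transpose, ← Matrix.dotProduct_mulVec, Matrix.mulVec_mulVec,
      Matrix.mulVec_mulVec, SymplecticGroup.mem_iff'.mp g.2]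
  · apply Subtype.ext
    apply Matrix.ext_of_mulVec_single
    intro i
    have := congrArg (fun f : Module.End ℂ (Space n) => f (Pi.single i 1)) h
    rw [Submonoid.coe_one, Matrix.one_mulVec]
    exact this
  · refine LinearMap.ext fun v => ?_
    rw [hact, pow_orderOf_eq_one, act_one_apply]
    rfl

theorem finrank_fixedSpace_add_two_le' [Finite G] (i : {g : G // g ≠ 1}) :
    Module.finrank ℂ (fixedSpace (i : G).1) + 2 ≤ Module.finrank ℂ (Space n) := by
  refine finrank_fixedSpace_add_two_le ?_ fun h => i.2 (Subtype.ext h)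
  exact G.subtype.isOfFinOrder (isOfFinOrder_of_finite (i : G))

theorem dense_isFree [Finite G] : Dense {v | IsFree G v} := by
  simp only [isFree_iff]
  refine dense_forall_notMem_submodule _ fun i h => ?_
  have := finrank_fixedSpace_add_two_le' i
  rw [h, finrank_top] at this
  omega

theorem isOpen_isFree [Finite G] : IsOpen {v | IsFree G v} := by
  simp only [isFree_iff]
  exact isOpen_forall_notMem_submodule _

/-- A point with trivial stabilizer has an open neighbourhood on which the projection to the orbit
space is injective. -/
theorem exists_isOpen_injOn_proj [Finite G] {v : Space n} (hv : IsFree G v) :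
    ∃ O : Set (Space n), IsOpen O ∧ v ∈ O ∧ InjOn (proj G) O ∧ ∀ w ∈ O, IsFree G w := by
  have hclosed : ∀ i : {g : G // g ≠ 1},
      IsOpen {p : Space n × Space n | act (i : G).1 p.1 ≠ p.2} := fun i =>
    isOpen_ne_fun ((act (i : G).1).continuous.comp continuous_fst) continuous_snd
  have hopen : IsOpen (⋂ i : {g : G // g ≠ 1},
      {p : Space n × Space n | act (i : G).1 p.1 ≠ p.2}) := isOpen_iInter_of_finite hclosed
  have hmem : (v, v) ∈ ⋂ i : {g : G // g ≠ 1},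
      {p : Space n × Space n | act (i : G).1 p.1 ≠ p.2} :=
    mem_iInter.mpr fun i hi => i.2 (Subtype.ext (hv _ (i : G).2 hi))
  obtain ⟨O₁, O₂, hO₁, hO₂, hv₁, hv₂, hsub⟩ := isOpen_prod_iff.mp hopen v v hmem
  have hne : ∀ g ∈ G, ∀ x ∈ O₁ ∩ O₂, act g x ∈ O₁ ∩ O₂ → g = 1 := by
    intro g hg x hx hgx
    by_contra hne
    exact mem_iInter.mp (hsub (mk_mem_prod hx.1 hgx.2))
      ⟨⟨g, hg⟩, fun h1 => hne (congrArg Subtype.val h1)⟩ rfl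
  refine ⟨O₁ ∩ O₂, hO₁.inter hO₂, ⟨hv₁, hv₂⟩, fun x hx y hy hxy => ?_, fun w hw g hg hgw => ?_⟩
  · obtain ⟨g, hg, rfl⟩ := proj_eq_iff.mp hxy
    rw [hne g hg x hx hy, act_one_apply]
  · exact hne g hg w hw (by rwa [hgw])

end Action

/-! ### Holomorphic charts -/

section Charts

open Set

variable {n : ℕ} {G : Subgroup (Matrix.symplecticGroup (Fin n) ℂ)}

theorem analyticAt_comp_proj_act {f : OrbitSpace G → ℂ}
    {g : Matrix.symplecticGroup (Fin n) ℂ} (hg : g ∈ G) {v : Space n}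
    (hf : AnalyticAt ℂ (f ∘ proj G) v) : AnalyticAt ℂ (f ∘ proj G) (act g v) := by
  have h : f ∘ proj G = fun w => (f ∘ proj G) (act g⁻¹ w) := by
    ext w
    simp [proj_act (G.inv_mem hg)]
  rw [h]
  refine AnalyticAt.fun_comp (g := f ∘ proj G) ?_
    ((act g⁻¹ : Space n →L[ℂ] Space n).analyticAt _)
  rw [act_inv_act]
  exact hf

/-- Near a point with trivial stabilizer, a local inverse of the projection is a holomorphic chart
of the orbit space. -/
theorem exists_holChart [Finite G] {v : Space n} (hv : IsFree G v) :
    ∃ e : HolChart G, v ∈ e.target ∧ (∀ w, e.toOpenPartialHomeomorph.symm w = proj G w) ∧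
      ∀ w ∈ e.target, IsFree G w := by
  obtain ⟨O, hO, hvO, hinj, hfree⟩ := exists_isOpen_injOn_proj hv
  let e : OpenPartialHomeomorph (Space n) (OrbitSpace G) :=
    OpenPartialHomeomorph.ofContinuousOpen (hinj.toPartialEquiv (proj G) O)
      continuous_proj.continuousOn isOpenMap_proj hO
  have he : ∀ w, e w = proj G w := fun w => rfl
  have hsource : e.source = O := rfl
  have htarget : e.target = proj G '' O := rfl
  refine ⟨⟨e.symm, fun U hU hUs f => ?_⟩, hvO, fun w => rfl, hfree⟩
  change _ ↔ AnalyticOnNhd ℂ (f ∘ proj G) (O ∩ proj G ⁻¹' U)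
  -- A function that is analytic on a sheet over `U` is analytic on the other sheets by invariance.
  refine ⟨fun h => h.mono inter_subset_right, fun h w hw => ?_⟩
  obtain ⟨y, hyO, hyw⟩ := hUs hw
  obtain ⟨g, hg, rfl⟩ := proj_eq_iff.mp hyw
  refine analyticAt_comp_proj_act hg (h y ⟨hyO, ?_⟩)
  rw [mem_preimage, hyw]
  exact hw

theorem HolChart.isHolomorphicOn_coord (e : HolChart G) (i : Fin n ⊕ Fin n) :
    IsHolomorphicOn G (fun x => e.toOpenPartialHomeomorph x i) e.source := by
  refine (e.holomorphic_iff e.source e.open_source subset_rfl _).mpr fun w hw => ?_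
  have h : AnalyticAt ℂ (fun w : Space n => w i) w :=
    (ContinuousLinearMap.proj i : Space n →L[ℂ] ℂ).analyticAt w
  refine h.congr ?_
  filter_upwards [e.open_target.mem_nhds hw.1] with y hy
  exact (congrFun (e.right_inv hy) i).symm

/-- A chart of the orbit space, pulled back to `ℂ²ⁿ`, is analytic. -/
theorem HolChart.analyticOnNhd_comp_proj (e : HolChart G) :
    AnalyticOnNhd ℂ (e.toOpenPartialHomeomorph ∘ proj G) (proj G ⁻¹' e.source) := fun v hv =>
  AnalyticAt.pi fun i => e.isHolomorphicOn_coord i v hv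

/-- A holomorphic map of the orbit space is analytic in charts. -/
theorem HolChart.analyticOnNhd_comp {ψ : OrbitSpace G → OrbitSpace G} {W : Set (OrbitSpace G)}
    (hW : IsOpen W) (hψ : IsHolomorphicMapOn G ψ W) (e e' : HolChart G) :
    AnalyticOnNhd ℂ (e'.toOpenPartialHomeomorph ∘ ψ ∘ e.toOpenPartialHomeomorph.symm)
      (e.target ∩ e.toOpenPartialHomeomorph.symm ⁻¹' (W ∩ ψ ⁻¹' e'.source)) := by
  intro y hy
  refine AnalyticAt.pi fun i => ?_
  have hopen : IsOpen (W ∩ ψ ⁻¹' e'.source) := hψ.1.isOpen_inter_preimage hW e'.open_source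
  have h1 := hψ.2 e'.source _ e'.open_source (e'.isHolomorphicOn_coord i)
  have h2 : IsHolomorphicOn G ((fun x => e'.toOpenPartialHomeomorph x i) ∘ ψ)
      (W ∩ ψ ⁻¹' e'.source ∩ e.source) := h1.mono (preimage_mono inter_subset_left)
  have h3 := (e.holomorphic_iff _ (hopen.inter e.open_source) inter_subset_right _).mp h2
  exact h3 y ⟨hy.1, hy.2, e.map_target hy.1⟩

theorem isHolomorphicMapOn_id : IsHolomorphicMapOn G id univ :=
  ⟨continuousOn_id, fun U f _ hf => by simpa using hf⟩

/-- Transition maps between charts are analytic. -/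
theorem HolChart.analyticOnNhd_transition (e e' : HolChart G) :
    AnalyticOnNhd ℂ (e'.toOpenPartialHomeomorph ∘ e.toOpenPartialHomeomorph.symm)
      (e.target ∩ e.toOpenPartialHomeomorph.symm ⁻¹' e'.source) := by
  simpa using HolChart.analyticOnNhd_comp isOpen_univ isHolomorphicMapOn_id e e'

end Charts

/-! ### Descent of equivariant maps -/

section Descent

open Set

variable {n : ℕ} {G : Subgroup (Matrix.symplecticGroup (Fin n) ℂ)}

variable (G) in
/-- The map of orbit spaces induced by an equivariant map. It is defined by choosing
representatives, and is meaningful on the image of a set on which the map is equivariant; see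
`IsEquivariantOn.descend_proj`. -/
noncomputable def descend (F : Space n → Space n) (x : OrbitSpace G) : OrbitSpace G :=
  proj G (F x.out)

/-- The set `W` is invariant under `G` and the map `F` is equivariant on it. -/
structure IsEquivariantOn (G : Subgroup (Matrix.symplecticGroup (Fin n) ℂ))
    (F : Space n → Space n) (W : Set (Space n)) : Prop where
  invariant : ∀ g ∈ G, ∀ v ∈ W, act g v ∈ W
  equivariant : ∀ g ∈ G, ∀ v ∈ W, F (act g v) = act g (F v)

variable {F : Space n → Space n} {W : Set (Space n)}

theorem IsEquivariantOn.descend_proj (h : IsEquivariantOn G F W) {v : Space n} (hv : v ∈ W) :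
    descend G F (proj G v) = proj G (F v) := by
  have hout : proj G (proj G v).out = proj G v := Quotient.out_eq _
  obtain ⟨g, hg, hgv⟩ := proj_eq_iff.mp hout.symm
  rw [descend, ← hgv, h.equivariant g hg v hv, proj_act hg]

theorem IsEquivariantOn.proj_mem_image_iff (h : IsEquivariantOn G F W) {v : Space n} :
    proj G v ∈ proj G '' W ↔ v ∈ W := by
  refine ⟨?_, mem_image_of_mem _⟩
  rintro ⟨w, hw, hwv⟩
  obtain ⟨g, hg, rfl⟩ := proj_eq_iff.mp hwv
  exact h.invariant g hg w hw

theorem IsEquivariantOn.isHolomorphicMapOn_descend (h : IsEquivariantOn G F W) (hW : IsOpen W)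
    (hF : AnalyticOnNhd ℂ F W) : IsHolomorphicMapOn G (descend G F) (proj G '' W) := by
  have heq : ∀ v ∈ W, descend G F ∘ proj G =ᶠ[𝓝 v] proj G ∘ F := fun v hv => by
    filter_upwards [hW.mem_nhds hv] with w hw
    exact h.descend_proj hw
  constructor
  · rintro _ ⟨v, hv, rfl⟩
    refine ContinuousAt.continuousWithinAt ?_
    rw [ContinuousAt, ← map_proj_nhds, Filter.tendsto_map'_iff, h.descend_proj hv]
    refine Filter.Tendsto.congr' (heq v hv).symm ?_
    exact continuous_proj.continuousAt.tendsto.comp (hF v hv).continuousAt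
  · intro U f hU hf v hv
    have hvW : v ∈ W := h.proj_mem_image_iff.mp hv.1
    have hvU : F v ∈ proj G ⁻¹' U := by
      have := hv.2
      rwa [mem_preimage, h.descend_proj hvW] at this
    have h1 : AnalyticAt ℂ (fun v => (f ∘ proj G) (F v)) v :=
      AnalyticAt.fun_comp (hf _ hvU) (hF v hvW)
    refine h1.congr ?_
    filter_upwards [heq v hvW] with w hw
    exact congrArg f hw.symm

/-- An equivariant biholomorphic map between invariant neighbourhoods of `0` descends to an
automorphism of the germ of the orbit space at its origin. -/
theorem exists_germAut (E : OpenPartialHomeomorph (Space n) (Space n))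
    (hE : IsEquivariantOn G E E.source) (h0 : (0 : Space n) ∈ E.source) (hE0 : E 0 = 0)
    (hana : AnalyticOnNhd ℂ E E.source) (hana' : AnalyticOnNhd ℂ E.symm E.target) :
    ∃ φ : GermAut G, φ.source = proj G '' E.source ∧ φ.target = proj G '' E.target ∧
      ∀ v ∈ E.source, φ.toOpenPartialHomeomorph (proj G v) = proj G (E v) := by
  have hE' : IsEquivariantOn G E.symm E.target := by
    constructor
    · intro g hg w hw
      rw [← E.right_inv hw, ← hE.equivariant g hg _ (E.map_target hw)]
      exact E.map_source (hE.invariant g hg _ (E.map_target hw))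
    · intro g hg w hw
      have h1 := hE.equivariant g hg _ (E.map_target hw)
      rw [E.right_inv hw] at h1
      rw [← h1, E.left_inv (hE.invariant g hg _ (E.map_target hw))]
  have hhol := hE.isHolomorphicMapOn_descend E.open_source hana
  have hhol' := hE'.isHolomorphicMapOn_descend E.open_target hana'
  let e : OpenPartialHomeomorph (OrbitSpace G) (OrbitSpace G) :=
    { toFun := descend G E
      invFun := descend G E.symm
      source := proj G '' E.source
      target := proj G '' E.target
      map_source' := by
        rintro _ ⟨v, hv, rfl⟩
        rw [hE.descend_proj hv]
        exact mem_image_of_mem _ (E.map_source hv)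
      map_target' := by
        rintro _ ⟨v, hv, rfl⟩
        rw [hE'.descend_proj hv]
        exact mem_image_of_mem _ (E.map_target hv)
      left_inv' := by
        rintro _ ⟨v, hv, rfl⟩
        rw [hE.descend_proj hv, hE'.descend_proj (E.map_source hv), E.left_inv hv]
      right_inv' := by
        rintro _ ⟨v, hv, rfl⟩
        rw [hE'.descend_proj hv, hE.descend_proj (E.map_target hv), E.right_inv hv]
      open_source := isOpenMap_proj _ E.open_source
      open_target := isOpenMap_proj _ E.open_target
      continuousOn_toFun := hhol.1
      continuousOn_invFun := hhol'.1 }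
  refine ⟨⟨e, mem_image_of_mem _ h0, ?_, hhol, hhol'⟩, rfl, rfl, fun v hv => hE.descend_proj hv⟩
  change descend G E (proj G 0) = proj G 0
  rw [hE.descend_proj h0, hE0]

end Descent

/-! ### Alternating forms as bilinear forms -/

section Bilinear

variable {V : Type*} [NormedAddCommGroup V] [NormedSpace ℂ V]

variable (V) in
/-- An alternating 2-form, regarded as a bilinear form. -/
noncomputable def toBilin : (V [⋀^Fin 2]→L[ℂ] ℂ) →L[ℂ] V →L[ℂ] V →L[ℂ] ℂ :=
  (ContinuousLinearMap.compL ℂ V (V [⋀^Fin 1]→L[ℂ] ℂ) (V →L[ℂ] ℂ)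
    ((ContinuousAlternatingMap.ofSubsingletonLIE (𝕜 := ℂ) (E := V) (F := ℂ)
      (0 : Fin 1)).symm.toContinuousLinearEquiv : (V [⋀^Fin 1]→L[ℂ] ℂ) →L[ℂ] (V →L[ℂ] ℂ))).comp
    (ContinuousAlternatingMap.curryLeftLI (𝕜 := ℂ) (E := V) (F := ℂ)
      (n := 1)).toContinuousLinearMap

theorem toBilin_apply (η : V [⋀^Fin 2]→L[ℂ] ℂ) (a b : V) : toBilin V η a b = η ![a, b] := by
  have h : toBilin V η a b = η (Matrix.vecCons a fun _ => b) := rfl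
  rw [h]
  congr 1
  ext i
  fin_cases i <;> rfl

theorem ext_of_toBilin {η η' : V [⋀^Fin 2]→L[ℂ] ℂ} (h : ∀ a b, toBilin V η a b = toBilin V η' a b) :
    η = η' := by
  ext v
  have h1 := h (v 0) (v 1)
  rw [toBilin_apply, toBilin_apply] at h1
  have h2 : ![v 0, v 1] = v := by
    ext i
    fin_cases i <;> rfl
  rwa [h2] at h1

theorem toBilin_skew (η : V [⋀^Fin 2]→L[ℂ] ℂ) (a b : V) : toBilin V η a b = -toBilin V η b a := by
  rw [toBilin_apply, toBilin_apply]
  have h := η.map_swap ![b, a] (i := 0) (j := 1) (by simp)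
  refine Eq.trans ?_ h
  change η ![a, b] = η _
  congr 1
  ext i
  fin_cases i <;> rfl

theorem toBilin_compContinuousLinearMap {W : Type*} [NormedAddCommGroup W] [NormedSpace ℂ W]
    (η : V [⋀^Fin 2]→L[ℂ] ℂ) (L : W →L[ℂ] V) (a b : W) :
    toBilin W (η.compContinuousLinearMap L) a b = toBilin V η (L a) (L b) := by
  rw [toBilin_apply, toBilin_apply, ContinuousAlternatingMap.compContinuousLinearMap_apply]
  congr 1
  ext i
  fin_cases i <;> rfl

/-- A form with vanishing exterior derivative is closed in terms of bilinear forms. -/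
theorem fderiv_toBilin_cyclic {η : V → V [⋀^Fin 2]→L[ℂ] ℂ} {x : V} (hη : DifferentiableAt ℂ η x)
    (h : extDeriv η x = 0) (a b c : V) :
    fderiv ℂ (fun y => toBilin V (η y)) x a b c + fderiv ℂ (fun y => toBilin V (η y)) x b c a +
      fderiv ℂ (fun y => toBilin V (η y)) x c a b = 0 := by
  have hd : fderiv ℂ (fun y => toBilin V (η y)) x = (toBilin V).comp (fderiv ℂ η x) :=
    ((toBilin V).hasFDerivAt (x := η x) |>.comp x hη.hasFDerivAt).fderiv
  have h0 : extDeriv η x ![a, b, c] = 0 := by rw [h]; rfl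
  rw [extDeriv, ContinuousAlternatingMap.alternatizeUncurryFin_apply] at h0
  have h1 := (Fin.sum_univ_three _).symm.trans h0
  have e0 : (0 : Fin 3).removeNth ![a, b, c] = ![b, c] := by ext i; fin_cases i <;> rfl
  have e1 : (1 : Fin 3).removeNth ![a, b, c] = ![a, c] := by ext i; fin_cases i <;> rfl
  have e2 : (2 : Fin 3).removeNth ![a, b, c] = ![a, b] := by ext i; fin_cases i <;> rfl
  rw [e0, e1, e2, ← toBilin_apply, ← toBilin_apply, ← toBilin_apply] at h1
  rw [hd]
  change toBilin V (fderiv ℂ η x a) b c + toBilin V (fderiv ℂ η x b) c a +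
    toBilin V (fderiv ℂ η x c) a b = 0
  rw [toBilin_skew (fderiv ℂ η x b) c a]
  simp at h1
  linear_combination h1

end Bilinear

/-! ### The pull-back of a form on the orbit space -/

section Pull

open Set Filter

variable {n : ℕ} {G : Subgroup (Matrix.symplecticGroup (Fin n) ℂ)}
  {U : Set (OrbitSpace G)}

/-- The pull-back of a 2-form to `ℂ²ⁿ`, computed with the chart `e` of the orbit space. -/
noncomputable def TwoForm.pullChart (ω : TwoForm G U) (e : HolChart G) (v : Space n) :
    Space n →L[ℂ] Space n →L[ℂ] ℂ :=
  toBilin (Space n) ((ω.form e (e.toOpenPartialHomeomorph (proj G v))).compContinuousLinearMap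
    (fderiv ℂ (e.toOpenPartialHomeomorph ∘ proj G) v))

theorem TwoForm.pullChart_apply (ω : TwoForm G U) (e : HolChart G) (v a b : Space n) :
    ω.pullChart e v a b = toBilin (Space n) (ω.form e (e.toOpenPartialHomeomorph (proj G v)))
      (fderiv ℂ (e.toOpenPartialHomeomorph ∘ proj G) v a)
      (fderiv ℂ (e.toOpenPartialHomeomorph ∘ proj G) v b) :=
  toBilin_compContinuousLinearMap _ _ _ _

/-- The pull-back does not depend on the chart. -/
theorem TwoForm.pullChart_eq (ω : TwoForm G U) {e e' : HolChart G} {v : Space n}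
    (hU : proj G v ∈ U) (he : proj G v ∈ e.source) (he' : proj G v ∈ e'.source) :
    ω.pullChart e v = ω.pullChart e' v := by
  have hchain : fderiv ℂ (e'.toOpenPartialHomeomorph ∘ proj G) v =
      (fderiv ℂ (e'.toOpenPartialHomeomorph ∘ e.toOpenPartialHomeomorph.symm)
        (e.toOpenPartialHomeomorph (proj G v))).comp
        (fderiv ℂ (e.toOpenPartialHomeomorph ∘ proj G) v) := by
    have h1 : e'.toOpenPartialHomeomorph ∘ proj G =ᶠ[𝓝 v]
        (e'.toOpenPartialHomeomorph ∘ e.toOpenPartialHomeomorph.symm) ∘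
          (e.toOpenPartialHomeomorph ∘ proj G) := by
      filter_upwards [continuous_proj.continuousAt.eventually (e.open_source.mem_nhds he)]
        with w hw
      simp [e.left_inv hw]
    rw [h1.fderiv_eq]
    refine fderiv_comp v ?_ (e.analyticOnNhd_comp_proj v he).differentiableAt
    refine (e.analyticOnNhd_transition e' _ ⟨e.map_source he, ?_⟩).differentiableAt
    rw [mem_preimage, e.left_inv he]
    exact he'
  ext a b
  rw [ω.pullChart_apply, ω.pullChart_apply, ω.compatible e e' _ hU he he', hchain,
    toBilin_compContinuousLinearMap]
  rfl

/-- The pull-back is invariant under `G`, because the projection is. -/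
theorem TwoForm.pullChart_act (ω : TwoForm G U) {e : HolChart G}
    {g : Matrix.symplecticGroup (Fin n) ℂ} (hg : g ∈ G) {v : Space n}
    (he : proj G v ∈ e.source) (a b : Space n) :
    ω.pullChart e (act g v) (act g a) (act g b) = ω.pullChart e v a b := by
  have hchain : fderiv ℂ (e.toOpenPartialHomeomorph ∘ proj G) v =
      (fderiv ℂ (e.toOpenPartialHomeomorph ∘ proj G) (act g v)).comp
        (act g : Space n →L[ℂ] Space n) := by
    have h1 : e.toOpenPartialHomeomorph ∘ proj G =
        (e.toOpenPartialHomeomorph ∘ proj G) ∘ (act g : Space n →L[ℂ] Space n) := by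
      ext1 w
      simp [proj_act hg]
    have hd : DifferentiableAt ℂ (e.toOpenPartialHomeomorph ∘ proj G) (act g v) := by
      refine (e.analyticOnNhd_comp_proj _ ?_).differentiableAt
      rw [mem_preimage, proj_act hg]
      exact he
    conv_lhs => rw [h1]
    exact (HasFDerivAt.comp v hd.hasFDerivAt (act g : Space n →L[ℂ] Space n).hasFDerivAt).fderiv
  rw [ω.pullChart_apply, ω.pullChart_apply, hchain, proj_act hg]
  rfl

/-- In a chart that is a local inverse of the projection, the pull-back is the local form. -/
theorem TwoForm.pullChart_eventuallyEq (ω : TwoForm G U) {e : HolChart G}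
    (hsymm : ∀ w, e.toOpenPartialHomeomorph.symm w = proj G w) {v : Space n} (hv : v ∈ e.target) :
    ω.pullChart e =ᶠ[𝓝 v] fun w => toBilin (Space n) (ω.form e w) := by
  have hid : ∀ w ∈ e.target, e.toOpenPartialHomeomorph (proj G w) = w := fun w hw => by
    rw [← hsymm, e.right_inv hw]
  filter_upwards [e.open_target.mem_nhds hv] with w hw
  have h1 : e.toOpenPartialHomeomorph ∘ proj G =ᶠ[𝓝 w] id := by
    filter_upwards [e.open_target.mem_nhds hw] with y hy using hid y hy
  ext a b
  rw [ω.pullChart_apply, h1.fderiv_eq, hid w hw, fderiv_id]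
  rfl

open Classical in
/-- The pull-back of a 2-form to the part of `ℂ²ⁿ` over the regular locus; it does not depend on
the chart, by `TwoForm.pull_eq`. Elsewhere its value is `0`. -/
noncomputable def TwoForm.pull (ω : TwoForm G U) (v : Space n) : Space n →L[ℂ] Space n →L[ℂ] ℂ :=
  if h : ∃ e : HolChart G, proj G v ∈ e.source then ω.pullChart h.choose v else 0

theorem TwoForm.pull_eq (ω : TwoForm G U) {e : HolChart G} {v : Space n}
    (hU : proj G v ∈ U) (he : proj G v ∈ e.source) : ω.pull v = ω.pullChart e v := by
  have h : ∃ e : HolChart G, proj G v ∈ e.source := ⟨e, he⟩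
  rw [TwoForm.pull, dif_pos h]
  exact ω.pullChart_eq hU h.choose_spec he

/-- Near a point with trivial stabilizer, the pull-back of a symplectic form is an analytic, closed
and nondegenerate form. -/
theorem TwoForm.IsSymplectic.pull_of_isFree [Finite G] {ω : TwoForm G U} (hω : ω.IsSymplectic)
    (hUo : IsOpen U) {v : Space n} (hU : proj G v ∈ U) (hv : IsFree G v) :
    AnalyticAt ℂ ω.pull v ∧ (∀ a b, ω.pull v a b = -ω.pull v b a) ∧
      (∀ a b c, fderiv ℂ ω.pull v a b c + fderiv ℂ ω.pull v b c a + fderiv ℂ ω.pull v c a b = 0) ∧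
      (∀ a, (∀ b, ω.pull v a b = 0) → a = 0) ∧
      ∀ g ∈ G, ∀ a b, ω.pull (act g v) (act g a) (act g b) = ω.pull v a b := by
  obtain ⟨e, hve, hsymm, -⟩ := exists_holChart hv
  have hπ : ∀ w ∈ e.target, proj G w ∈ e.source := fun w hw => by
    rw [← hsymm]
    exact e.map_target hw
  have hev : e.toOpenPartialHomeomorph (proj G v) = v := by rw [← hsymm, e.right_inv hve]
  have hpull : ω.pull =ᶠ[𝓝 v] fun w => toBilin (Space n) (ω.form e w) := by
    filter_upwards [ω.pullChart_eventuallyEq hsymm hve, e.open_target.mem_nhds hve,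
      continuous_proj.continuousAt.eventually (hUo.mem_nhds hU)] with w h1 h2 h3
    rw [← h1, ω.pull_eq h3 (hπ w h2)]
  have hform : AnalyticAt ℂ (ω.form e) v := by
    refine ω.holomorphic e v ⟨hve, ?_⟩
    rw [mem_preimage, hsymm]
    exact hU
  refine ⟨?_, fun a b => ?_, fun a b c => ?_, fun a ha => ?_, fun g hg a b => ?_⟩
  · exact AnalyticAt.congr (((toBilin (Space n)).analyticAt _).fun_comp hform) hpull.symm
  · rw [hpull.eq_of_nhds]
    exact toBilin_skew _ a b
  · rw [hpull.fderiv_eq]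
    refine fderiv_toBilin_cyclic hform.differentiableAt ?_ a b c
    have := hω.closed e _ hU (hπ v hve)
    rwa [hev] at this
  · refine hω.nondegenerate e _ hU (hπ v hve) a fun b => ?_
    rw [hev, ← toBilin_apply]
    have := ha b
    rwa [hpull.eq_of_nhds] at this
  · have hgv := proj_act hg v
    rw [ω.pull_eq hU (hπ v hve), ω.pull_eq (hgv.symm ▸ hU) (hgv.symm ▸ hπ v hve)]
    exact ω.pullChart_act hg (hπ v hve) a b

/-- Two maps that are continuous near `0` and agree at the points with trivial stabilizer agree
near `0`. -/
theorem eventuallyEq_of_isFree [Finite G] {F : Type*} [TopologicalSpace F] [T2Space F]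
    {f g : Space n → F} (hf : ∀ᶠ x in 𝓝 0, ContinuousAt f x) (hg : ∀ᶠ x in 𝓝 0, ContinuousAt g x)
    (h : ∀ᶠ x in 𝓝 0, IsFree G x → f x = g x) : f =ᶠ[𝓝 0] g := by
  filter_upwards [hf, hg, h.eventually_nhds] with x hfx hgx hx
  have hfreq : ∃ᶠ y in 𝓝 x, f y = g y :=
    ((mem_closure_iff_frequently.mp (dense_isFree (G := G) x)).and_eventually hx).mono
      fun y hy => hy.2 hy.1
  exact tendsto_nhds_unique_of_frequently_eq hfx hgx hfreq

/-- A symplectic form on the germ of the orbit space at its origin extends, after pulling it back,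
to an invariant symplectic form on a neighbourhood of `0` in `ℂ²ⁿ`. -/
theorem TwoForm.IsSymplectic.exists_extension [Finite G] {ω : TwoForm G U} (hω : ω.IsSymplectic)
    (hUo : IsOpen U) (h0 : origin G ∈ U) :
    ∃ B : Space n → Space n →L[ℂ] Space n →L[ℂ] ℂ, AnalyticAt ℂ B 0 ∧
      (∀ᶠ x in 𝓝 0, ∀ a b, B x a b = -B x b a) ∧
      (∀ᶠ x in 𝓝 0, ∀ a b c,
        fderiv ℂ B x a b c + fderiv ℂ B x b c a + fderiv ℂ B x c a b = 0) ∧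
      (∀ x, (∀ y, B 0 x y = 0) → x = 0) ∧
      (∀ g : G, ∀ᶠ x in 𝓝 0, ∀ a b, B (act g x) (act g a) (act g b) = B x a b) ∧
      ∀ᶠ x in 𝓝 0, IsFree G x → B x = ω.pull x := by
  have hUo' : IsOpen (proj G ⁻¹' U) := hUo.preimage continuous_proj
  have hU0 : ∀ᶠ x in 𝓝 (0 : Space n), proj G x ∈ U := hUo'.mem_nhds h0
  have hana : AnalyticOnNhd ℂ ω.pull
      (proj G ⁻¹' U ∩ {x | ∀ i : {g : G // g ≠ 1}, x ∉ fixedSpace (i : G).1}) := fun x hx =>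
    (hω.pull_of_isFree hUo hx.1 (isFree_iff.mpr hx.2)).1
  obtain ⟨B, hB, hBpull⟩ := exists_analyticAt_extension
    (fun i : {g : G // g ≠ 1} => fixedSpace (i : G).1) finrank_fixedSpace_add_two_le' hUo' h0 hana
  simp only [← isFree_iff] at hBpull
  -- The extended form is nondegenerate because the inverse of the form extends as well.
  have hana' : AnalyticOnNhd ℂ (fun x => (ω.pull x).inverse)
      (proj G ⁻¹' U ∩ {x | ∀ i : {g : G // g ≠ 1}, x ∉ fixedSpace (i : G).1}) := fun x hx => by
    obtain ⟨h1, -, -, h2, -⟩ := hω.pull_of_isFree hUo hx.1 (isFree_iff.mpr hx.2)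
    have h3 : ContDiffAt ℂ ⊤ (fun x => (ω.pull x).inverse) x :=
      ContDiffAt.comp (g := ContinuousLinearMap.inverse) x
        (isInvertible_of_nondegenerate h2).contDiffAt_map_inverse h1.contDiffAt
    exact h3.analyticAt
  obtain ⟨C, hC, hCpull⟩ := exists_analyticAt_extension
    (fun i : {g : G // g ≠ 1} => fixedSpace (i : G).1) finrank_fixedSpace_add_two_le' hUo' h0 hana'
  simp only [← isFree_iff] at hCpull
  have hBan := hB.eventually_analyticAt
  have hBc : ∀ᶠ x in 𝓝 0, ContinuousAt B x := hBan.mono fun x hx => hx.continuousAt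
  have hBfc : ∀ᶠ x in 𝓝 0, ContinuousAt (fderiv ℂ B) x :=
    hBan.mono fun x hx => hx.fderiv.continuousAt
  have hactt : ∀ g : Matrix.symplecticGroup (Fin n) ℂ, Tendsto (act g) (𝓝 0) (𝓝 0) := fun g =>
    (act g).continuous.tendsto' 0 0 (map_zero _)
  refine ⟨B, hB, ?_, ?_, fun x hx => ?_, fun g => ?_, hBpull⟩
  · have h1 : (fun x => B x) =ᶠ[𝓝 0] fun x => -(B x).flip := by
      refine eventuallyEq_of_isFree (G := G) hBc (hBc.mono fun x hx => ?_) ?_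
      · exact ((ContinuousLinearMap.flipₗᵢ ℂ (Space n) (Space n) ℂ).continuous.continuousAt.comp
          hx).neg
      · filter_upwards [hBpull, hU0] with x h1 h2 hx
        ext1 a
        ext1 b
        rw [h1 hx]
        exact (hω.pull_of_isFree hUo h2 hx).2.1 a b
    filter_upwards [h1] with x hx a b
    exact congrArg (fun β : Space n →L[ℂ] Space n →L[ℂ] ℂ => β a b) hx
  · have h1 : (fun x (a b c : Space n) =>
        fderiv ℂ B x a b c + fderiv ℂ B x b c a + fderiv ℂ B x c a b) =ᶠ[𝓝 0] fun _ => 0 := by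
      refine eventuallyEq_of_isFree (G := G) (hBfc.mono fun x hx => ?_)
        (Eventually.of_forall fun x => continuousAt_const) ?_
      · refine continuousAt_pi.mpr fun a => continuousAt_pi.mpr fun b => continuousAt_pi.mpr
          fun c => ?_
        have h : ∀ a b c, ContinuousAt (fun x => fderiv ℂ B x a b c) x := fun a b c =>
          ((hx.clm_apply continuousAt_const).clm_apply continuousAt_const).clm_apply
            continuousAt_const
        exact ((h a b c).add (h b c a)).add (h c a b)
      · filter_upwards [hBpull.eventually_nhds, hU0] with x h1 h2 hx
        have h3 : B =ᶠ[𝓝 x] ω.pull := by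
          filter_upwards [h1, isOpen_isFree.mem_nhds hx] with y hy hyf using hy hyf
        rw [h3.fderiv_eq]
        funext a b c
        exact (hω.pull_of_isFree hUo h2 hx).2.2.1 a b c
    filter_upwards [h1] with x hx a b c
    exact congrFun (congrFun (congrFun hx a) b) c
  · have h1 : (fun x => (C x).comp (B x)) =ᶠ[𝓝 0] fun _ => ContinuousLinearMap.id ℂ (Space n) := by
      refine eventuallyEq_of_isFree (G := G) ?_
        (Eventually.of_forall fun x => continuousAt_const) ?_
      · filter_upwards [hBc, hC.eventually_analyticAt] with x hx hx'
        exact hx'.continuousAt.clm_comp hx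
      · filter_upwards [hBpull, hCpull, hU0] with x h1 h2 h3 hx
        rw [h1 hx, h2 hx]
        exact (isInvertible_of_nondegenerate
          (hω.pull_of_isFree hUo h3 hx).2.2.2.1).inverse_comp_self
    have h2 := congrArg (fun T : Space n →L[ℂ] Space n => T x) h1.eq_of_nhds
    have h3 : B 0 x = 0 := ContinuousLinearMap.ext hx
    have h4 : C 0 (B 0 x) = x := h2
    rw [← h4, h3, map_zero]
  · have h1 : (fun x (a b : Space n) => B (act g x) (act g a) (act g b)) =ᶠ[𝓝 0]
        fun x a b => B x a b := by
      refine eventuallyEq_of_isFree (G := G) ?_ (hBc.mono fun x hx => ?_) ?_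
      · filter_upwards [(hactt g).eventually hBc] with x hx
        refine continuousAt_pi.mpr fun a => continuousAt_pi.mpr fun b => ?_
        have h2 : ContinuousAt (fun x => B (act g x)) x :=
          ContinuousAt.comp (g := B) hx (act (g : Matrix.symplecticGroup (Fin n) ℂ)).continuousAt
        exact (h2.clm_apply continuousAt_const).clm_apply continuousAt_const
      · refine continuousAt_pi.mpr fun a => continuousAt_pi.mpr fun b => ?_
        exact (hx.clm_apply continuousAt_const).clm_apply continuousAt_const
      · filter_upwards [hBpull, (hactt g).eventually hBpull, hU0] with x h1 h2 h3 hx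
        funext a b
        rw [h1 hx, h2 (hx.act g.2)]
        exact (hω.pull_of_isFree hUo h3 hx).2.2.2.2 g g.2 a b
    filter_upwards [h1] with x hx a b
    exact congrFun (congrFun hx a) b

end Pull

/-! ### Equivalence of invariant symplectic forms -/

section Equivalence

open Set Filter

variable {V : Type*} [NormedAddCommGroup V] [NormedSpace ℂ V] [FiniteDimensional ℂ V]

/-- Analytic inverse function theorem, for maps with injective derivative. -/
theorem exists_openPartialHomeomorph {φ : V → V} (hφ : AnalyticAt ℂ φ 0)
    (hinj : Function.Injective (fderiv ℂ φ 0)) :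
    ∃ E : OpenPartialHomeomorph V V, (0 : V) ∈ E.source ∧ (∀ x, E x = φ x) ∧
      AnalyticAt ℂ E.symm (φ 0) := by
  have : CompleteSpace V := FiniteDimensional.complete ℂ V
  let D : V ≃L[ℂ] V :=
    (LinearEquiv.ofInjectiveEndo (fderiv ℂ φ 0 : V →ₗ[ℂ] V) hinj).toContinuousLinearEquiv
  have hD : (D : V →L[ℂ] V) = fderiv ℂ φ 0 := rfl
  have hstrict : HasStrictFDerivAt φ (D : V →L[ℂ] V) 0 := by
    rw [hD]
    exact hφ.hasStrictFDerivAt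
  have h0 : (0 : V) ∈ (hstrict.toOpenPartialHomeomorph φ).source :=
    hstrict.mem_toOpenPartialHomeomorph_source
  exact ⟨hstrict.toOpenPartialHomeomorph φ, h0, fun _ => rfl,
    OpenPartialHomeomorph.analyticAt_symm' _ h0 hφ hD.symm⟩

omit [FiniteDimensional ℂ V] in
theorem injective_of_pullback {b b' : V →L[ℂ] V →L[ℂ] ℂ} {D : V →L[ℂ] V}
    (hnd : ∀ x, (∀ y, b x y = 0) → x = 0) (h : ∀ x y, b' (D x) (D y) = b x y) :
    Function.Injective D := by
  rw [injective_iff_map_eq_zero]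
  intro x hx
  refine hnd x fun y => ?_
  rw [← h, hx, map_zero]
  rfl

/-- Two holomorphic symplectic forms near the origin of a vector space that are invariant under
finitely many linear maps are equivalent by a map commuting with these. -/
theorem exists_equivariant_equivalence {ι : Type*} [Finite ι] (L : ι → V ≃L[ℂ] V)
    {B B' : V → V →L[ℂ] V →L[ℂ] ℂ}
    (hB : AnalyticAt ℂ B 0) (hskew : ∀ᶠ x in 𝓝 (0 : V), ∀ a b, B x a b = -B x b a)
    (hclosed : ∀ᶠ x in 𝓝 (0 : V), ∀ a b c,
      fderiv ℂ B x a b c + fderiv ℂ B x b c a + fderiv ℂ B x c a b = 0)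
    (hnd : ∀ x, (∀ y, B 0 x y = 0) → x = 0)
    (hL : ∀ i, ∀ᶠ x in 𝓝 0, ∀ a b, B (L i x) (L i a) (L i b) = B x a b)
    (hB' : AnalyticAt ℂ B' 0) (hskew' : ∀ᶠ x in 𝓝 (0 : V), ∀ a b, B' x a b = -B' x b a)
    (hclosed' : ∀ᶠ x in 𝓝 (0 : V), ∀ a b c,
      fderiv ℂ B' x a b c + fderiv ℂ B' x b c a + fderiv ℂ B' x c a b = 0)
    (hnd' : ∀ x, (∀ y, B' 0 x y = 0) → x = 0)
    (hL' : ∀ i, ∀ᶠ x in 𝓝 0, ∀ a b, B' (L i x) (L i a) (L i b) = B' x a b) :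
    ∃ Φ : V → V, AnalyticAt ℂ Φ 0 ∧ Φ 0 = 0 ∧
      (∀ᶠ x in 𝓝 0, ∀ a b, B' (Φ x) (fderiv ℂ Φ x a) (fderiv ℂ Φ x b) = B x a b) ∧
      ∀ i, ∀ᶠ x in 𝓝 0, Φ (L i x) = L i (Φ x) := by
  obtain ⟨φ, hφ, hφ0, hφB, hφL⟩ := exists_equivariant_darboux L hB hskew hclosed hnd hL
  obtain ⟨χ, hχ, hχ0, hχB, hχL⟩ := exists_equivariant_darboux L hB' hskew' hclosed' hnd' hL'
  obtain ⟨S, hSB, hSL⟩ := exists_commuting_isometry hskew.self_of_nhds hskew'.self_of_nhds hnd hnd'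
  have hinj : Function.Injective (fderiv ℂ φ 0) :=
    injective_of_pullback hnd hφB.self_of_nhds
  obtain ⟨E, h0E, hEφ, hE⟩ := exists_openPartialHomeomorph hφ hinj
  rw [hφ0] at hE
  have hE0 : E.symm 0 = 0 := by
    have := E.left_inv h0E
    rwa [hEφ, hφ0] at this
  have htarget : E.target ∈ 𝓝 (0 : V) := by
    refine E.open_target.mem_nhds ?_
    have := E.map_source h0E
    rwa [hEφ, hφ0] at this
  have hEt : Tendsto E.symm (𝓝 0) (𝓝 0) := by
    have := hE.continuousAt.tendsto
    rwa [hE0] at this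
  have hSEt : Tendsto (fun x => S (E.symm x)) (𝓝 0) (𝓝 0) := by
    have := (S.continuous.tendsto 0).comp hEt
    rwa [map_zero] at this
  have hLt : ∀ i, Tendsto (L i) (𝓝 0) (𝓝 0) := fun i =>
    (L i).continuous.tendsto' 0 0 (map_zero _)
  refine ⟨fun x => χ (S (E.symm x)), ?_, ?_, ?_, fun i => ?_⟩
  · have h1 : AnalyticAt ℂ (fun x => S (E.symm x)) 0 :=
      ((S : V →L[ℂ] V).analyticAt _).fun_comp hE
    refine AnalyticAt.fun_comp (g := χ) ?_ h1
    rw [hE0, map_zero]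
    exact hχ
  · simp only [hE0, map_zero, hχ0]
  · filter_upwards [hEt.eventually hφB, hEt.eventually hφ.eventually_analyticAt,
      hE.eventually_analyticAt, htarget, hSEt.eventually hχB,
      hSEt.eventually hχ.eventually_analyticAt, eventually_eventually_nhds.mpr htarget]
      with x h1 h2 h3 h4 h5 h6 h7 a b
    have hd : HasFDerivAt (fun x => χ (S (E.symm x)))
        ((fderiv ℂ χ (S (E.symm x))).comp ((S : V →L[ℂ] V).comp (fderiv ℂ E.symm x))) x :=
      h6.differentiableAt.hasFDerivAt.comp x
        ((S : V →L[ℂ] V).hasFDerivAt.comp x h3.differentiableAt.hasFDerivAt)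
    have hid : ∀ c, fderiv ℂ φ (E.symm x) (fderiv ℂ E.symm x c) = c := fun c => by
      have h8 : HasFDerivAt (fun x => φ (E.symm x))
          ((fderiv ℂ φ (E.symm x)).comp (fderiv ℂ E.symm x)) x :=
        h2.differentiableAt.hasFDerivAt.comp x h3.differentiableAt.hasFDerivAt
      have h9 : (fun x => φ (E.symm x)) =ᶠ[𝓝 x] id := by
        filter_upwards [h7] with y hy
        rw [← hEφ, E.right_inv hy]
        rfl
      have h10 := (h8.congr_of_eventuallyEq h9.symm).unique (hasFDerivAt_id x)
      exact congrArg (fun T : V →L[ℂ] V => T c) h10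
    rw [hd.fderiv]
    refine (h5 _ _).trans ((hSB _ _).trans ?_)
    refine (h1 _ _).symm.trans ?_
    change B (φ (E.symm x)) (fderiv ℂ φ (E.symm x) (fderiv ℂ E.symm x a))
      (fderiv ℂ φ (E.symm x) (fderiv ℂ E.symm x b)) = B x a b
    rw [hid, hid, ← hEφ, E.right_inv h4]
  · have hLinv : ∀ a b, B 0 (L i a) (L i b) = B 0 a b := by
      simpa using (hL i).self_of_nhds
    have hLinv' : ∀ a b, B' 0 (L i a) (L i b) = B' 0 a b := by
      simpa using (hL' i).self_of_nhds
    filter_upwards [hSEt.eventually (hχL i), hEt.eventually (hφL i), htarget,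
      ((hLt i).comp hEt).eventually (E.open_source.mem_nhds h0E)] with x h1 h2 h3 h4
    have h5 : E.symm (L i x) = L i (E.symm x) := by
      have h6 := E.left_inv h4
      rwa [Function.comp_apply, hEφ, h2, ← hEφ, E.right_inv h3] at h6
    simp only [h5]
    rw [ hSL _ hLinv hLinv', h1]

end Equivalence

/-! ### Comparison of forms on the orbit space -/

section Comparison

open Set Filter

variable {n : ℕ} {G : Subgroup (Matrix.symplecticGroup (Fin n) ℂ)} {U U' : Set (OrbitSpace G)}

/-- The equality of two forms, one of them pulled back, can be checked upstairs at the points with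
trivial stabilizer: the projection is étale there, and these points are dense. -/
theorem TwoForm.IsSymplectic.pullsBack [Finite G] {ω : TwoForm G U} {ω' : TwoForm G U'}
    (hω : ω.IsSymplectic) (hUo : IsOpen U) {φ : GermAut G}
    (hφU : φ.source ⊆ U) (hφU' : φ.target ⊆ U') {Φ : Space n → Space n}
    (hΦ : AnalyticOnNhd ℂ Φ (proj G ⁻¹' φ.source))
    (hφΦ : ∀ v, proj G v ∈ φ.source → φ.toOpenPartialHomeomorph (proj G v) = proj G (Φ v))
    (h : ∀ v, proj G v ∈ φ.source → IsFree G v → ∀ a b,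
      ω'.pull (Φ v) (fderiv ℂ Φ v a) (fderiv ℂ Φ v b) = ω.pull v a b) :
    φ.PullsBack ω' ω := by
  refine ⟨hφU, hφU', fun e e' x hxφ hxe hxe' => ?_⟩
  have hN : IsOpen (φ.source ∩ φ.toOpenPartialHomeomorph ⁻¹' e'.source) :=
    φ.toOpenPartialHomeomorph.isOpen_inter_preimage e'.open_source
  set Ψ : Space n → Space n := e'.toOpenPartialHomeomorph ∘ φ.toOpenPartialHomeomorph ∘
    e.toOpenPartialHomeomorph.symm with hΨdef
  have hΨe : ∀ x ∈ e.source, Ψ (e.toOpenPartialHomeomorph x) =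
      e'.toOpenPartialHomeomorph (φ.toOpenPartialHomeomorph x) := fun x hx => by
    simp only [hΨdef, Function.comp_apply, e.left_inv hx]
  have hΨ : ∀ x ∈ e.source, x ∈ φ.source → φ.toOpenPartialHomeomorph x ∈ e'.source →
      AnalyticAt ℂ Ψ (e.toOpenPartialHomeomorph x) := fun x h1 h2 h3 => by
    refine e.analyticOnNhd_comp φ.open_source φ.holomorphic e' _ ⟨e.map_source h1, ?_⟩
    rw [mem_preimage, e.left_inv h1]
    exact ⟨h2, h3⟩
  -- At a free point the chart `e` has bijective derivative upstairs, because the form does not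
  -- degenerate there.
  have hfree : ∀ v, IsFree G v → proj G v ∈ e.source → proj G v ∈ φ.source →
      φ.toOpenPartialHomeomorph (proj G v) ∈ e'.source → ∀ a b,
      toBilin (Space n) (ω'.form e' (Ψ (e.toOpenPartialHomeomorph (proj G v))))
        (fderiv ℂ Ψ (e.toOpenPartialHomeomorph (proj G v)) a)
        (fderiv ℂ Ψ (e.toOpenPartialHomeomorph (proj G v)) b) =
      toBilin (Space n) (ω.form e (e.toOpenPartialHomeomorph (proj G v))) a b := by
    intro v hv h1 h2 h3
    have hpull := h v h2 hv
    have h3' : proj G (Φ v) ∈ e'.source := hφΦ v h2 ▸ h3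
    have hU' : proj G (Φ v) ∈ U' := hφΦ v h2 ▸ hφU' (φ.map_source h2)
    obtain ⟨-, -, -, hnd, -⟩ := hω.pull_of_isFree hUo (hφU h2) hv
    rw [ω.pull_eq (hφU h2) h1] at hnd
    rw [ω'.pull_eq hU' h3', ω.pull_eq (hφU h2) h1] at hpull
    simp only [TwoForm.pullChart_apply] at hpull hnd
    have hinj : Function.Injective (fderiv ℂ (e.toOpenPartialHomeomorph ∘ proj G) v) := by
      rw [injective_iff_map_eq_zero]
      intro a ha
      refine hnd a fun b => ?_
      rw [ha, map_zero]
      rfl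
    have hsurj : Function.Surjective (fderiv ℂ (e.toOpenPartialHomeomorph ∘ proj G) v) :=
      LinearMap.injective_iff_surjective.mp hinj
    have hchain : (fderiv ℂ Ψ (e.toOpenPartialHomeomorph (proj G v))).comp
        (fderiv ℂ (e.toOpenPartialHomeomorph ∘ proj G) v) =
        (fderiv ℂ (e'.toOpenPartialHomeomorph ∘ proj G) (Φ v)).comp (fderiv ℂ Φ v) := by
      have hl : HasFDerivAt (Ψ ∘ (e.toOpenPartialHomeomorph ∘ proj G)) _ v :=
        (hΨ _ h1 h2 h3).differentiableAt.hasFDerivAt.comp v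
          (e.analyticOnNhd_comp_proj v h1).differentiableAt.hasFDerivAt
      have hr : HasFDerivAt ((e'.toOpenPartialHomeomorph ∘ proj G) ∘ Φ) _ v :=
        (e'.analyticOnNhd_comp_proj _ h3').differentiableAt.hasFDerivAt.comp v
          (hΦ v h2).differentiableAt.hasFDerivAt
      refine hl.unique (hr.congr_of_eventuallyEq ?_)
      filter_upwards [continuous_proj.continuousAt.eventually (e.open_source.mem_nhds h1),
        continuous_proj.continuousAt.eventually (φ.open_source.mem_nhds h2)] with w hw1 hw2
      simp only [Function.comp_apply]
      rw [hΨe _ hw1, hφΦ w hw2]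
    intro a b
    obtain ⟨a, rfl⟩ := hsurj a
    obtain ⟨b, rfl⟩ := hsurj b
    rw [← hpull, hΨe _ h1, hφΦ v h2]
    have hc : ∀ c, fderiv ℂ Ψ (e.toOpenPartialHomeomorph (proj G v))
        (fderiv ℂ (e.toOpenPartialHomeomorph ∘ proj G) v c) =
        fderiv ℂ (e'.toOpenPartialHomeomorph ∘ proj G) (Φ v) (fderiv ℂ Φ v c) := fun c =>
      congrArg (fun T : Space n →L[ℂ] Space n => T c) hchain
    rw [hc, hc]
  obtain ⟨v, rfl⟩ := proj_surjective x
  rw [← hΨe _ hxe]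
  refine ext_of_toBilin fun a b => ?_
  rw [toBilin_compContinuousLinearMap]
  have hcont : ContinuousAt (fun w => e.toOpenPartialHomeomorph (proj G w)) v :=
    (e.analyticOnNhd_comp_proj v hxe).continuousAt
  have hΨx := hΨ _ hxe hxφ hxe'
  have hform' : ContinuousAt (ω'.form e') (Ψ (e.toOpenPartialHomeomorph (proj G v))) := by
    rw [hΨe _ hxe]
    refine (ω'.holomorphic e' _ ⟨e'.map_source hxe', ?_⟩).continuousAt
    rw [mem_preimage, e'.left_inv hxe']
    exact hφU' (φ.map_source hxφ)
  have hform : ContinuousAt (ω.form e) (e.toOpenPartialHomeomorph (proj G v)) := by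
    refine (ω.holomorphic e _ ⟨e.map_source hxe, ?_⟩).continuousAt
    rw [mem_preimage, e.left_inv hxe]
    exact hφU hxφ
  have hl : ContinuousAt (fun y => toBilin (Space n) (ω'.form e' (Ψ y)) (fderiv ℂ Ψ y a)
      (fderiv ℂ Ψ y b)) (e.toOpenPartialHomeomorph (proj G v)) := by
    have h1 : ContinuousAt (fun y => ω'.form e' (Ψ y)) (e.toOpenPartialHomeomorph (proj G v)) :=
      ContinuousAt.comp (g := ω'.form e') hform' hΨx.continuousAt
    have h2 := hΨx.fderiv.continuousAt
    have h3 : ContinuousAt (fun y => toBilin (Space n) (ω'.form e' (Ψ y)))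
        (e.toOpenPartialHomeomorph (proj G v)) :=
      (toBilin (Space n)).continuous.continuousAt.comp h1
    exact (h3.clm_apply (h2.clm_apply continuousAt_const)).clm_apply
      (h2.clm_apply continuousAt_const)
  have hr : ContinuousAt (fun y => toBilin (Space n) (ω.form e y) a b)
      (e.toOpenPartialHomeomorph (proj G v)) := by
    have h3 : ContinuousAt (fun y => toBilin (Space n) (ω.form e y))
        (e.toOpenPartialHomeomorph (proj G v)) :=
      (toBilin (Space n)).continuous.continuousAt.comp hform
    exact (h3.clm_apply continuousAt_const).clm_apply continuousAt_const
  refine tendsto_nhds_unique_of_frequently_eq (hl.comp (f := fun w =>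
    e.toOpenPartialHomeomorph (proj G w)) hcont) (hr.comp (f := fun w =>
    e.toOpenPartialHomeomorph (proj G w)) hcont) ?_
  refine ((mem_closure_iff_frequently.mp (dense_isFree (G := G) v)).and_eventually
    (continuous_proj.continuousAt.eventually
      ((e.open_source.inter hN).mem_nhds ⟨hxe, hxφ, hxe'⟩))).mono fun w hw => ?_
  exact hfree w hw.1 hw.2.1 hw.2.2.1 hw.2.2.2 a b

end Comparison

end QuotSing

open QuotSing Set Filter

theorem mainTheorem9 (n : ℕ) (G : Subgroup (Matrix.symplecticGroup (Fin n) ℂ)) [Finite G]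
    (U U' : Set (QuotSing.OrbitSpace G))
    (hU : IsOpen U) (h0U : QuotSing.origin G ∈ U)
    (hU' : IsOpen U') (h0U' : QuotSing.origin G ∈ U')
    (ω : QuotSing.TwoForm G U) (hω : ω.IsSymplectic)
    (ω' : QuotSing.TwoForm G U') (hω' : ω'.IsSymplectic) :
    ∃ φ : QuotSing.GermAut G, φ.PullsBack ω' ω := by
  obtain ⟨B, hB, hskew, hclosed, hnd, hL, hBpull⟩ := hω.exists_extension hU h0U
  obtain ⟨B', hB', hskew', hclosed', hnd', hL', hBpull'⟩ := hω'.exists_extension hU' h0U'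
  obtain ⟨Φ, hΦ, hΦ0, hΦB, hΦL⟩ := exists_equivariant_equivalence
    (fun g : G => act (g : Matrix.symplecticGroup (Fin n) ℂ))
    hB hskew hclosed hnd hL hB' hskew' hclosed' hnd' hL'
  obtain ⟨E, h0E, hEΦ, hE⟩ := exists_openPartialHomeomorph hΦ
    (injective_of_pullback hnd hΦB.self_of_nhds)
  have hΦt : Tendsto Φ (𝓝 0) (𝓝 0) := by
    have := hΦ.continuousAt.tendsto
    rwa [hΦ0] at this
  have hproj : ∀ {U : Set (OrbitSpace G)}, IsOpen U → origin G ∈ U →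
      ∀ᶠ x in 𝓝 (0 : Space n), proj G x ∈ U := fun hU h0 =>
    (hU.preimage continuous_proj).mem_nhds h0
  rw [hΦ0] at hE
  have hgood : ∀ᶠ x in 𝓝 (0 : Space n), x ∈ E.source ∧ AnalyticAt ℂ Φ x ∧
      AnalyticAt ℂ E.symm (Φ x) ∧
      (∀ g ∈ G, Φ (act g x) = act g (Φ x)) ∧
      (∀ a b, B' (Φ x) (fderiv ℂ Φ x a) (fderiv ℂ Φ x b) = B x a b) ∧
      (IsFree G x → B x = ω.pull x) ∧ (IsFree G (Φ x) → B' (Φ x) = ω'.pull (Φ x)) ∧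
      proj G x ∈ U ∧ proj G (Φ x) ∈ U' := by
    filter_upwards [E.open_source.mem_nhds h0E, hΦ.eventually_analyticAt,
      hΦt.eventually hE.eventually_analyticAt, eventually_all.mpr hΦL, hΦB, hBpull,
      hΦt.eventually hBpull', hproj hU h0U, hΦt.eventually (hproj hU' h0U')]
      with x h1 h2 h3 h4 h5 h6 h7 h8 h9
    exact ⟨h1, h2, h3, fun g hg => h4 ⟨g, hg⟩, h5, h6, h7, h8, h9⟩
  obtain ⟨N, hN, hNo, h0N⟩ := eventually_nhds_iff.mp hgood
  -- The largest invariant subset of the neighbourhood `N`.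
  let W : Set (Space n) := ⋂ g : G, act (g : Matrix.symplecticGroup (Fin n) ℂ) ⁻¹' N
  have hWo : IsOpen W := isOpen_iInter_of_finite fun g => hNo.preimage (act g.1).continuous
  have h0W : (0 : Space n) ∈ W := mem_iInter.mpr fun g => by
    rw [mem_preimage, map_zero]
    exact h0N
  have hWN : ∀ v ∈ W, v ∈ N := fun v hv => by
    have := mem_iInter.mp hv 1
    rwa [mem_preimage, OneMemClass.coe_one, act_one_apply] at this
  have hWact : ∀ g ∈ G, ∀ v ∈ W, act g v ∈ W := fun g hg v hv => mem_iInter.mpr fun h => by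
    have := mem_iInter.mp hv (h * ⟨g, hg⟩)
    rwa [mem_preimage, Subgroup.coe_mul, act_mul_apply] at this
  let E' : OpenPartialHomeomorph (Space n) (Space n) := E.restrOpen W hWo
  have hE'E : ∀ v, E' v = Φ v := hEΦ
  have hEfun : (E' : Space n → Space n) = Φ := funext hE'E
  have hE'W : ∀ v, v ∈ E'.source ↔ v ∈ W := fun v =>
    ⟨fun hv => hv.2, fun hv => ⟨(hN v (hWN v hv)).1, hv⟩⟩
  have hequiv : IsEquivariantOn G E' E'.source := by
    refine ⟨fun g hg v hv => (hE'W _).mpr (hWact g hg v ((hE'W v).mp hv)), fun g hg v hv => ?_⟩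
    rw [hE'E, hE'E]
    exact (hN v (hWN v ((hE'W v).mp hv))).2.2.2.1 g hg
  have hana : AnalyticOnNhd ℂ Φ E'.source := fun v hv =>
    (hN v (hWN v ((hE'W v).mp hv))).2.1
  have hana' : AnalyticOnNhd ℂ E'.symm E'.target := fun w hw => by
    have h1 := (hN _ (hWN _ ((hE'W _).mp (E'.map_target hw)))).2.2.1
    rw [← hE'E, E'.right_inv hw] at h1
    exact h1
  obtain ⟨φ, hφs, hφt, hφ⟩ := exists_germAut E' hequiv ((hE'W 0).mpr h0W)
    ((hE'E 0).trans hΦ0) (hEfun ▸ hana) hana'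
  have hmem : ∀ {v}, proj G v ∈ φ.source → v ∈ E'.source := fun hv => by
    rw [hφs] at hv
    exact hequiv.proj_mem_image_iff.mp hv
  refine ⟨φ, hω.pullsBack hU (Φ := Φ) ?_ ?_ (fun v hv => hana v (hmem hv))
    (fun v hv => hE'E v ▸ hφ v (hmem hv)) fun v hv hfree a b => ?_⟩
  · rw [hφs]
    rintro _ ⟨v, hv, rfl⟩
    exact (hN v (hWN v ((hE'W v).mp hv))).2.2.2.2.2.2.2.1
  · rw [hφt]
    rintro _ ⟨w, hw, rfl⟩
    have h1 := (hN _ (hWN _ ((hE'W _).mp (E'.map_target hw)))).2.2.2.2.2.2.2.2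
    rwa [← hE'E, E'.right_inv hw] at h1
  · have hvs := hmem hv
    obtain ⟨-, -, -, -, hpull, h1, h2, -⟩ := hN v (hWN v ((hE'W v).mp hvs))
    have hfree' : IsFree G (Φ v) := fun g hg hgv => by
      refine hfree g hg (E'.injOn (hequiv.invariant g hg v hvs) hvs ?_)
      rw [hequiv.equivariant g hg v hvs, hE'E, hgv]
    rw [← h1 hfree, ← h2 hfree', hpull]
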